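/- Let $F$ be the function field of a complete, smooth, geometrically irreducible curve $X$ over a finite field $\mathbb{F}_q$, let $\infty$ be a closed point of $X$ (a place of $F/\mathbb{F}_q$), let $A\subset F$ be the ring of functions regular everywhere except possibly at $\infty$, and let $F_\infty$ be the completion of $F$ at $\infty$. Let $\hat A=\prod_{v\neq\infty}A_v$ be the product of the completions of $A$ at the places $v\ne\infty$ and $\mathbb{A}_A=\hat A\otimes_A F$. Let $\mathbf{C}$ be an algebraically closed field, complete with respect to a non-trivial absolute value, and containing $F_\infty$ (with a continuous embedding). Let $D$ be a central simple $F$-algebra of dimension $d^2$, unramified at $\infty$; choose an isomorphism $\theta: D\otimes_F F_\infty\cong M(d,F_\infty)$, and let $O_D$ be a maximal $A$-order in $D$. Write $D^*(\mathbb{A}_A)=(D\otimes_F\mathbb{A}_A)^*$, let $U\subset D^*(\mathbb{A}_A)$ be the image of $(O_D\otimes_A\hat A)^*$, and let $\Omega^d(\mathbf{C})$ be the Drinfeld symmetric space, i.e. the set of points of $\mathbb{P}^{d-1}(\mathbf{C})$ that lie on no $F_\infty$-rational hyperplane. The group $D^*$ acts on $\Omega^d(\mathbf{C})$ through $\theta$,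 on $D^*(\mathbb{A}_A)/U$ by left multiplication, and diagonally on the product. Consider pairs $(V,\Lambda)$, where $V$ is a $d$-dimensional $\mathbf{C}$-linear representation of the $F$-algebra $D$ (so $F$ acts through $F\subset\mathbf{C}$) and $\Lambda\subset V$ is an $O_D$-lattice, i.e. a discrete, projective $O_D$-submodule of rank one (its $F$-span $F\Lambda$ satisfies $\dim_F F\Lambda=\dim_F D$). Isomorphisms of pairs are the $\mathbf{C}$- and $D$-linear isomorphisms carrying one lattice onto the other. Then there is a bijection $$\{\text{pairs }(V,\Lambda)\}/\!\cong\ \longrightarrow\ D^*\backslash\left[\Omega^d(\mathbf{C})\times D^*(\mathbb{A}_A)/U\right]$$ which is natural in the following sense. For a pair $(V,\Lambda)$, a point $z\in\Omega^d(\mathbf{C})$ and $g\in D^*(\mathbb{A}_A)$, the class of $(V,\Lambda)$ is sent to the double coset of $(z,g)$ if and only if there are a $\mathbf{C}$-linear isomorphism $\psi:V\to\mathbf{C}^d$, equivariant for the action of $D$ on $\mathbf{C}^d$ given by $\theta$, and a generator $w$ of the $D$-module $F\Lambda$, such that $z=[\psi(w)]$ and such that $L=\{x\in D: xw\in\Lambda\}$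 satisfies $\hat A L=(O_D\otimes_A\hat A)\,g^{-1}$ inside $D\otimes_F\mathbb{A}_A$. -/

import Mathlib

open scoped TensorProduct LinearAlgebra.Projectivization

noncomputable section

universe u

namespace DLattice

/-! ### The curve, seen through its function field -/

/-- `F` is the function field of a complete, smooth, geometrically irreducible curve over the
finite field `Fq`: it is finitely generated of transcendence degree one over `Fq` (a finite
extension of some `Fq(t)`, with `t` transcendental), and `Fq` is algebraically closed in `F`. -/
structure IsCurveFunctionField (Fq F : Type*) [Field Fq] [Field F] [Algebra Fq F] : Prop where
  exists_finite : ∃ t : F, Transcendental Fq t ∧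
    FiniteDimensional (IntermediateField.adjoin Fq {t}) F
  constants : ∀ x : F, IsAlgebraic Fq x → x ∈ Set.range (algebraMap Fq F)

/-- A place of `F` over `Fq`, that is, a closed point of the curve with function field `F`, given
by its local ring: a valuation ring of `F`, different from `F`, that contains `Fq`. -/
structure Place (Fq F : Type*) [Field Fq] [Field F] [Algebra Fq F]
    extends ValuationSubring F where
  algebraMap_mem' : ∀ c : Fq, algebraMap Fq F c ∈ toValuationSubring
  ne_top' : toValuationSubring ≠ ⊤

namespace Place

variable {Fq F : Type*} [Field Fq] [Field F] [Algebra Fq F]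

/-- The completion `F_v` of `F` at the place `v`. -/
def Completion (v : Place Fq F) : Type _ := v.toValuationSubring.valuation.Completion

instance (v : Place Fq F) : Field v.Completion :=
  inferInstanceAs (Field v.toValuationSubring.valuation.Completion)

instance (v : Place Fq F) : Valued v.Completion v.toValuationSubring.ValueGroup :=
  inferInstanceAs (Valued v.toValuationSubring.valuation.Completion
    v.toValuationSubring.ValueGroup)

/-- The natural embedding of `F` in its completion `F_v`. -/
def toCompletion (v : Place Fq F) : F →+* v.Completion :=
  (UniformSpace.Completion.coeRingHom
    (α := WithVal v.toValuationSubring.valuation)).comp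
    (WithVal.equiv v.toValuationSubring.valuation).symm.toRingHom

instance (v : Place Fq F) : Algebra F v.Completion := v.toCompletion.toAlgebra

theorem valued_toCompletion (v : Place Fq F) (x : F) :
    Valued.v (v.toCompletion x) = v.toValuationSubring.valuation x :=
  Valued.valuedCompletion_apply _

/-- The ring of integers of `F_v`, which is the completion of the local ring at `v`. -/
def integers (v : Place Fq F) : Subring v.Completion :=
  (Valued.v : Valuation v.Completion v.toValuationSubring.ValueGroup).integer

variable (p : Place Fq F)

/-- The ring `A` of the functions in `F` that are regular everywhere except possibly at `p`. -/
def regularRing : Subalgebra Fq F where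
  carrier := {x | ∀ v : Place Fq F, v ≠ p → x ∈ v.toValuationSubring}
  mul_mem' hx hy v hv := mul_mem (hx v hv) (hy v hv)
  add_mem' hx hy v hv := add_mem (hx v hv) (hy v hv)
  algebraMap_mem' c v _ := v.algebraMap_mem' c

/-- The ring `Â`, the product of the completions `A_v` over all the places `v ≠ p`. -/
abbrev HatRing : Type _ := ∀ v : {v : Place Fq F // v ≠ p}, v.1.integers

/-- The diagonal map from `A` to `Â`. -/
def toHatRing : p.regularRing →+* p.HatRing :=
  RingHom.pi fun v =>
    (v.1.toCompletion.comp p.regularRing.val.toRingHom).codRestrict v.1.integers (by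
      intro x
      refine (Valuation.mem_integer_iff _ _).2 ?_
      have h : (x : F) ∈ v.1.toValuationSubring := x.2 v.1 v.2
      exact (valued_toCompletion v.1 (x : F)).le.trans
        ((ValuationSubring.valuation_le_one_iff _ _).2 h))

instance : Algebra p.regularRing p.HatRing := p.toHatRing.toAlgebra

/-- The ring of adeles away from `p`, namely `Â ⊗ F` (over `A`). -/
abbrev AdeleRing : Type _ := F ⊗[p.regularRing] p.HatRing

end Place

section Algebra

variable {Fq F : Type*} [Field Fq] [Field F] [Algebra Fq F] (p : Place Fq F)
variable {D : Type*} [Ring D] [Algebra F D]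

/-- An `A`-order in `D`: a subring containing `A` that is finitely generated as an `A`-module and
spans `D` over `F`. -/
structure IsOrder (O : Subalgebra p.regularRing D) : Prop where
  finite : Module.Finite p.regularRing O
  span_eq_top : Submodule.span F (O : Set D) = ⊤

/-- A maximal `A`-order in `D`. -/
def IsMaximalOrder (O : Subalgebra p.regularRing D) : Prop :=
  Maximal (IsOrder p) O

variable (D)

/-- The ring `D ⊗_F 𝔸_A`; its unit group is `D^*(𝔸_A)`. -/
abbrev AdelicAlgebra : Type _ := D ⊗[F] p.AdeleRing

/-- The homomorphism from `D^*` to `D^*(𝔸_A)`. -/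
def unitsToAdelic : Dˣ →* (AdelicAlgebra p D)ˣ :=
  Units.map (Algebra.TensorProduct.includeLeftRingHom : D →+* AdelicAlgebra p D).toMonoidHom

variable {D}

/-- The natural homomorphism from `O ⊗_A Â` to `D ⊗_F 𝔸_A`, sending `x ⊗ a` to
`x ⊗ (1 ⊗ a)`. -/
def hatOrderMap (O : Subalgebra p.regularRing D) :
    O ⊗[p.regularRing] p.HatRing →ₐ[p.regularRing] AdelicAlgebra p D :=
  Algebra.TensorProduct.lift
    ((Algebra.TensorProduct.includeLeft : D →ₐ[p.regularRing] AdelicAlgebra p D).comp O.val)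
    (((Algebra.TensorProduct.includeRight :
        p.AdeleRing →ₐ[F] AdelicAlgebra p D).restrictScalars p.regularRing).comp
      (Algebra.TensorProduct.includeRight : p.HatRing →ₐ[p.regularRing] p.AdeleRing))
    (by
      intro x a
      change ((x : D) ⊗ₜ[F] (1 : p.AdeleRing)) * ((1 : D) ⊗ₜ[F] ((1 : F) ⊗ₜ[p.regularRing] a)) =
        ((1 : D) ⊗ₜ[F] ((1 : F) ⊗ₜ[p.regularRing] a)) * ((x : D) ⊗ₜ[F] (1 : p.AdeleRing))
      rw [Algebra.TensorProduct.tmul_mul_tmul, Algebra.TensorProduct.tmul_mul_tmul, mul_one,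
        mul_one, one_mul, one_mul])

theorem hatOrderMap_tmul (O : Subalgebra p.regularRing D) (x : O) (a : p.HatRing) :
    hatOrderMap p O (x ⊗ₜ a) = (x : D) ⊗ₜ[F] ((1 : F) ⊗ₜ[p.regularRing] a) := by
  change ((x : D) ⊗ₜ[F] (1 : p.AdeleRing)) * ((1 : D) ⊗ₜ[F] ((1 : F) ⊗ₜ[p.regularRing] a)) = _
  rw [Algebra.TensorProduct.tmul_mul_tmul, mul_one, one_mul]

/-- The subgroup `U = (O ⊗_A Â)^*` of `D^*(𝔸_A)`. -/
def levelSubgroup (O : Subalgebra p.regularRing D) : Subgroup (AdelicAlgebra p D)ˣ :=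
  (Units.map (hatOrderMap p O).toRingHom.toMonoidHom).range

/-- For a subset `L` of `D`, the additive subgroup `ÂL` of `D ⊗_F 𝔸_A`. -/
def adelicSpan (L : Set D) : AddSubgroup (AdelicAlgebra p D) :=
  AddSubgroup.closure
    {y | ∃ x ∈ L, ∃ a : p.HatRing, y = x ⊗ₜ[F] ((1 : F) ⊗ₜ[p.regularRing] a)}

end Algebra

section Analytic

variable {Fq F : Type*} [Field Fq] [Field F] [Algebra Fq F] {p : Place Fq F}
variable (C : Type u) [NontriviallyNormedField C] [Algebra p.Completion C]
variable (d : ℕ)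

variable (p) in
/-- The Drinfeld symmetric space `Ω^d(C)`: the points of `ℙ^{d-1}(C)` that lie on no hyperplane
that is rational over `F_∞`. -/
def drinfeldSpace : Set (ℙ C (Fin d → C)) :=
  {x | ∀ c : Fin d → p.Completion, c ≠ 0 →
    ∑ i, algebraMap p.Completion C (c i) * x.rep i ≠ 0}

theorem mk_mem_drinfeldSpace {z : Fin d → C} (hz : z ≠ 0) :
    Projectivization.mk C z hz ∈ drinfeldSpace p C d ↔
      ∀ c : Fin d → p.Completion, c ≠ 0 → ∑ i, algebraMap p.Completion C (c i) * z i ≠ 0 := by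
  obtain ⟨a, ha⟩ := Projectivization.exists_smul_eq_mk_rep C z hz
  have key : ∀ c : Fin d → p.Completion,
      ∑ i, algebraMap p.Completion C (c i) * (Projectivization.mk C z hz).rep i =
        (a : C) * ∑ i, algebraMap p.Completion C (c i) * z i := by
    intro c
    rw [← ha, Finset.mul_sum]
    refine Finset.sum_congr rfl fun i _ => ?_
    simp only [Pi.smul_apply, Units.smul_def, smul_eq_mul]
    ring
  simp only [drinfeldSpace, Set.mem_ofPred_eq, key, ne_eq, mul_eq_zero, Units.ne_zero, false_or]

variable {d} {D : Type*} [Ring D] [Algebra F D]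
variable (θ : p.Completion ⊗[F] D ≃ₐ[p.Completion] Matrix (Fin d) (Fin d) p.Completion)

/-- The `d`-dimensional representation of `D` over `C` given by
`θ : D ⊗_F F_∞ ≅ M(d, F_∞)`. -/
def stdRep : D →+* Matrix (Fin d) (Fin d) C :=
  (algebraMap p.Completion C).mapMatrix.comp
    (θ.toRingEquiv.toRingHom.comp
      (Algebra.TensorProduct.includeRight : D →ₐ[F] p.Completion ⊗[F] D).toRingHom)

/-- The induced homomorphism from `D^*` to `GL_d(C)`. -/
def unitsToGL : Dˣ →* LinearMap.GeneralLinearGroup C (Fin d → C) :=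
  (Matrix.GeneralLinearGroup.toLin : Matrix.GeneralLinearGroup (Fin d) C ≃* _).toMonoidHom.comp
    (Units.map (stdRep C θ).toMonoidHom)

theorem smul_mem_drinfeldSpace (δ : Dˣ) {x : ℙ C (Fin d → C)} (hx : x ∈ drinfeldSpace p C d) :
    unitsToGL C θ δ • x ∈ drinfeldSpace p C d := by
  induction x using Projectivization.ind with
  | h z hz =>
    rw [mk_mem_drinfeldSpace] at hx
    rw [Projectivization.smul_mk, mk_mem_drinfeldSpace]
    intro c hc h0
    set N : D → Matrix (Fin d) (Fin d) p.Completion := fun y => θ (1 ⊗ₜ y) with hN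
    have hNmul : N δ * N (δ⁻¹ : Dˣ) = 1 := by
      simp only [hN, ← map_mul, Algebra.TensorProduct.tmul_mul_tmul, mul_one, Units.mul_inv]
      exact map_one θ
    refine hx (Matrix.vecMul c (N δ)) ?_ ?_
    · intro h
      apply hc
      have := congrArg (fun w => Matrix.vecMul w (N (δ⁻¹ : Dˣ))) h
      simpa [Matrix.vecMul_vecMul, hNmul] using this
    · have hact : unitsToGL C θ δ • z =
          Matrix.mulVec ((N δ).map (algebraMap p.Completion C)) z := rfl
      rw [hact] at h0
      rw [← h0]
      simp only [Matrix.vecMul, Matrix.mulVec, dotProduct, map_sum, map_mul, Matrix.map_apply,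
        Finset.sum_mul, Finset.mul_sum]
      rw [Finset.sum_comm]
      refine Finset.sum_congr rfl fun i _ => Finset.sum_congr rfl fun j _ => ?_
      ring

/-- The product `Ω^d(C) × D^*(𝔸_A)/U`. -/
def PeriodSpace (_θ : p.Completion ⊗[F] D ≃ₐ[p.Completion] Matrix (Fin d) (Fin d) p.Completion)
    (O : Subalgebra p.regularRing D) : Type _ :=
  drinfeldSpace p C d × ((AdelicAlgebra p D)ˣ ⧸ levelSubgroup p O)

/-- The diagonal action of `D^*` on `Ω^d(C) × D^*(𝔸_A)/U`, on the first factor through `θ`, on the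
second by left multiplication. -/
instance (O : Subalgebra p.regularRing D) : MulAction Dˣ (PeriodSpace C θ O) where
  smul δ x := (⟨unitsToGL C θ δ • x.1.1, smul_mem_drinfeldSpace C θ δ x.1.2⟩,
    unitsToAdelic p D δ • x.2)
  one_smul x := by
    refine Prod.ext (Subtype.ext ?_) ?_
    · change unitsToGL C θ 1 • x.1.1 = x.1.1
      rw [map_one, one_smul]
    · change unitsToAdelic p D 1 • x.2 = x.2
      rw [map_one, one_smul]
  mul_smul δ ε x := by
    refine Prod.ext (Subtype.ext ?_) ?_
    · change unitsToGL C θ (δ * ε) • x.1.1 = unitsToGL C θ δ • unitsToGL C θ ε • x.1.1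
      rw [map_mul, mul_smul]
    · change unitsToAdelic p D (δ * ε) • x.2 = unitsToAdelic p D δ • unitsToAdelic p D ε • x.2
      rw [map_mul, mul_smul]

/-- The set of double cosets `D^* \ [Ω^d(C) × D^*(𝔸_A)/U]`. -/
def DoubleCosets (O : Subalgebra p.regularRing D) : Type _ :=
  MulAction.orbitRel.Quotient Dˣ (PeriodSpace C θ O)

/-- The double coset of the pair `(z, g)`. -/
def DoubleCosets.mk (O : Subalgebra p.regularRing D) (z : drinfeldSpace p C d)
    (g : (AdelicAlgebra p D)ˣ) : DoubleCosets C θ O :=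
  Quotient.mk (MulAction.orbitRel Dˣ (PeriodSpace C θ O)) (z, QuotientGroup.mk g)

end Analytic

section Pairs

variable {Fq F : Type*} [Field Fq] [Field F] [Algebra Fq F] {p : Place Fq F}
variable (C : Type u) [NontriviallyNormedField C] [Algebra F C]
variable {D : Type*} [Ring D] [Algebra F D]
variable (d : ℕ) (O : Subalgebra p.regularRing D)

/-- A pair `(V, Λ)`: a `d`-dimensional `C`-linear representation `V` of the `F`-algebra `D` (the
subfield `F` of `D` acts through the embedding of `F` in `C`), and an `O`-lattice `Λ` in `V`, that
is, an `O`-submodule which is discrete (for the canonical topology of a finite-dimensional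
`C`-vector space), projective over `O`, and of rank one over `O`. -/
structure LatticePair where
  V : Type u
  [addCommGroup : AddCommGroup V]
  [moduleC : Module C V]
  [moduleF : Module F V]
  [moduleD : Module D V]
  [smulComm : SMulCommClass D C V]
  [towerC : IsScalarTower F C V]
  [towerD : IsScalarTower F D V]
  finrank_eq : Module.finrank C V = d
  lattice : Submodule O V
  discrete : letI := moduleTopology C V; DiscreteTopology lattice
  projective : Module.Projective O lattice
  rank_one : Module.finrank F (Submodule.span F (lattice : Set V)) = Module.finrank F D

attribute [instance] LatticePair.addCommGroup LatticePair.moduleC LatticePair.moduleF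
  LatticePair.moduleD LatticePair.smulComm LatticePair.towerC LatticePair.towerD

variable {C d O}

/-- Isomorphism of pairs: a `C`-linear and `D`-linear isomorphism carrying one lattice onto the
other. -/
def LatticePair.Iso (P Q : LatticePair C d O) : Prop :=
  ∃ e : P.V ≃ₗ[C] Q.V, (∀ (x : D) (v : P.V), e (x • v) = x • e v) ∧
    e '' (P.lattice : Set P.V) = Q.lattice

variable (C d O)

instance LatticePair.setoid : Setoid (LatticePair C d O) where
  r := LatticePair.Iso
  iseqv :=
    { refl := fun P => ⟨LinearEquiv.refl C P.V, fun _ _ => rfl, Set.image_id _⟩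
      symm := by
        rintro P Q ⟨e, he, hl⟩
        refine ⟨e.symm, fun x v => ?_, ?_⟩
        · apply e.injective
          rw [he, e.apply_symm_apply, e.apply_symm_apply]
        · rw [← hl, Set.image_image]
          simp only [LinearEquiv.symm_apply_apply, Set.image_id']
      trans := by
        rintro P Q R ⟨e, he, hl⟩ ⟨f, hf, hm⟩
        refine ⟨e.trans f, fun x v => ?_, ?_⟩
        · simp [he, hf]
        · rw [← hm, ← hl, ← Set.image_comp]
          rfl }

/-- The set of isomorphism classes of pairs `(V, Λ)`. -/
def PairClasses : Type _ := Quotient (LatticePair.setoid C d O)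

/-- The isomorphism class of a pair. -/
def PairClasses.mk (P : LatticePair C d O) : PairClasses C d O :=
  Quotient.mk (LatticePair.setoid C d O) P

variable {C d O}

/-- `(z, g)` is obtained from the pair `(V, Λ)` as follows. Choose an isomorphism `ψ` of `V` with
the representation of `D` on `C^d` given by `θ`, and a generator `w` of the `F`-span of `Λ` as a
`D`-module. Then `z` is the point of projective space marked by `ψ w`, and `Λ = Lw` for a lattice
`L` in `D` whose adelic span `ÂL` equals `(O ⊗ Â) g⁻¹`. -/
def LatticePair.HasPeriod [Algebra p.Completion C]
    (θ : p.Completion ⊗[F] D ≃ₐ[p.Completion] Matrix (Fin d) (Fin d) p.Completion)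
    (P : LatticePair C d O) (z : drinfeldSpace p C d) (g : (AdelicAlgebra p D)ˣ) : Prop :=
  ∃ (ψ : P.V ≃ₗ[C] (Fin d → C)) (w : P.V) (hw : ψ w ≠ 0),
    (∀ (x : D) (v : P.V), ψ (x • v) = Matrix.mulVec (stdRep C θ x) (ψ v)) ∧
    (Submodule.span F (P.lattice : Set P.V) : Set P.V) = Set.range (fun x : D => x • w) ∧
    (z : ℙ C (Fin d → C)) = Projectivization.mk C (ψ w) hw ∧
    (adelicSpan p {x : D | x • w ∈ P.lattice} : Set (AdelicAlgebra p D)) =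
      {y | ∃ u, y = hatOrderMap p O u * ((g⁻¹ : (AdelicAlgebra p D)ˣ) : AdelicAlgebra p D)}

end Pairs

end DLattice

end

/-! Let `(V, Λ)` be a pair. The `D`-module `FΛ` has the dimension of the simple Artinian algebra
`D`, so it is free of rank one, with a generator `w`. The space `V` is a module over the matrix
algebra `F_∞ ⊗ D`, so it is isomorphic to `C^d` by some `ψ`, unique up to a scalar by Schur's lemma.
Hence `Λ = Lw` for a projective `O`-lattice `L` in `D`, and the pair is recorded by `z = [ψ w]` and
`L`. The scalar in `ψ` does not move `z`; replacing `w` by `δw` with `δ ∈ D^*` replaces `(z, L)` by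
`(δz, Lδ⁻¹)`. It remains to see which `z` occur, and to describe the lattices `L` adelically.

Points: `Lw` is discrete exactly when `z` lies on no rational hyperplane. If `z` lies on none,
compactness of the unit vectors of `F_∞^d` gives `|Σ cᵢzᵢ| ≥ ε max |cᵢ|`; a lattice element that
moves `z` to a small vector then has small coordinates, with bounded denominators, and a small
element of `A` is zero (`exists_pos_forall_norm_lt`). If `Σ cᵢzᵢ = 0`, the matrix with all rows
equal to `c` kills `z`; approximating its multiples by elements of `L` yields infinitely many
lattice points in a compact set (`sum_ne_zero_of_discreteTopology`).

Lattices: `L ↦ g` with `ÂL = (O ⊗ Â)g⁻¹` matches projective lattices with cosets of `U`. From `g`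
the lattice is recovered as `D ∩ (O ⊗ Â)g⁻¹`, and approximating `g⁻¹` by elements of `L` shows that
it is locally generated by one element, hence projective (`projective_lattice`). Conversely a
projective `L` is locally principal (`exists_local_generator`). The proof of this is the ideal
theory of a maximal order: two-sided primes are invertible (`idealInverse_mul_annihilatorIn`), and
over a maximal ideal `P` of `A` there is only one, `M`, with a power inside `PO`
(`exists_annihilatorIn_pow_le`). Hence `L/ML` and `O/M` are powers of the same simple module, so
that one surjects onto the other, and Nakayama's lemma lifts the surjection. One generator serves
all primes dividing a given `a` (`exists_generator_modulo`); a non-zero scalar in `L` serves at the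
other places, and an idempotent of `Â` glues the two (`exists_unit_of_projective`).

Everything rests on the arithmetic of `A`: it is a Dedekind domain with finite quotients and field
of fractions `F`, it is discrete and cocompact in `F_∞`, and strong approximation holds away from
infinity. This is proved from valuation rings alone; a dimension count (`rank_quotient_mulLeft_lt`,
`finrank_le_finrank_inf_add`) takes the place of the Riemann–Roch theorem in finding a non-constant
element of `A`. -/

noncomputable section

/-! ### Places of a function field: independence, zeros and poles -/

namespace DLattice

open Polynomial

section FunctionField

variable {Fq F : Type*} [Field Fq] [Field F] [Algebra Fq F]

/-- The transcendence degree is at most one, so `x` alone is a transcendence basis. Then `F` is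
algebraic and essentially of finite type over `Fq(x)`, hence finite. -/
theorem IsCurveFunctionField.finiteDimensional_adjoin (hF : IsCurveFunctionField Fq F) {x : F}
    (hx : Transcendental Fq x) : FiniteDimensional (IntermediateField.adjoin Fq {x}) F := by
  obtain ⟨t, ht, hfin⟩ := hF.exists_finite
  have hess : Algebra.EssFiniteType Fq (IntermediateField.adjoin Fq {t}) :=
    IntermediateField.essFiniteType_iff.2 ⟨{t}, by simp⟩
  have hess' : Algebra.EssFiniteType Fq F :=
    Algebra.EssFiniteType.comp Fq (IntermediateField.adjoin Fq {t}) F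
  have halg : Algebra.IsAlgebraic (Algebra.adjoin Fq {t}) F := by
    have h1 : Algebra.IsAlgebraic (IntermediateField.adjoin Fq {t}) F := inferInstance
    open scoped IntermediateField.algebraAdjoinAdjoin in
    exact (IsFractionRing.comap_isAlgebraic_iff (A := Algebra.adjoin Fq {t})
      (K := IntermediateField.adjoin Fq {t})).2 h1
  have htr : Algebra.trdeg Fq F ≤ 1 := by
    simpa using Algebra.IsAlgebraic.trdeg_le_cardinalMk Fq {t}
  have hb : IsTranscendenceBasis Fq (fun _ : Unit => x) := by
    refine AlgebraicIndependent.isTranscendenceBasis_of_lift_trdeg_le_of_finite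
      (algebraicIndependent_unique_type_iff.2 hx) (by simpa using htr)
  have h2 := hb.isAlgebraic_field
  rw [Set.range_const] at h2
  have h3 : Algebra.EssFiniteType (IntermediateField.adjoin Fq {x}) F :=
    Algebra.EssFiniteType.of_comp Fq _ F
  exact Algebra.finite_of_essFiniteType_of_isAlgebraic

/-- A relation over `k(x)` can be cleared of denominators and of common powers of `x`. -/
theorem exists_polynomial_relation {x : F} {ι : Type*} [Fintype ι] (hx : x ≠ 0)
    {y : ι → F} (hy : ¬ LinearIndependent (IntermediateField.adjoin Fq {x}) y) :
    ∃ g : ι → Fq[X], (∃ i, (g i).coeff 0 ≠ 0) ∧ ∑ i, aeval x (g i) * y i = 0 := by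
  classical
  open scoped IntermediateField.algebraAdjoinAdjoin in
  rw [← LinearIndependent.iff_fractionRing (Algebra.adjoin Fq {x})] at hy
  rw [Fintype.not_linearIndependent_iff] at hy
  obtain ⟨c, hc, i, hi⟩ := hy
  have hc' : ∀ j, ∃ f : Fq[X], aeval x f = (c j : F) := fun j => by
    have h := Algebra.adjoin_singleton_eq_range_aeval Fq x
    have : (c j : F) ∈ (aeval (R := Fq) x).range := h ▸ (c j).2
    exact this
  choose f hf using hc'
  have hfi : f i ≠ 0 := by
    intro h
    apply hi
    apply Subtype.ext
    rw [← hf, h]; simp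
  have hsum : ∑ i, aeval x (f i) * y i = 0 := by
    rw [← hc]
    exact Finset.sum_congr rfl fun j _ => by rw [hf]; rfl
  clear hc hf hi c
  -- If all constant terms vanish, every coefficient is divisible by `X` and the relation can be
  -- divided by `x`. The degree of the non-zero coefficient `f i` drops, so this ends.
  induction hn : (f i).natDegree using Nat.strong_induction_on generalizing f with
  | _ n ih =>
    by_cases h0 : ∃ j, (f j).coeff 0 ≠ 0
    · exact ⟨f, h0, hsum⟩
    · push Not at h0
      have hX : ∀ j, f j = X * (f j).divX := fun j => by
        conv_lhs => rw [← X_mul_divX_add (f j), h0 j, C_0, add_zero]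
      have hdi : (f i).divX ≠ 0 := fun h => hfi (by rw [hX i, h, mul_zero])
      refine ih _ ?_ (fun j => (f j).divX) hdi ?_ rfl
      · rw [← hn]
        conv_rhs => rw [hX i]
        rw [natDegree_X_mul hdi]
        exact Nat.lt_succ_self _
      · have : x * ∑ j, aeval x (f j).divX * y j = 0 := by
          rw [← hsum, Finset.mul_sum]
          refine Finset.sum_congr rfl fun j _ => ?_
          conv_rhs => rw [hX j]
          simp only [map_mul, aeval_X, mul_assoc]
        exact (mul_eq_zero.1 this).resolve_left hx

theorem exists_integral_mul {x : F}
    (hfin : FiniteDimensional (IntermediateField.adjoin Fq {x}) F) (y : F) :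
    ∃ f : Fq[X], f ≠ 0 ∧ IsIntegral (Algebra.adjoin Fq {x}) (aeval x f * y) := by
  have halg : Algebra.IsAlgebraic (Algebra.adjoin Fq {x}) F := by
    have h1 : Algebra.IsAlgebraic (IntermediateField.adjoin Fq {x}) F := inferInstance
    open scoped IntermediateField.algebraAdjoinAdjoin in
    exact (IsFractionRing.comap_isAlgebraic_iff (A := Algebra.adjoin Fq {x})
      (K := IntermediateField.adjoin Fq {x})).2 h1
  obtain ⟨z, hz, hint⟩ := IsAlgebraic.exists_integral_multiple (halg.isAlgebraic y)
  have h := Algebra.adjoin_singleton_eq_range_aeval Fq x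
  have : (z : F) ∈ (aeval (R := Fq) x).range := h ▸ z.2
  obtain ⟨f, hf⟩ := this
  refine ⟨f, ?_, ?_⟩
  · rintro rfl
    apply hz
    apply Subtype.ext
    rw [← hf]; simp
  · have : aeval x f * y = z • y := by
      rw [Algebra.smul_def]; congr 1
    rwa [this]

theorem mul_lt_one_of_le_of_lt₀ {Γ : Type*} [LinearOrderedCommGroupWithZero Γ] {a b : Γ}
    (ha : a ≤ 1) (hb : b < 1) : a * b < 1 :=
  mul_lt_one_of_nonneg_of_lt_one_right ha zero_le hb

theorem mul_lt_one_of_lt_of_le₀ {Γ : Type*} [LinearOrderedCommGroupWithZero Γ] {a b : Γ}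
    (ha : a < 1) (hb : b ≤ 1) : a * b < 1 :=
  mul_lt_one_of_nonneg_of_lt_one_left zero_le ha hb

namespace Place

/-- The valuation of a place. -/
abbrev val (v : Place Fq F) : Valuation F v.toValuationSubring.ValueGroup :=
  v.toValuationSubring.valuation

theorem val_le_one_iff (v : Place Fq F) (x : F) : v.val x ≤ 1 ↔ x ∈ v.toValuationSubring :=
  ValuationSubring.valuation_le_one_iff _ _

theorem ext_of_toValuationSubring {v w : Place Fq F}
    (h : v.toValuationSubring = w.toValuationSubring) : v = w := by
  cases v; cases w; cases h; rfl

theorem val_algebraMap (v : Place Fq F) {c : Fq} (hc : c ≠ 0) : v.val (algebraMap Fq F c) = 1 := by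
  refine le_antisymm ((v.val_le_one_iff _).2 (v.algebraMap_mem' c)) ?_
  have h := (v.val_le_one_iff _).2 (v.algebraMap_mem' c⁻¹)
  rw [map_inv₀, map_inv₀] at h
  have h0 : 0 < v.val (algebraMap Fq F c) := by
    rw [zero_lt_iff, Valuation.ne_zero_iff]
    simpa using hc
  exact (inv_le_one₀ h0).1 h

theorem exists_one_lt_val (v : Place Fq F) : ∃ x, 1 < v.val x := by
  by_contra! h
  apply v.ne_top'
  rw [eq_top_iff]
  intro x _
  exact (v.val_le_one_iff x).1 (h x)

theorem transcendental_of_val_lt_one (hF : IsCurveFunctionField Fq F) (v : Place Fq F) {x : F}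
    (hx : x ≠ 0) (h : v.val x < 1) : Transcendental Fq x := by
  intro ha
  obtain ⟨c, rfl⟩ := hF.constants x ha
  have hc : c ≠ 0 := by rintro rfl; simp at hx
  rw [v.val_algebraMap hc] at h
  exact lt_irrefl _ h

/-- The local ring of a place, as an algebra over the constant field. -/
def subalgebra (v : Place Fq F) : Subalgebra Fq F where
  __ := v.toValuationSubring.toSubring
  algebraMap_mem' := v.algebraMap_mem'

theorem mem_subalgebra (v : Place Fq F) {x : F} : x ∈ v.subalgebra ↔ v.val x ≤ 1 :=
  (v.val_le_one_iff x).symm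

theorem val_aeval_le (v : Place Fq F) {x : F} (hx : v.val x ≤ 1) (f : Fq[X]) :
    v.val (aeval x f) ≤ 1 := by
  have h : aeval x f ∈ v.subalgebra :=
    (Algebra.adjoin_le (S := v.subalgebra) (by simpa [mem_subalgebra] using hx))
      (aeval_mem_adjoin_singleton Fq x)
  exact (v.mem_subalgebra).1 h

theorem val_aeval_eq_one (v : Place Fq F) {x : F} (hx : v.val x < 1) {f : Fq[X]}
    (hf : f.coeff 0 ≠ 0) : v.val (aeval x f) = 1 := by
  rw [← X_mul_divX_add f]
  simp only [map_add, map_mul, aeval_X, aeval_C]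
  rw [Valuation.map_add_eq_of_lt_right, v.val_algebraMap hf]
  rw [v.val_algebraMap hf, map_mul]
  exact mul_lt_one_of_lt_of_le₀ hx (v.val_aeval_le hx.le _)

theorem val_le_one_of_isIntegral (v : Place Fq F) {x : F} (hx : v.val x ≤ 1) {y : F}
    (hy : IsIntegral (Algebra.adjoin Fq {x}) y) : v.val y ≤ 1 := by
  rw [val_le_one_iff]
  have hle : Algebra.adjoin Fq {x} ≤ v.subalgebra :=
    Algebra.adjoin_le (by simpa [mem_subalgebra] using hx)
  have h1 : IsIntegral v.toValuationSubring y := by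
    obtain ⟨f, hf, hf0⟩ := hy
    let j : Algebra.adjoin Fq {x} →+* v.toValuationSubring :=
      (Subalgebra.inclusion hle).toRingHom
    refine ⟨f.map j, hf.map _, ?_⟩
    rw [eval₂_map]
    exact hf0
  obtain ⟨z, hz⟩ := (IsIntegrallyClosed.isIntegral_iff (R := v.toValuationSubring) (K := F)).1 h1
  rw [← hz]
  exact z.2

/-- The archimedean property of a place, used instead of discreteness. Some `f(x)y` is integral over
`Fq[x]`, hence bounded by 1 at `v`. Writing `f = X^k g` with `g(0) ≠ 0`, the factor `g(x)` is a unit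
at `v`, so `x^k y` is bounded by 1 as well. -/
theorem exists_pow_mul_le_one (hF : IsCurveFunctionField Fq F) (v : Place Fq F) {x : F}
    (hx : v.val x < 1) (y : F) : ∃ N : ℕ, ∀ n, N ≤ n → v.val (x ^ n * y) ≤ 1 := by
  by_cases hx0 : x = 0
  · refine ⟨1, fun n hn => ?_⟩
    rw [hx0, zero_pow (by omega)]; simp
  have htr := v.transcendental_of_val_lt_one hF hx0 hx
  obtain ⟨f, hf0, hf⟩ := exists_integral_mul (hF.finiteDimensional_adjoin htr) y
  have h1 := v.val_le_one_of_isIntegral hx.le hf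
  obtain ⟨g, hg⟩ := X_pow_dvd_iff.2 (fun d (hd : d < f.natTrailingDegree) =>
    coeff_eq_zero_of_lt_natTrailingDegree hd)
  have hg0 : g.coeff 0 ≠ 0 := by
    have : f.coeff f.natTrailingDegree = g.coeff 0 := by
      have h2 := coeff_X_pow_mul g f.natTrailingDegree 0
      rwa [← hg, zero_add] at h2
    rw [← this]
    exact trailingCoeff_nonzero_iff_nonzero.2 hf0
  refine ⟨f.natTrailingDegree, fun n hn => ?_⟩
  rw [hg, map_mul, map_mul, map_mul, v.val_aeval_eq_one hx hg0, mul_one, map_pow, aeval_X] at h1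
  obtain ⟨k, rfl⟩ := Nat.exists_eq_add_of_le hn
  rw [pow_add, mul_right_comm, map_mul, map_mul]
  exact mul_le_one' h1 (by rw [map_pow]; exact pow_le_one' hx.le _)

theorem exists_pow_mul_lt_one (hF : IsCurveFunctionField Fq F) (v : Place Fq F) {x : F}
    (hx : v.val x < 1) (y : F) : ∃ N : ℕ, ∀ n, N ≤ n → v.val (x ^ n * y) < 1 := by
  obtain ⟨N, hN⟩ := v.exists_pow_mul_le_one hF hx y
  refine ⟨N + 1, fun n hn => ?_⟩
  obtain ⟨k, rfl⟩ := Nat.exists_eq_add_of_le' (show 1 ≤ n by omega)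
  rw [pow_succ, mul_right_comm, map_mul]
  exact mul_lt_one_of_le_of_lt₀ (hN k (by omega)) hx

/-- Local rings of distinct places do not contain one another. If `O_v ⊂ O_w` and `a ∈ O_w` is not
in `O_v`, then for every `y` some `a⁻ᴺy` is in `O_v`, hence in `O_w`, and multiplying by `a^N` gives
`y ∈ O_w`; but `O_w ≠ F`. -/
theorem exists_not_mem_of_ne (hF : IsCurveFunctionField Fq F) {v w : Place Fq F} (h : v ≠ w) :
    ∃ x, v.val x ≤ 1 ∧ 1 < w.val x := by
  by_contra! hle
  apply h
  apply ext_of_toValuationSubring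
  apply le_antisymm
  · intro x hx
    exact (w.val_le_one_iff x).1 (hle x ((v.val_le_one_iff x).2 hx))
  · intro a ha
    by_contra hav
    rw [← val_le_one_iff, not_le] at hav
    apply w.ne_top'
    rw [eq_top_iff]
    intro y _
    have hσ : v.val a⁻¹ < 1 := by
      rw [map_inv₀]; exact inv_lt_one_of_one_lt₀ hav
    obtain ⟨N, hN⟩ := v.exists_pow_mul_le_one hF hσ y
    have h1 := (w.val_le_one_iff _).1 (hle _ (hN N le_rfl))
    have ha0 : a ≠ 0 := by rintro rfl; simp at hav
    have : y = a ^ N * (a⁻¹ ^ N * y) := by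
      rw [inv_pow, mul_inv_cancel_left₀ (pow_ne_zero _ ha0)]
    rw [this]
    exact mul_mem (pow_mem ha _) h1

theorem exists_one_lt_and_lt_one (hF : IsCurveFunctionField Fq F) (v : Place Fq F)
    (S : Finset (Place Fq F)) (hS : v ∉ S) :
    ∃ x, 1 < v.val x ∧ ∀ w ∈ S, w.val x < 1 := by
  classical
  induction S using Finset.induction_on with
  | empty =>
    obtain ⟨x, hx⟩ := v.exists_one_lt_val
    exact ⟨x, hx, by simp⟩
  | insert w S hw ih =>
    obtain ⟨x, hxv, hxS⟩ := ih (fun h => hS (Finset.mem_insert_of_mem h))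
    have hvw : v ≠ w := fun h => hS (h ▸ Finset.mem_insert_self _ _)
    obtain ⟨y, hyv, hyw⟩ : ∃ y, 1 < v.val y ∧ w.val y < 1 := by
      obtain ⟨a, hav, haw⟩ := exists_not_mem_of_ne hF hvw
      obtain ⟨b, hbw, hbv⟩ := exists_not_mem_of_ne hF hvw.symm
      have ha0 : a ≠ 0 := by rintro rfl; simp at haw
      refine ⟨b / a, ?_, ?_⟩
      · rw [map_div₀, one_lt_div₀ (by simpa [zero_lt_iff] using ha0)]
        exact hav.trans_lt hbv
      · rw [map_div₀, div_lt_one₀ (by simpa [zero_lt_iff] using ha0)]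
        exact hbw.trans_lt haw
    have hN : ∃ N : ℕ, 1 ≤ N ∧ ∀ u ∈ S, u.val (x ^ N * y) < 1 := by
      have hex : ∀ u : S, ∃ N : ℕ, ∀ n, N ≤ n → u.1.val (x ^ n * y) < 1 := fun u =>
        u.1.exists_pow_mul_lt_one hF (hxS u.1 u.2) y
      choose N hN using hex
      refine ⟨Finset.univ.sup N + 1, by omega, fun u hu => hN ⟨u, hu⟩ _ ?_⟩
      exact (Finset.le_sup (f := N) (Finset.mem_univ _)).trans (Nat.le_succ _)
    obtain ⟨N, hN1, hN⟩ := hN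
    -- The element `y` is large at `v` and small at `w`. It is multiplied by `x^N` if `x` is not
    -- large at `w`. Otherwise the factor is `x^N/(1 + x^N)`, which has value 1 where `x` is large
    -- and behaves like `x^N` where `x` is small.
    rcases le_or_gt (w.val x) 1 with hle | hgt
    · refine ⟨x ^ N * y, ?_, fun u hu => ?_⟩
      · rw [map_mul, map_pow]
        exact one_lt_mul_of_le_of_lt (one_le_pow_of_one_le' hxv.le _) hyv
      · rcases Finset.mem_insert.1 hu with rfl | hu
        · rw [map_mul, map_pow]
          exact mul_lt_one_of_le_of_lt₀ (pow_le_one' hle _) hyw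
        · exact hN u hu
    · have hgt1 : ∀ u : Place Fq F, 1 < u.val x → u.val (x ^ N / (1 + x ^ N) * y) = u.val y := by
        intro u hu
        have h1 : 1 < u.val (x ^ N) := by
          rw [map_pow]; exact one_lt_pow' hu (by omega)
        rw [map_mul, map_div₀, Valuation.map_add_eq_of_lt_right (v := u.val) (by simpa using h1),
          div_self (zero_lt_one.trans h1).ne', one_mul]
      refine ⟨x ^ N / (1 + x ^ N) * y, ?_, fun u hu => ?_⟩
      · rw [hgt1 v hxv]; exact hyv
      · rcases Finset.mem_insert.1 hu with rfl | hu
        · rw [hgt1 u hgt]; exact hyw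
        · have h1 : u.val (x ^ N) < 1 := by
            rw [map_pow]; exact pow_lt_one' (hxS u hu) (by omega)
          have h2 : u.val (1 + x ^ N) = 1 := by
            rw [Valuation.map_add_eq_of_lt_left (v := u.val) (by simpa using h1), map_one]
          rw [div_mul_eq_mul_div, map_div₀, h2, div_one]
          exact hN u hu

/-- The number of zeros of `x` is at most `n = [F : Fq(x)]`. Given `n + 1` zeros, take elements that
are units at one of them and small at the others. In a linear relation over `Fq(x)`, normalised so
that some coefficient does not vanish at `x = 0`, the corresponding term has value 1 at its zero and
all other terms are smaller. -/
theorem finite_val_lt_one (hF : IsCurveFunctionField Fq F) {x : F} (hx : x ≠ 0) :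
    {w : Place Fq F | w.val x < 1}.Finite := by
  classical
  by_contra hinf
  obtain ⟨v, hv⟩ := (Set.Infinite.nonempty hinf)
  have htr := v.transcendental_of_val_lt_one hF hx hv
  have hfin := hF.finiteDimensional_adjoin htr
  set n := Module.finrank (IntermediateField.adjoin Fq {x}) F
  obtain ⟨S, hS, hcard⟩ := Set.Infinite.exists_subset_card_eq hinf (n + 1)
  have hz : ∀ w : S, ∃ z, 1 < w.1.val z ∧ ∀ u ∈ S.erase w.1, u.val z < 1 := fun w =>
    w.1.exists_one_lt_and_lt_one hF _ (Finset.notMem_erase _ _)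
  choose z hz1 hz2 using hz
  have hdep : ¬ LinearIndependent (IntermediateField.adjoin Fq {x})
      (fun w : S => z w / (1 + z w)) := by
    intro hli
    have := hli.fintype_card_le_finrank
    rw [Fintype.card_coe, hcard] at this
    omega
  obtain ⟨g, ⟨i, hi⟩, hsum⟩ := exists_polynomial_relation hx hdep
  have hxi : i.1.val x < 1 := hS i.2
  have h1 : i.1.val (aeval x (g i) * (z i / (1 + z i))) = 1 := by
    rw [map_mul, i.1.val_aeval_eq_one hxi hi, one_mul, map_div₀,
      Valuation.map_add_eq_of_lt_right (v := i.1.val) (by simpa using hz1 i),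
      div_self (zero_lt_one.trans (hz1 i)).ne']
  rw [← Finset.add_sum_erase _ _ (Finset.mem_univ i)] at hsum
  have h2 : i.1.val (∑ j ∈ Finset.univ.erase i, aeval x (g j) * (z j / (1 + z j))) < 1 := by
    refine Valuation.map_sum_lt _ one_ne_zero fun j hj => ?_
    have hji : i.1 ∈ S.erase j.1 :=
      Finset.mem_erase.2 ⟨fun h => (Finset.mem_erase.1 hj).1 (Subtype.ext h.symm), i.2⟩
    have h3 := hz2 j i.1 hji
    have h4 : i.1.val (1 + z j) = 1 := by
      rw [Valuation.map_add_eq_of_lt_left (v := i.1.val) (by simpa using h3), map_one]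
    rw [map_mul, map_div₀, h4, div_one]
    exact mul_lt_one_of_le_of_lt₀ (i.1.val_aeval_le hxi.le _) h3
  have h5 := eq_neg_of_add_eq_zero_left hsum
  rw [h5, Valuation.map_neg] at h1
  exact h2.ne h1

/-- In `Fq[x⁻¹]` the ideal generated by `x⁻¹` is proper, because `x⁻¹` is transcendental; a
valuation ring that dominates it is a pole of `x`. -/
theorem exists_one_lt_of_transcendental {x : F} (hx : Transcendental Fq x) :
    ∃ w : Place Fq F, 1 < w.val x := by
  have hx0 : x ≠ 0 := by rintro rfl; exact hx isAlgebraic_zero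
  let R := (Algebra.adjoin Fq {x⁻¹}).toSubring
  let r : R := ⟨x⁻¹, Algebra.self_mem_adjoin_singleton _ _⟩
  have hne : Ideal.span {r} ≠ ⊤ := by
    intro h
    rw [Ideal.eq_top_iff_one, Ideal.mem_span_singleton'] at h
    obtain ⟨a, ha⟩ := h
    have h := Algebra.adjoin_singleton_eq_range_aeval Fq x⁻¹
    have : (a : F) ∈ (aeval (R := Fq) x⁻¹).range := h ▸ a.2
    obtain ⟨f, hf⟩ := this
    apply hx
    rw [← IsAlgebraic.inv_iff]
    refine ⟨f * X - 1, ?_, ?_⟩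
    · intro h0
      have := congrArg (fun p => p.coeff 0) h0
      simp at this
    · have h3 : (a : F) * x⁻¹ = 1 := congrArg Subtype.val ha
      rw [map_sub, map_mul, aeval_X, map_one, sub_eq_zero, ← h3]
      exact congrArg (· * x⁻¹) hf
  obtain ⟨B, hB, hI⟩ := Ideal.image_subset_nonunits_valuationSubring _ hne
  have hxB : x⁻¹ ∈ B.nonunits := hI ⟨r, Ideal.mem_span_singleton_self r, rfl⟩
  have hxB' : B.valuation x⁻¹ < 1 := (ValuationSubring.mem_nonunits_iff _).1 hxB
  have h1 : 1 < B.valuation x := by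
    rw [map_inv₀] at hxB'
    by_contra! h
    have h0 : 0 < B.valuation x := by simpa [zero_lt_iff] using hx0
    exact absurd hxB' (not_lt.2 ((one_le_inv₀ h0).2 h))
  refine ⟨⟨B, fun c => hB (Subalgebra.algebraMap_mem _ c), ?_⟩, h1⟩
  rintro rfl
  exact absurd ((ValuationSubring.valuation_le_one_iff ⊤ x).2 trivial) (not_le.2 h1)

end Place

end FunctionField

end DLattice

/-! ### Dimension counts modulo a function -/

namespace DLattice

open Polynomial

section FunctionField

variable {Fq F : Type*} [Field Fq] [Field F] [Algebra Fq F]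

/-- A dependence over `Fq(x)` can be normalised to polynomial coefficients whose constant terms are
not all zero; modulo `xW` it becomes a non-trivial relation over `Fq`. -/
theorem linearIndependent_of_quotient (W : Subalgebra Fq F) (x : W) (hx : (x : F) ≠ 0)
    {ι : Type*} [Fintype ι] (y : ι → W)
    (h : LinearIndependent Fq ((LinearMap.range (LinearMap.mulLeft Fq x)).mkQ ∘ y)) :
    LinearIndependent (IntermediateField.adjoin Fq {(x : F)}) (fun i => (y i : F)) := by
  by_contra hdep
  obtain ⟨g, ⟨i, hi⟩, hsum⟩ := exists_polynomial_relation hx hdep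
  have hsumW : ∑ j, aeval x (g j) * y j = 0 := by
    apply Subtype.ext
    rw [← ZeroMemClass.coe_zero W] at hsum
    rw [← hsum]
    push_cast
    exact Finset.sum_congr rfl fun j _ => by rw [Subalgebra.aeval_coe]
  rw [Fintype.linearIndependent_iff] at h
  refine hi (h (fun j => (g j).coeff 0) ?_ i)
  have : ∑ j, (g j).coeff 0 • y j = x * (-∑ j, aeval x (g j).divX * y j) := by
    rw [mul_neg, eq_neg_iff_add_eq_zero, Finset.mul_sum, ← Finset.sum_add_distrib, ← hsumW]
    refine Finset.sum_congr rfl fun j _ => ?_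
    conv_rhs => rw [← X_mul_divX_add (g j)]
    simp only [map_add, map_mul, aeval_X, aeval_C, Algebra.smul_def]
    ring
  simp only [Function.comp_apply, ← map_smul, ← map_sum]
  rw [this, Submodule.mkQ_apply, Submodule.Quotient.mk_eq_zero]
  exact ⟨_, rfl⟩

theorem rank_quotient_mulLeft_le (hF : IsCurveFunctionField Fq F) (W : Subalgebra Fq F) (x : W)
    (hx : Transcendental Fq (x : F)) :
    Module.rank Fq (W ⧸ LinearMap.range (LinearMap.mulLeft Fq x)) ≤
      Module.finrank (IntermediateField.adjoin Fq {(x : F)}) F := by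
  have hfin := hF.finiteDimensional_adjoin hx
  have hx0 : (x : F) ≠ 0 := by intro h; rw [h] at hx; exact hx isAlgebraic_zero
  refine rank_le fun s hs => ?_
  have hli := linearIndependent_of_quotient W x hx0
    (fun i : s => Function.surjInv (Submodule.mkQ_surjective _) i.1) (by
      convert hs using 1
      funext i
      exact Function.surjInv_eq (Submodule.mkQ_surjective _) i.1)
  simpa using hli.fintype_card_le_finrank

/-- The bound improves by one because the zero `v` of `x` is invisible in `W`, which has an element
`y` with a pole there. If `[F : Fq(x)]` classes were independent, add to their representatives a
power `y^N` that dominates all of them at `v`. The new family is dependent. If the coefficient of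
`y^N` vanishes at `x = 0`, reduction modulo `x` contradicts independence; if not, the term in `y^N`
is strictly the largest at `v`. -/
theorem rank_quotient_mulLeft_lt (hF : IsCurveFunctionField Fq F) (W : Subalgebra Fq F) (x : W)
    (v : Place Fq F) (hx0 : (x : F) ≠ 0) (hx : v.val (x : F) < 1) (y : W)
    (hy : 1 < v.val (y : F)) :
    Module.rank Fq (W ⧸ LinearMap.range (LinearMap.mulLeft Fq x)) ≤
      (Module.finrank (IntermediateField.adjoin Fq {(x : F)}) F - 1 : ℕ) := by
  classical
  have htr := v.transcendental_of_val_lt_one hF hx0 hx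
  have hfin := hF.finiteDimensional_adjoin htr
  refine rank_le fun s hs => ?_
  set b : s → W := fun i : s => Function.surjInv (Submodule.mkQ_surjective _) i.1 with hb
  have hs' : LinearIndependent Fq ((LinearMap.range (LinearMap.mulLeft Fq x)).mkQ ∘ b) := by
    convert hs using 1
    funext i
    exact Function.surjInv_eq (Submodule.mkQ_surjective _) i.1
  have hli := linearIndependent_of_quotient W x hx0 b hs'
  have hcard := hli.fintype_card_le_finrank
  rw [Fintype.card_coe] at hcard
  rcases hcard.lt_or_eq with h | h
  · omega
  exfalso
  have hyv : v.val (y : F)⁻¹ < 1 := by rw [map_inv₀]; exact inv_lt_one_of_one_lt₀ hy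
  obtain ⟨N, hN⟩ : ∃ N : ℕ, ∀ i, v.val ((y : F)⁻¹ ^ N * (b i : F)) < 1 := by
    have hex := fun i : s => v.exists_pow_mul_lt_one hF hyv (b i : F)
    choose N hN using hex
    exact ⟨Finset.univ.sup N, fun i => hN i _ (Finset.le_sup (f := N) (Finset.mem_univ _))⟩
  have hy0 : (y : F) ≠ 0 := by rintro h0; rw [h0] at hy; simp at hy
  have hdep : ¬ LinearIndependent (IntermediateField.adjoin Fq {(x : F)})
      (fun o : Option s => ((o.elim (y ^ N) b : W) : F)) := by
    intro h1
    have := h1.fintype_card_le_finrank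
    rw [Fintype.card_option, Fintype.card_coe] at this
    omega
  obtain ⟨g, hg, hsum⟩ := exists_polynomial_relation hx0 hdep
  rw [Fintype.sum_option] at hsum
  simp only [Option.elim_none, Option.elim_some, SubmonoidClass.coe_pow] at hsum
  by_cases hg0 : (g none).coeff 0 = 0
  · have hsumW : aeval x (g none) * y ^ N + ∑ j, aeval x (g (some j)) * b j = 0 := by
      apply Subtype.ext
      rw [← ZeroMemClass.coe_zero W] at hsum
      rw [← hsum]
      push_cast
      simp only [Subalgebra.aeval_coe]
    rw [Fintype.linearIndependent_iff] at hs'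
    have hall := hs' (fun j => (g (some j)).coeff 0) (by
      have : ∑ j, (g (some j)).coeff 0 • b j =
          x * (-(aeval x (g none).divX * y ^ N) - ∑ j, aeval x (g (some j)).divX * b j) := by
        rw [← add_zero (∑ j, (g (some j)).coeff 0 • b j)]
        rw [← neg_zero, ← hsumW]
        have hn : aeval x (g none) = x * aeval x (g none).divX := by
          conv_lhs => rw [← X_mul_divX_add (g none), hg0]
          simp
        have hj : ∀ j, aeval x (g (some j)) * b j =
            (g (some j)).coeff 0 • b j + x * (aeval x (g (some j)).divX * b j) := fun j => by
          conv_lhs => rw [← X_mul_divX_add (g (some j))]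
          simp only [map_add, map_mul, aeval_X, aeval_C, Algebra.smul_def]
          ring
        rw [hn, Finset.sum_congr rfl fun j _ => hj j, Finset.sum_add_distrib, ← Finset.mul_sum]
        ring
      simp only [Function.comp_apply, ← map_smul, ← map_sum]
      rw [this, Submodule.mkQ_apply, Submodule.Quotient.mk_eq_zero]
      exact ⟨_, rfl⟩)
    obtain ⟨o, ho⟩ := hg
    cases o with
    | none => exact ho hg0
    | some j => exact ho (hall j)
  · have h1 : v.val (aeval (x : F) (g none)) = 1 := v.val_aeval_eq_one hx hg0
    have h2 : aeval (x : F) (g none) =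
        -∑ j, aeval (x : F) (g (some j)) * ((y : F)⁻¹ ^ N * (b j : F)) := by
      have h3 := congrArg (fun z => (y : F)⁻¹ ^ N * z) hsum
      simp only [mul_add, mul_zero] at h3
      rw [mul_left_comm, inv_pow, inv_mul_cancel₀ (pow_ne_zero _ hy0), mul_one,
        Finset.mul_sum] at h3
      rw [eq_neg_iff_add_eq_zero, ← h3]
      congr 1
      refine Finset.sum_congr rfl fun j _ => ?_
      rw [inv_pow]; ring
    rw [h2, Valuation.map_neg] at h1
    refine absurd h1 (ne_of_lt (Valuation.map_sum_lt _ one_ne_zero fun j _ => ?_))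
    rw [map_mul]
    exact mul_lt_one_of_le_of_lt₀ (v.val_aeval_le hx.le _) (hN j)

/-- The codimension in `x⁻ᴺW` of the part of a subspace `U` that lies in `W`. -/
theorem finrank_le_finrank_inf_add (W : Subalgebra Fq F) (x : W) (hx0 : (x : F) ≠ 0) (n : ℕ)
    (hn : Module.rank Fq (W ⧸ LinearMap.range (LinearMap.mulLeft Fq x)) ≤ n)
    (N : ℕ) (U : Submodule Fq F) [FiniteDimensional Fq U]
    (hU : ∀ u ∈ U, (x : F) ^ N * u ∈ W) :
    Module.finrank Fq U ≤
      Module.finrank Fq (U ⊓ Subalgebra.toSubmodule W : Submodule Fq F) + N * n := by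
  induction N generalizing U with
  | zero =>
    have : U ⊓ Subalgebra.toSubmodule W = U :=
      inf_eq_left.2 fun u hu => by simpa using hU u hu
    rw [this]; omega
  | succ N ih =>
    let f : U →ₗ[Fq] W := (LinearMap.mulLeft Fq ((x : F) ^ (N + 1)) ∘ₗ U.subtype).codRestrict
      (Subalgebra.toSubmodule W) (fun u => hU u u.2)
    let q := (LinearMap.range (LinearMap.mulLeft Fq x)).mkQ ∘ₗ f
    have hfd : FiniteDimensional Fq (W ⧸ LinearMap.range (LinearMap.mulLeft Fq x)) :=
      Module.rank_lt_aleph0_iff.1 (hn.trans_lt (Cardinal.natCast_lt_aleph0))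
    have hq := LinearMap.finrank_range_add_finrank_ker q
    have hr : Module.finrank Fq (LinearMap.range q) ≤ n :=
      (Submodule.finrank_le _).trans (Module.finrank_le_of_rank_le hn)
    -- The part of `U` that a factor `x^N` already brings into `W`. Its codimension in `U` is at
    -- most `n`, so each of the successive powers of `x` costs at most `n` dimensions.
    let U' : Submodule Fq F := (LinearMap.ker q).map U.subtype
    have hU' : Module.finrank Fq U' = Module.finrank Fq (LinearMap.ker q) :=
      Submodule.finrank_map_subtype_eq _ _
    have h1 := ih U' (by
      rintro _ ⟨u, hu, rfl⟩
      have h2 : f u ∈ LinearMap.range (LinearMap.mulLeft Fq x) := by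
        rw [← Submodule.Quotient.mk_eq_zero]; exact hu
      obtain ⟨w, hw⟩ := h2
      have h3 : (x : F) * (w : F) = (x : F) ^ (N + 1) * (u : F) := congrArg Subtype.val hw
      rw [pow_succ', mul_assoc] at h3
      have h4 := mul_left_cancel₀ hx0 h3
      change (x : F) ^ N * (u : F) ∈ W
      rw [← h4]
      exact w.2)
    have h5 : Module.finrank Fq (U' ⊓ Subalgebra.toSubmodule W : Submodule Fq F) ≤
        Module.finrank Fq (U ⊓ Subalgebra.toSubmodule W : Submodule Fq F) := by
      refine Submodule.finrank_mono (inf_le_inf_right _ ?_)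
      rintro _ ⟨u, -, rfl⟩
      exact u.2
    rw [Nat.succ_mul]
    omega

end FunctionField

end DLattice

/-! ### Functions with a pole only at `p` -/

namespace DLattice

open Polynomial

section FunctionField

variable {Fq F : Type*} [Field Fq] [Field F] [Algebra Fq F]

theorem exists_integral_basis (hF : IsCurveFunctionField Fq F) {x : F} (hx : Transcendental Fq x)
    {n : ℕ} (hn : Module.finrank (IntermediateField.adjoin Fq {x}) F = n) :
    ∃ b : Module.Basis (Fin n)
      (IntermediateField.adjoin Fq {x}) F, ∀ i, IsIntegral (Algebra.adjoin Fq {x}) (b i) := by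
  have hfin := hF.finiteDimensional_adjoin hx
  open scoped IntermediateField.algebraAdjoinAdjoin in
  obtain ⟨s, b, hb⟩ := FiniteDimensional.exists_is_basis_integral (Algebra.adjoin Fq {x})
    (IntermediateField.adjoin Fq {x}) F
  have hc : Fintype.card s = Module.finrank (IntermediateField.adjoin Fq {x}) F :=
    (Module.finrank_eq_card_basis b).symm
  rw [hn] at hc
  exact ⟨b.reindex (Fintype.equivFinOfCardEq hc), fun i => by simpa using hb _⟩

theorem linearIndependent_pow_smul {x : F} (hx : Transcendental Fq x) {ι : Type*} {b : ι → F}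
    (hb : LinearIndependent (IntermediateField.adjoin Fq {x}) b) (m : ℕ) :
    LinearIndependent Fq (fun p : Fin m × ι => x ^ (p.1 : ℕ) * b p.2) := by
  let x' : IntermediateField.adjoin Fq {x} := IntermediateField.AdjoinSimple.gen Fq x
  have h1 : LinearIndependent Fq (fun j : Fin m => x' ^ (j : ℕ)) := by
    have hx' : Transcendental Fq x' := by
      intro h
      exact hx ((isAlgebraic_algebraMap_iff (A := F)
        (FaithfulSMul.algebraMap_injective (IntermediateField.adjoin Fq {x}) F)).2 h)
    have h2 : LinearIndependent Fq (fun j : ℕ => x' ^ j) := by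
      have h3 := (basisMonomials Fq).linearIndependent.map' (aeval (R := Fq) x').toLinearMap
        (LinearMap.ker_eq_bot.2 (transcendental_iff_injective.1 hx'))
      simpa [Function.comp_def] using h3
    exact h2.comp _ Fin.val_injective
  exact linearIndependent_smul h1 hb

namespace Place

/-- A weak form of Riemann's theorem. Let `s` have a pole at `p`, let `S` be the set of its other
poles and `n = [F : Fq(s)]`. The span of the `s^j bᵢ` with `j < m` and `b` an integral basis has
dimension `mn` and consists of functions without poles outside those of `s`. Regularity on `S` costs
at most `(m + c)(n - 1)` dimensions, because `p` does not count there. For large `m` a non-constant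
function remains. -/
theorem exists_transcendental_mem_regularRing (hF : IsCurveFunctionField Fq F) (p : Place Fq F) :
    ∃ t ∈ p.regularRing, Transcendental Fq t := by
  classical
  obtain ⟨s, hs⟩ := p.exists_one_lt_val
  have hs0 : s ≠ 0 := by rintro rfl; simp at hs
  have hx : p.val s⁻¹ < 1 := by rw [map_inv₀]; exact inv_lt_one_of_one_lt₀ hs
  have hx0 : s⁻¹ ≠ 0 := inv_ne_zero hs0
  have htrx := p.transcendental_of_val_lt_one hF hx0 hx
  have htr : Transcendental Fq s := by rwa [Transcendental, IsAlgebraic.inv_iff] at htrx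
  let S : Finset (Place Fq F) := (finite_val_lt_one hF hx0).toFinset.erase p
  have hS : ∀ w ∈ S, w.val s⁻¹ < 1 := fun w hw => by
    simpa using (Finset.mem_erase.1 hw).2
  have hS' : ∀ w : Place Fq F, w ≠ p → w ∉ S → w.val s ≤ 1 := by
    intro w hw hwS
    by_contra! h
    exact hwS (Finset.mem_erase.2 ⟨hw, by
      simpa [map_inv₀] using inv_lt_one_of_one_lt₀ h⟩)
  let W : Subalgebra Fq F := ⨅ w ∈ S, w.subalgebra
  have hW : ∀ y, y ∈ W ↔ ∀ w ∈ S, w.val y ≤ 1 := fun y => by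
    simp only [W, Algebra.mem_iInf, mem_subalgebra]
  obtain ⟨y, hyp, hyS⟩ := p.exists_one_lt_and_lt_one hF S (Finset.notMem_erase _ _)
  have hxW : s⁻¹ ∈ W := (hW _).2 fun w hw => (hS w hw).le
  have hyW : y ∈ W := (hW _).2 fun w hw => (hyS w hw).le
  have hrank := rank_quotient_mulLeft_lt hF W ⟨s⁻¹, hxW⟩ p hx0 hx ⟨y, hyW⟩ hyp
  have hadj : IntermediateField.adjoin Fq {s⁻¹} = IntermediateField.adjoin Fq {s} := by
    apply le_antisymm
    · rw [IntermediateField.adjoin_simple_le_iff]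
      exact inv_mem (IntermediateField.mem_adjoin_simple_self Fq s)
    · rw [IntermediateField.adjoin_simple_le_iff]
      simpa using inv_mem (IntermediateField.mem_adjoin_simple_self Fq s⁻¹)
  have hfr : Module.finrank (IntermediateField.adjoin Fq {s⁻¹}) F =
      Module.finrank (IntermediateField.adjoin Fq {s}) F := by rw [hadj]
  simp only [hfr] at hrank
  have hfin := hF.finiteDimensional_adjoin htr
  obtain ⟨n, hn⟩ : ∃ n, Module.finrank (IntermediateField.adjoin Fq {s}) F = n := ⟨_, rfl⟩
  obtain ⟨b, hb⟩ := exists_integral_basis hF htr hn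
  have hnpos : 0 < n := hn ▸ Module.finrank_pos
  rw [hn] at hrank
  obtain ⟨c, hc⟩ : ∃ c : ℕ, ∀ i, ∀ w ∈ S, ∀ k, c ≤ k → w.val (s⁻¹ ^ k * b i) ≤ 1 := by
    have hex := fun (i : Fin n) (w : S) => w.1.exists_pow_mul_le_one hF (hS w.1 w.2) (b i)
    choose N hN using hex
    refine ⟨Finset.univ.sup fun i => Finset.univ.sup (N i), fun i w hw k hk =>
      hN i ⟨w, hw⟩ _ (le_trans ?_ hk)⟩
    exact (Finset.le_sup (f := N i) (Finset.mem_univ (⟨w, hw⟩ : S))).trans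
      (Finset.le_sup (f := fun i => Finset.univ.sup (N i)) (Finset.mem_univ i))
  -- This value makes `mn - (m + c)(n - 1) = 2`, one more than the dimension of the constants.
  set m := c * (n - 1) + 2 with hm
  have hli := linearIndependent_pow_smul htr b.linearIndependent m
  set U := Submodule.span Fq (Set.range fun p : Fin m × Fin n => s ^ (p.1 : ℕ) * b p.2) with hU
  have hUfd : FiniteDimensional Fq U := FiniteDimensional.span_of_finite _ (Set.finite_range _)
  have hUrank : Module.finrank Fq U = m * n := by
    rw [hU, finrank_span_eq_card hli]; simp
  have key := finrank_le_finrank_inf_add W ⟨s⁻¹, hxW⟩ hx0 (n - 1) hrank (m + c) U (by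
    intro u hu
    induction hu using Submodule.span_induction with
    | mem u hu =>
      obtain ⟨⟨j, i⟩, rfl⟩ := hu
      rw [hW]
      intro w hw
      have : s⁻¹ ^ (m + c) * (s ^ (j : ℕ) * b i) = s⁻¹ ^ (m + c - j) * b i := by
        have hj : (m + c) = (m + c - j) + j := by have := j.2; omega
        conv_lhs => rw [hj, pow_add]
        rw [mul_assoc, inv_pow s (j : ℕ), inv_mul_cancel_left₀ (pow_ne_zero _ hs0)]
      change w.val (s⁻¹ ^ (m + c) * (s ^ (j : ℕ) * b i)) ≤ 1
      rw [this]
      exact hc i w hw _ (by have := j.2; omega)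
    | zero => simp
    | add u v _ _ hu hv => rw [mul_add]; exact add_mem hu hv
    | smul a u _ hu => rw [mul_smul_comm]; exact Subalgebra.smul_mem _ hu a)
  rw [hUrank] at key
  have hdim : 2 ≤ Module.finrank Fq (U ⊓ Subalgebra.toSubmodule W : Submodule Fq F) := by
    obtain ⟨k, hk⟩ : ∃ k, n = k + 1 := ⟨n - 1, by omega⟩
    have h1 : n - 1 = k := by omega
    rw [h1] at key hm
    rw [hk] at key
    have : m * (k + 1) = (m + c) * k + 2 := by rw [hm]; ring
    omega
  obtain ⟨t, ht, htc⟩ : ∃ t ∈ (U ⊓ Subalgebra.toSubmodule W : Submodule Fq F),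
      t ∉ Submodule.span Fq {(1 : F)} := by
    by_contra! hle
    have h1 := Submodule.finrank_mono (R := Fq) (M := F) hle
    have h2 := finrank_span_singleton (K := Fq) (one_ne_zero (α := F))
    omega
  refine ⟨t, ?_, ?_⟩
  · intro w hw
    rw [← val_le_one_iff]
    by_cases hwS : w ∈ S
    · exact (hW t).1 ht.2 w hwS
    · have h1 := hS' w hw hwS
      have hUw : U ≤ Subalgebra.toSubmodule w.subalgebra := by
        rw [hU, Submodule.span_le]
        rintro _ ⟨⟨j, i⟩, rfl⟩
        change _ ∈ w.subalgebra
        rw [mem_subalgebra, map_mul, map_pow]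
        exact mul_le_one' (pow_le_one' h1 _) (w.val_le_one_of_isIntegral h1 (hb _))
      exact (mem_subalgebra w).1 (hUw ht.1)
  · intro halg
    obtain ⟨a, rfl⟩ := hF.constants t halg
    exact htc (Submodule.mem_span_singleton.2 ⟨a, by rw [Algebra.smul_def, mul_one]⟩)

variable {p : Place Fq F}

/-- A transcendental function has a pole, and only `p` is available. This plays the role of the
product formula. -/
theorem one_lt_val_of_mem_regularRing {t : F} (ht : t ∈ p.regularRing) (htr : Transcendental Fq t) :
    1 < p.val t := by
  obtain ⟨w, hw⟩ := exists_one_lt_of_transcendental htr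
  by_cases h : w = p
  · rwa [h] at hw
  · exact absurd ((w.val_le_one_iff t).2 (ht w h)) (not_le.2 hw)

theorem eq_zero_of_mem_regularRing (hF : IsCurveFunctionField Fq F) {t : F}
    (ht : t ∈ p.regularRing) (h : p.val t < 1) : t = 0 := by
  by_contra h0
  exact lt_asymm h (one_lt_val_of_mem_regularRing ht (p.transcendental_of_val_lt_one hF h0 h))

theorem val_aeval_eq_pow {v : Place Fq F} {t : F} (ht : 1 < v.val t) {f : Fq[X]} (hf : f ≠ 0) :
    v.val (aeval t f) = v.val t ^ f.natDegree := by
  have ht0 : t ≠ 0 := by rintro rfl; simp at ht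
  have h1 : v.val t⁻¹ < 1 := by rw [map_inv₀]; exact inv_lt_one_of_one_lt₀ ht
  have h2 : v.val (aeval t⁻¹ f.reverse) = 1 := v.val_aeval_eq_one h1 (by
    rw [coeff_zero_reverse]; exact leadingCoeff_ne_zero.2 hf)
  have h3 : aeval t⁻¹ f.reverse * t ^ f.natDegree = aeval t f := by
    let := invertibleOfNonzero ht0
    have := eval₂_reverse_mul_pow (algebraMap Fq F) t f
    rwa [invOf_eq_inv] at this
  rw [← h3, map_mul, h2, one_mul, map_pow]

/-- Every function is, up to a function bounded at `p`, a combination of a fixed finite set of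
functions of `A`, with coefficients polynomials in a given function of `A`. -/
theorem exists_bounded_approx (hF : IsCurveFunctionField Fq F) {t : F}
    (ht : t ∈ p.regularRing) (htr : Transcendental Fq t) :
    ∃ (n : ℕ) (b : Fin n → p.regularRing) (c : F), c ≠ 0 ∧
      ∀ y : F, ∃ g : Fin n → Fq[X], p.val (y - ∑ i, aeval t (g i) * (b i : F)) ≤ p.val c := by
  classical
  have htp := one_lt_val_of_mem_regularRing ht htr
  have hfin := hF.finiteDimensional_adjoin htr
  obtain ⟨b, hb⟩ := exists_integral_basis hF htr rfl
  obtain ⟨M, hM⟩ := (Finset.univ.image fun i => p.val (b i)).exists_le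
  -- The bound `c` dominates the whole integral basis at `p`.
  obtain ⟨c, hc0, hc⟩ : ∃ c : F, c ≠ 0 ∧ M ≤ p.val c := by
    rcases eq_or_ne M 0 with h | h
    · exact ⟨1, one_ne_zero, by rw [h]; exact zero_le⟩
    · obtain ⟨c, rfl⟩ := ValuationSubring.valuation_surjective _ M
      exact ⟨c, by rintro rfl; simp at h, le_rfl⟩
  refine ⟨_, fun i => ⟨b i, fun v hv => (v.val_le_one_iff _).1
    (v.val_le_one_of_isIntegral ((v.val_le_one_iff _).2 (ht v hv)) (hb i))⟩, c, hc0, fun y => ?_⟩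
  have hco : ∀ i, ∃ r q : Fq[X], (b.repr y i : F) = aeval t r / aeval t q := fun i => by
    have := (b.repr y i).2
    rwa [IntermediateField.mem_adjoin_simple_iff] at this
  choose r q hrq using hco
  -- Only the polynomial part of each coordinate is kept. The remainder has smaller degree than the
  -- denominator, and `t` has a pole at `p`, so the fractional part has value at most 1 there.
  refine ⟨fun i => r i / q i, ?_⟩
  have hy : y = ∑ i, (b.repr y i : F) * b i := by
    conv_lhs => rw [← b.sum_repr y]
    rfl
  conv_lhs => rw [hy]
  rw [← Finset.sum_sub_distrib]
  refine Valuation.map_sum_le _ fun i _ => ?_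
  rw [← sub_mul, map_mul]
  have hbi : p.val (b i) ≤ p.val c :=
    (hM _ (Finset.mem_image_of_mem _ (Finset.mem_univ i))).trans hc
  refine (mul_le_mul_left (a := p.val (b i)) ?_).trans ((one_mul _).trans_le hbi)
  rw [hrq]
  by_cases hq : q i = 0
  · simp [hq]
  have hq' : aeval t (q i) ≠ 0 := fun h => hq ((transcendental_iff.1 htr) _ h)
  have h1 : aeval t (r i) / aeval t (q i) - aeval t (r i / q i) =
      aeval t (r i % q i) / aeval t (q i) := by
    rw [div_sub' hq']
    congr 1
    rw [← map_mul, ← map_sub]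
    congr 1
    rw [sub_eq_iff_eq_add, EuclideanDomain.mod_add_div]
  rw [h1]
  by_cases hr : r i % q i = 0
  · simp [hr]
  rw [map_div₀, val_aeval_eq_pow htp hq, val_aeval_eq_pow htp hr]
  have hpos : 0 < p.val t := zero_lt_one.trans htp
  rw [div_le_one₀ (pow_pos hpos _)]
  refine pow_le_pow_right₀ htp.le (natDegree_le_natDegree ?_)
  exact (EuclideanDomain.mod_lt (r i) hq).le

end Place

end FunctionField

end DLattice

/-! ### Finiteness properties of `A` -/

namespace DLattice

open Polynomial

namespace Place

section FunctionField

variable {Fq F : Type*} [Field Fq] [Field F] [Algebra Fq F]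

theorem exists_ne_zero_val_lt_one (v : Place Fq F) : ∃ x : F, x ≠ 0 ∧ v.val x < 1 := by
  obtain ⟨y, hy⟩ := v.exists_one_lt_val
  refine ⟨y⁻¹, inv_ne_zero (by rintro rfl; simp at hy), ?_⟩
  rw [map_inv₀]
  exact inv_lt_one_of_one_lt₀ hy

/-- After division by `b` this is finiteness of the local ring modulo `a/b`, which has finite
dimension over the finite field `Fq`. It later gives compactness of the balls in the completions. -/
theorem exists_finite_residues [Finite Fq] (hF : IsCurveFunctionField Fq F) (v : Place Fq F)
    {a b : F} (ha : a ≠ 0) (hb : b ≠ 0) :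
    ∃ T : Set F, T.Finite ∧ ∀ y, v.val y ≤ v.val b → ∃ τ ∈ T, v.val τ ≤ v.val b ∧
      v.val (y - τ) ≤ v.val a := by
  have hb' : 0 < v.val b := by simpa [zero_lt_iff] using hb
  by_cases hσ : v.val (a / b) < 1
  · have hab : a / b ≠ 0 := div_ne_zero ha hb
    have htr := v.transcendental_of_val_lt_one hF hab hσ
    have hr := rank_quotient_mulLeft_le hF v.subalgebra ⟨a / b, v.mem_subalgebra.2 hσ.le⟩ htr
    set I := LinearMap.range (LinearMap.mulLeft Fq
      (⟨a / b, v.mem_subalgebra.2 hσ.le⟩ : v.subalgebra)) with hI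
    have hfd : FiniteDimensional Fq (v.subalgebra ⧸ I) :=
      Module.rank_lt_aleph0_iff.1 (hr.trans_lt Cardinal.natCast_lt_aleph0)
    have hfin : Finite (v.subalgebra ⧸ I) := Module.finite_of_finite Fq
    let sec : v.subalgebra ⧸ I → v.subalgebra := Function.surjInv I.mkQ_surjective
    let s : v.subalgebra ⧸ I → F := fun q => b * (sec q : F)
    refine ⟨Set.range s, Set.finite_range s, fun y hy => ?_⟩
    have hyb : v.val (y / b) ≤ 1 := by
      rw [map_div₀]; exact (div_le_one₀ hb').2 hy
    let z : v.subalgebra := ⟨y / b, v.mem_subalgebra.2 hyb⟩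
    refine ⟨s (I.mkQ z), ⟨_, rfl⟩, ?_, ?_⟩
    · rw [map_mul]
      exact mul_le_of_le_one_right' (v.mem_subalgebra.1 (Subtype.property _))
    · have h1 : z - sec (I.mkQ z) ∈ I := by
        rw [← Submodule.Quotient.mk_eq_zero, Submodule.Quotient.mk_sub, sub_eq_zero]
        exact (Function.surjInv_eq I.mkQ_surjective (I.mkQ z)).symm
      obtain ⟨w, hw⟩ := h1
      have h2 : a / b * (w : F) = y / b - (sec (I.mkQ z) : F) :=
        congrArg Subtype.val hw
      have h3 : y - s (I.mkQ z) = a * w := by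
        have : y - s (I.mkQ z) =
            b * (y / b - (sec (I.mkQ z) : F)) := by
          rw [mul_sub, mul_div_cancel₀ _ hb]
        rw [this, ← h2]
        field_simp
      rw [h3, map_mul]
      exact mul_le_of_le_one_right' (v.mem_subalgebra.1 w.2)
  · refine ⟨{0}, Set.finite_singleton _, fun y hy => ⟨0, rfl, by simp, ?_⟩⟩
    rw [sub_zero]
    refine hy.trans ?_
    rw [map_div₀, not_lt] at hσ
    exact (one_le_div₀ hb').1 hσ

variable {p : Place Fq F}

/-- Two elements of `A` with the same residue modulo a small ball differ by an element of `A` that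
vanishes at `p`, that is, by 0. -/
theorem finite_regularRing_inter [Finite Fq] (hF : IsCurveFunctionField Fq F) {b : F}
    (hb : b ≠ 0) : {y : p.regularRing | p.val (y : F) ≤ p.val b}.Finite := by
  obtain ⟨σ, hσ0, hσ⟩ := p.exists_ne_zero_val_lt_one
  obtain ⟨T, hT, hT'⟩ := p.exists_finite_residues hF hσ0 hb
  have hch : ∀ y : {y : p.regularRing | p.val (y : F) ≤ p.val b}, ∃ τ : T,
      p.val ((y : F) - τ) ≤ p.val σ := fun y => by
    obtain ⟨τ, hτ, -, h⟩ := hT' y y.2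
    exact ⟨⟨τ, hτ⟩, h⟩
  choose f hf using hch
  have := hT.to_subtype
  refine Set.finite_coe_iff.1 (Finite.of_injective f fun x y hxy => ?_)
  apply Subtype.ext
  apply Subtype.ext
  rw [← sub_eq_zero]
  refine eq_zero_of_mem_regularRing hF (sub_mem x.1.2 y.1.2) ?_
  refine lt_of_le_of_lt ?_ hσ
  have h1 : (x.1 : F) - (y.1 : F) = ((x : F) - f x) - ((y : F) - f y) := by rw [hxy]; ring
  rw [h1]
  exact Valuation.map_sub_le _ (hf x) (hf y)

/-- The approximating combinations lie in `A`. Together with the compactness of balls, this says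
that `A` is cocompact in the completion at `p`. -/
theorem exists_regularRing_approx (hF : IsCurveFunctionField Fq F) (p : Place Fq F) :
    ∃ c : F, c ≠ 0 ∧ ∀ y : F, ∃ a ∈ p.regularRing, p.val (y - a) ≤ p.val c := by
  obtain ⟨t, ht, htr⟩ := p.exists_transcendental_mem_regularRing hF
  obtain ⟨n, b, c, hc, h⟩ := exists_bounded_approx hF ht htr
  refine ⟨c, hc, fun y => ?_⟩
  obtain ⟨g, hg⟩ := h y
  refine ⟨_, ?_, hg⟩
  refine sum_mem fun i _ => mul_mem ?_ (b i).2
  have := Algebra.adjoin_le (S := p.regularRing) (by simpa using ht)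
    (aeval_mem_adjoin_singleton (p := g i) Fq t)
  exact this

/-- Let `a ∈ I` be non-constant. Write an element of `A` as `Σ gᵢ(a)bᵢ` plus a remainder bounded at
`p`. Modulo `a` only the constants `gᵢ(0)` and the remainder matter, and there are finitely many of
both. -/
theorem hasFiniteQuotients [Finite Fq] (hF : IsCurveFunctionField Fq F) (p : Place Fq F) :
    Ring.HasFiniteQuotients p.regularRing where
  finiteQuotient := by
    intro I hI
    obtain ⟨a, haI, ha0⟩ := Submodule.exists_mem_ne_zero_of_ne_bot hI
    by_cases halg : IsAlgebraic Fq (a : F)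
    · obtain ⟨c, hc⟩ := hF.constants _ halg
      have hc0 : c ≠ 0 := by
        rintro rfl
        rw [map_zero] at hc
        exact ha0 (Subtype.ext hc.symm)
      have hu : IsUnit a := by
        have : a = algebraMap Fq p.regularRing c := Subtype.ext hc.symm
        rw [this]
        exact (IsUnit.mk0 c hc0).map _
      rw [Ideal.eq_top_of_isUnit_mem _ haI hu]
      infer_instance
    · obtain ⟨n, b, c, hc, h⟩ := exists_bounded_approx hF a.2 halg
      have hR := (finite_regularRing_inter (p := p) hF hc).to_subtype
      let f : (Fin n → Fq) × {y : p.regularRing | p.val (y : F) ≤ p.val c} → p.regularRing ⧸ I :=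
        fun q => Ideal.Quotient.mk I (∑ i, algebraMap Fq p.regularRing (q.1 i) * b i + q.2)
      refine Finite.of_surjective f fun z => ?_
      obtain ⟨y, rfl⟩ := Ideal.Quotient.mk_surjective z
      obtain ⟨g, hg⟩ := h y
      let r : p.regularRing := y - ∑ i, aeval a (g i) * b i
      refine ⟨(fun i => (g i).coeff 0, ⟨r, ?_⟩), ?_⟩
      · have : (r : F) = y - ∑ i, aeval (a : F) (g i) * (b i : F) := by
          simp only [r]
          push_cast
          simp only [Subalgebra.aeval_coe]
        rw [Set.mem_ofPred_eq, this]; exact hg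
      · simp only [f]
        rw [Ideal.Quotient.eq]
        have : ∑ i, algebraMap Fq p.regularRing ((g i).coeff 0) * b i + r - y =
            a * (-∑ i, aeval a (g i).divX * b i) := by
          have hj : ∀ i, aeval a (g i) * b i = algebraMap Fq p.regularRing ((g i).coeff 0) * b i
              + a * (aeval a (g i).divX * b i) := fun i => by
            conv_lhs => rw [← X_mul_divX_add (g i)]
            simp only [map_add, map_mul, aeval_X, aeval_C]
            ring
          simp only [r]
          rw [Finset.sum_congr rfl fun i _ => hj i, Finset.sum_add_distrib, ← Finset.mul_sum]
          ring
        rw [this]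
        exact I.mul_mem_right _ haI

theorem isFractionRing (hF : IsCurveFunctionField Fq F) (p : Place Fq F) :
    IsFractionRing p.regularRing F := by
  obtain ⟨t, ht, htr⟩ := p.exists_transcendental_mem_regularRing hF
  have hA : ∀ f : Fq[X], aeval t f ∈ p.regularRing := fun f =>
    Algebra.adjoin_le (S := p.regularRing) (by simpa using ht)
      (aeval_mem_adjoin_singleton (p := f) Fq t)
  refine IsFractionRing.of_field _ _ fun y => ?_
  obtain ⟨f, hf0, hf⟩ := exists_integral_mul (hF.finiteDimensional_adjoin htr) y
  refine ⟨⟨aeval t f * y, fun v hv => ?_⟩, ⟨aeval t f, hA f⟩, ?_⟩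
  · exact (v.val_le_one_iff _).1
      (v.val_le_one_of_isIntegral ((v.val_le_one_iff _).2 (ht v hv)) hf)
  · have : aeval t f ≠ 0 := fun h => hf0 ((transcendental_iff.1 htr) _ h)
    change y = (aeval t f * y) / aeval t f
    field_simp

/-- Finiteness of the quotients makes `A` noetherian of dimension at most one; as an intersection of
valuation rings it is integrally closed. -/
theorem isDedekindDomain [Finite Fq] (hF : IsCurveFunctionField Fq F) (p : Place Fq F) :
    IsDedekindDomain p.regularRing := by
  have := p.hasFiniteQuotients hF
  have := p.isFractionRing hF
  have hic : IsIntegrallyClosed p.regularRing := by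
    rw [isIntegrallyClosed_iff F]
    intro x hx
    refine ⟨⟨x, fun v hv => ?_⟩, rfl⟩
    have h1 : IsIntegral v.toValuationSubring x := by
      obtain ⟨f, hf, hf0⟩ := hx
      let j : p.regularRing →+* v.toValuationSubring :=
        p.regularRing.val.toRingHom.codRestrict v.toValuationSubring.toSubring fun y => y.2 v hv
      refine ⟨f.map j, hf.map _, ?_⟩
      rw [eval₂_map]
      exact hf0
    obtain ⟨z, hz⟩ := (IsIntegrallyClosed.isIntegral_iff (R := v.toValuationSubring) (K := F)).1 h1
    rw [← hz]
    exact z.2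
  have hr : IsDedekindRing p.regularRing := (isDedekindRing_iff p.regularRing F).2
    ⟨inferInstance, inferInstance, fun h => (isIntegrallyClosed_iff F).1 hic h⟩
  exact ⟨⟩

end FunctionField

end Place

end DLattice

/-! ### Strong approximation -/

namespace DLattice

namespace Place

section StrongApproximation

variable {Fq F : Type*} [Field Fq] [Field F] [Algebra Fq F] {p : Place Fq F}

theorem val_regularRing_le {v : Place Fq F} (hv : v ≠ p) (a : p.regularRing) :
    v.val (a : F) ≤ 1 :=
  (v.val_le_one_iff _).2 (a.2 v hv)

/-- The prime ideal of `A` attached to a place other than `p`. -/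
def primeIdeal {v : Place Fq F} (hv : v ≠ p) : Ideal p.regularRing where
  carrier := {a | v.val (a : F) < 1}
  add_mem' ha hb := by
    rw [Set.mem_ofPred_eq] at ha hb ⊢
    exact Valuation.map_add_lt _ ha hb
  zero_mem' := by simp
  smul_mem' a b hb := by
    rw [Set.mem_ofPred_eq] at hb ⊢
    rw [smul_eq_mul, MulMemClass.coe_mul, map_mul]
    exact mul_lt_one_of_le_of_lt₀ (val_regularRing_le hv a) hb

theorem mem_primeIdeal {v : Place Fq F} (hv : v ≠ p) {a : p.regularRing} :
    a ∈ primeIdeal hv ↔ v.val (a : F) < 1 :=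
  Set.mem_ofPred

instance {v : Place Fq F} (hv : v ≠ p) : (primeIdeal hv).IsPrime where
  ne_top' h := by
    have h1 := (Ideal.eq_top_iff_one _).1 h
    rw [mem_primeIdeal] at h1
    simp at h1
  mem_or_mem' := by
    intro a b h
    by_contra! hab
    simp only [mem_primeIdeal, not_lt] at hab h
    rw [MulMemClass.coe_mul, map_mul] at h
    exact absurd h (not_lt.2 (one_le_mul hab.1 hab.2))

theorem exists_frac (hF : IsCurveFunctionField Fq F) (p : Place Fq F) (x : F) :
    ∃ b c : p.regularRing, c ≠ 0 ∧ x * c = b := by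
  have := p.isFractionRing hF
  obtain ⟨b, c, hc, rfl⟩ := IsFractionRing.div_surjective (A := p.regularRing) x
  have hc0 := nonZeroDivisors.ne_zero hc
  have hc1 : (c : F) ≠ 0 := fun h => hc0 (Subtype.ext h)
  exact ⟨b, c, hc0, div_mul_cancel₀ _ hc1⟩

theorem primeIdeal_ne_bot (hF : IsCurveFunctionField Fq F) {v : Place Fq F} (hv : v ≠ p) :
    primeIdeal hv ≠ ⊥ := by
  obtain ⟨x, hx0, hx⟩ := v.exists_ne_zero_val_lt_one
  obtain ⟨b, c, hc, hbc⟩ := exists_frac hF p x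
  intro h
  have hb : b ∈ primeIdeal hv := by
    rw [mem_primeIdeal, ← hbc, map_mul]
    exact mul_lt_one_of_lt_of_le₀ hx (val_regularRing_le hv c)
  rw [h, Ideal.mem_bot] at hb
  rw [hb, ZeroMemClass.coe_zero, mul_eq_zero] at hbc
  exact hbc.elim hx0 fun h => hc (Subtype.ext h)

/-- The localisation of `A` at the prime of `v` is a discrete valuation ring, so of the numerator
and denominator of `x` one divides the other locally. In the second case `v(x) ≤ 1` forces the new
denominator to be a unit at `v`. Thus the localisation is the local ring of `v`. -/
theorem exists_frac_val_eq_one [Finite Fq] (hF : IsCurveFunctionField Fq F) {v : Place Fq F}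
    (hv : v ≠ p) {x : F} (hx : v.val x ≤ 1) :
    ∃ b c : p.regularRing, v.val (c : F) = 1 ∧ x * c = b := by
  have := p.isFractionRing hF
  have := p.isDedekindDomain hF
  have hdvr : IsDiscreteValuationRing (Localization.AtPrime (primeIdeal hv)) :=
    IsLocalization.AtPrime.isDiscreteValuationRing_of_dedekind_domain p.regularRing
      (primeIdeal_ne_bot hF hv) _
  have hc1 : ∀ c : p.regularRing, c ∉ primeIdeal hv → v.val (c : F) = 1 := fun c hc =>
    le_antisymm (val_regularRing_le hv c) (not_lt.1 fun h => hc ((mem_primeIdeal hv).2 h))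
  have hdvd : ∀ b c : p.regularRing, algebraMap _ (Localization.AtPrime (primeIdeal hv)) b ∣
      algebraMap _ (Localization.AtPrime (primeIdeal hv)) c →
      ∃ r s : p.regularRing, s ∉ primeIdeal hv ∧ b * r = c * s := by
    rintro b c ⟨z, hz⟩
    obtain ⟨r, s, rfl⟩ := IsLocalization.exists_mk'_eq (primeIdeal hv).primeCompl z
    refine ⟨r, s, s.2, ?_⟩
    rw [IsLocalization.mul_mk'_eq_mk'_of_mul, eq_comm, IsLocalization.mk'_eq_iff_eq_mul,
      ← map_mul] at hz
    exact IsLocalization.injective _ (primeIdeal hv).primeCompl_le_nonZeroDivisors hz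
  obtain ⟨b, c, hc, hbc⟩ := exists_frac hF p x
  have hc0 : (c : F) ≠ 0 := fun h => hc (Subtype.ext h)
  rcases ValuationRing.dvd_total (algebraMap _ (Localization.AtPrime (primeIdeal hv)) c)
    (algebraMap _ (Localization.AtPrime (primeIdeal hv)) b) with h | h
  · obtain ⟨r, s, hs, hrs⟩ := hdvd _ _ h
    refine ⟨r, s, hc1 s hs, mul_left_cancel₀ hc0 ?_⟩
    have h1 : (c : F) * r = b * s := congrArg Subtype.val hrs
    rw [h1, ← hbc]; ring
  · obtain ⟨r, s, hs, hrs⟩ := hdvd _ _ h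
    have h1 : (b : F) * r = c * s := congrArg Subtype.val hrs
    have h2 : x * r = s := mul_left_cancel₀ hc0 (by rw [← h1, ← hbc]; ring)
    refine ⟨s, r, le_antisymm (val_regularRing_le hv r) ?_, h2⟩
    rw [← hc1 s hs, ← h2, map_mul]
    exact mul_le_of_le_one_left zero_le hx

/-- Modulo the maximal ideal of `v` the element `f` has an inverse: `fδ = 1 - ρ` with `ρ` small.
Since `1 - ρ` divides `1 - ρ^N`, so does `f`. -/
theorem exists_mul_sub_one_le [Finite Fq] (hF : IsCurveFunctionField Fq F) {v : Place Fq F}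
    (hv : v ≠ p) (f : p.regularRing) (hf : v.val (f : F) = 1) {a : F} (ha : a ≠ 0) :
    ∃ δ : p.regularRing, v.val ((f * δ : p.regularRing) - 1 : F) ≤ v.val a := by
  have := p.hasFiniteQuotients hF
  have hmax : (primeIdeal hv).IsMaximal :=
    Ring.HasFiniteQuotients.maximalOfPrime (primeIdeal_ne_bot hF hv)
  have hfm : f ∉ primeIdeal hv := by rw [mem_primeIdeal, hf]; exact lt_irrefl _
  obtain ⟨δ, ρ, hρ, h1⟩ := hmax.exists_inv hfm
  rw [mem_primeIdeal] at hρ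
  obtain ⟨N, hN⟩ := v.exists_pow_mul_le_one hF hρ a⁻¹
  obtain ⟨ε, hε⟩ : f ∣ 1 - ρ ^ N := by
    have : f ∣ 1 - ρ := ⟨δ, by rw [← h1]; ring⟩
    exact this.trans (by simpa using sub_dvd_pow_sub_pow 1 ρ N)
  refine ⟨ε, ?_⟩
  rw [← hε]
  have h2 := hN N le_rfl
  rw [map_mul, map_inv₀] at h2
  have : ((1 - ρ ^ N : p.regularRing) : F) - 1 = -((ρ : F) ^ N) := by push_cast; ring
  rw [this, Valuation.map_neg]
  have ha' : 0 < v.val a := by simpa [zero_lt_iff] using ha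
  rwa [← div_eq_mul_inv, div_le_one₀ ha'] at h2

theorem exists_approx_one [Finite Fq] (hF : IsCurveFunctionField Fq F) {v : Place Fq F}
    (hv : v ≠ p) {x : F} (hx : v.val x ≤ 1) {a : F} (ha : a ≠ 0) :
    ∃ α : p.regularRing, v.val (α - x) ≤ v.val a := by
  obtain ⟨b, c, hc, hbc⟩ := exists_frac_val_eq_one hF hv hx
  obtain ⟨δ, hδ⟩ := exists_mul_sub_one_le hF hv c hc ha
  refine ⟨b * δ, ?_⟩
  have : ((b * δ : p.regularRing) : F) - x = x * (((c * δ : p.regularRing) : F) - 1) := by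
    push_cast
    rw [← hbc]; ring
  rw [this, map_mul]
  exact mul_le_of_le_one_of_le hx hδ

theorem exists_separating [Finite Fq] (hF : IsCurveFunctionField Fq F) {v w : Place Fq F}
    (hv : v ≠ p) (hw : w ≠ p) (h : v ≠ w) :
    ∃ c : p.regularRing, v.val (c : F) = 1 ∧ w.val (c : F) < 1 := by
  obtain ⟨x, hxv, hxw⟩ := exists_not_mem_of_ne hF h
  obtain ⟨b, c, hc, hbc⟩ := exists_frac_val_eq_one hF hv hxv
  refine ⟨c, hc, ?_⟩
  by_contra! hle
  have h1 : w.val (x * c) ≤ 1 := hbc ▸ val_regularRing_le hw b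
  rw [map_mul] at h1
  exact absurd h1 (not_le.2 (one_lt_mul_of_lt_of_le hxw hle))

open Classical in
-- A product of elements that separate `v` from the other places of `S`, raised to a high power, is
-- small at those places and a unit at `v`; an approximate inverse at `v` then normalises it to 1.
theorem exists_idempotent_approx [Finite Fq] (hF : IsCurveFunctionField Fq F) {a : F} (ha : a ≠ 0)
    (S : Finset (Place Fq F)) (hS : p ∉ S) {v : Place Fq F} (hv : v ≠ p) :
    ∃ e : p.regularRing, v.val ((e : F) - 1) ≤ v.val a ∧
      ∀ w ∈ S.erase v, w.val (e : F) ≤ w.val a := by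
  classical
  have hSp : ∀ w ∈ S.erase v, w ≠ p := fun w hw h => hS (h ▸ Finset.mem_of_mem_erase hw)
  have hex : ∀ w : S.erase v, ∃ c : p.regularRing, v.val (c : F) = 1 ∧ w.1.val (c : F) < 1 :=
    fun w => exists_separating hF hv (hSp w w.2) (Finset.ne_of_mem_erase w.2).symm
  choose c hc1 hc2 using hex
  set γ := ∏ w, c w with hγ
  have hγv : v.val (γ : F) = 1 := by
    rw [hγ]; push_cast
    rw [map_prod]
    exact Finset.prod_eq_one fun w _ => hc1 w
  have hγw : ∀ w : S.erase v, w.1.val (γ : F) < 1 := fun w => by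
    rw [hγ, ← Finset.mul_prod_erase _ _ (Finset.mem_univ w)]
    push_cast
    rw [map_mul]
    exact mul_lt_one_of_lt_of_le₀ (hc2 w) (by
      have := val_regularRing_le (hSp w w.2) (∏ x ∈ Finset.univ.erase w, c x)
      push_cast at this
      exact this)
  obtain ⟨N, hN⟩ : ∃ N : ℕ, ∀ w : S.erase v, w.1.val ((γ : F) ^ N) ≤ w.1.val a := by
    have hex := fun w : S.erase v => w.1.exists_pow_mul_le_one hF (hγw w) a⁻¹
    choose N hN using hex
    refine ⟨Finset.univ.sup N, fun w => ?_⟩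
    have h2 := hN w _ (Finset.le_sup (f := N) (Finset.mem_univ w))
    rw [map_mul, map_inv₀] at h2
    have ha' : 0 < w.1.val a := by simpa [zero_lt_iff] using ha
    rwa [← div_eq_mul_inv, div_le_one₀ ha'] at h2
  obtain ⟨δ, hδ⟩ := exists_mul_sub_one_le hF hv (γ ^ N)
    (by push_cast; rw [map_pow, hγv, one_pow]) ha
  refine ⟨γ ^ N * δ, hδ, fun w hw => ?_⟩
  push_cast
  rw [map_mul]
  exact mul_le_of_le_of_le_one (hN ⟨w, hw⟩) (val_regularRing_le (hSp w hw) δ)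

/-- Strong approximation away from `p`. -/
theorem exists_strong_approx [Finite Fq] (hF : IsCurveFunctionField Fq F) (p : Place Fq F)
    {a : p.regularRing} (ha : a ≠ 0) (x : Place Fq F → F)
    (hx : ∀ v, v ≠ p → v.val (x v) ≤ 1) :
    ∃ α : p.regularRing, ∀ v, v ≠ p → v.val ((α : F) - x v) ≤ v.val (a : F) := by
  classical
  have ha' : (a : F) ≠ 0 := fun h => ha (Subtype.ext h)
  -- Only the finitely many places where `a` is not a unit matter. Elsewhere the required inequality
  -- holds for all integral elements.
  obtain ⟨S, hSm⟩ : ∃ S : Finset (Place Fq F), ∀ w, w ∈ S ↔ w ≠ p ∧ w.val (a : F) < 1 :=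
    ⟨(finite_val_lt_one hF ha').toFinset.erase p, fun w => by simp⟩
  have hS : p ∉ S := fun h => ((hSm p).1 h).1 rfl
  have h1 : ∀ v : Place Fq F, ∃ α : p.regularRing, v ≠ p → v.val ((α : F) - x v) ≤ v.val (a : F) :=
    fun v => by
      by_cases hv : v = p
      · exact ⟨0, fun h => absurd hv h⟩
      · obtain ⟨α, hα⟩ := exists_approx_one hF hv (hx v hv) ha'
        exact ⟨α, fun _ => hα⟩
  choose α hα using h1
  have h2 : ∀ v : Place Fq F, ∃ e : p.regularRing, v ≠ p → v.val ((e : F) - 1) ≤ v.val (a : F) ∧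
      ∀ w ∈ S.erase v, w.val (e : F) ≤ w.val (a : F) :=
    fun v => by
      by_cases hv : v = p
      · exact ⟨0, fun h => absurd hv h⟩
      · obtain ⟨e, he⟩ := exists_idempotent_approx hF ha' S hS hv
        refine ⟨e, fun _ => ?_⟩
        convert he
  choose e he using h2
  refine ⟨∑ v ∈ S, e v * α v, fun v hv => ?_⟩
  by_cases hvS : v ∈ S
  · have h3 : ((∑ w ∈ S, e w * α w : p.regularRing) : F) - x v =
        (((e v : F) - 1) * α v + (α v - x v)) + ∑ w ∈ S.erase v, (e w : F) * α w := by
      rw [← Finset.add_sum_erase _ _ hvS]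
      push_cast; ring
    rw [h3]
    have h5 : v.val (((e v : F) - 1) * α v) ≤ v.val (a : F) := by
      rw [map_mul]
      exact mul_le_of_le_of_le_one (he v hv).1 (val_regularRing_le hv _)
    have h6 : v.val (∑ w ∈ S.erase v, (e w : F) * α w) ≤ v.val (a : F) := by
      refine Valuation.map_sum_le _ fun w hw => ?_
      rw [map_mul]
      have hw' := Finset.mem_erase.1 hw
      exact mul_le_of_le_of_le_one ((he w ((hSm w).1 hw'.2).1).2 v
        (Finset.mem_erase.2 ⟨hw'.1.symm, hvS⟩)) (val_regularRing_le hv _)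
    exact Valuation.map_add_le _ (Valuation.map_add_le _ h5 (hα v hv)) h6
  · have h4 : 1 ≤ v.val (a : F) := by
      by_contra! h
      exact hvS ((hSm v).2 ⟨hv, h⟩)
    exact (Valuation.map_sub_le _ (val_regularRing_le hv _) (hx v hv)).trans h4

end StrongApproximation

end Place

end DLattice

/-! ### The ring `Â` and the adeles -/

namespace DLattice

namespace Place

section HatRing

variable {Fq F : Type*} [Field Fq] [Field F] [Algebra Fq F] {p : Place Fq F}

theorem toCompletion_ne_zero (v : Place Fq F) {x : F} (hx : x ≠ 0) : v.toCompletion x ≠ 0 :=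
  (map_ne_zero v.toCompletion).2 hx

theorem exists_valued_sub_le (v : Place Fq F) (x : v.Completion) {a : F} (ha : a ≠ 0) :
    ∃ y : F, Valued.v (x - v.toCompletion y) ≤ v.val a := by
  have hd : DenseRange v.toCompletion := by
    have h1 : DenseRange (UniformSpace.Completion.coe' :
        WithVal v.toValuationSubring.valuation → v.Completion) :=
      UniformSpace.Completion.denseRange_coe
    exact h1.comp (WithVal.equiv v.toValuationSubring.valuation).symm.surjective.denseRange
      (UniformSpace.Completion.continuous_coe _)
  have ha' : v.toCompletion a ≠ 0 := v.toCompletion_ne_zero ha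
  have hopen : IsOpen {y : v.Completion | Valued.v.restrict (y - x) <
      Valued.v.restrict (v.toCompletion a)} :=
    (Valued.isOpen_ball _ _).preimage (continuous_id.sub continuous_const)
  obtain ⟨y, hy⟩ := hd.exists_mem_open hopen ⟨x, by
    rw [Set.mem_ofPred_eq, sub_self, map_zero]
    simpa [zero_lt_iff] using ha'⟩
  rw [Set.mem_ofPred_eq, Valuation.restrict_lt_iff] at hy
  refine ⟨y, ?_⟩
  rw [← valued_toCompletion, Valuation.map_sub_swap]
  exact hy.le

theorem valued_sub_le {v : Place Fq F} {x y : v.Completion} {γ : v.toValuationSubring.ValueGroup}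
    (hx : Valued.v x ≤ γ) (hy : Valued.v y ≤ γ) : Valued.v (x - y) ≤ γ :=
  Valuation.map_sub_le _ hx hy

/-- Density of `F` in each completion reduces the claim to strong approximation in `F`. The
components of `y` are the quotients `(x - α)/a`, which are integral at every place. -/
theorem hatRing_approx [Finite Fq] (hF : IsCurveFunctionField Fq F) {a : p.regularRing}
    (ha : a ≠ 0) (x : p.HatRing) :
    ∃ (α : p.regularRing) (y : p.HatRing),
      x = algebraMap p.regularRing p.HatRing α + algebraMap p.regularRing p.HatRing a * y := by
  have ha' : (a : F) ≠ 0 := fun h => ha (Subtype.ext h)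
  have h1 : ∀ v : Place Fq F, ∃ y : F, ∀ hv : v ≠ p,
      Valued.v ((x ⟨v, hv⟩ : v.Completion) - v.toCompletion y) ≤ v.val (a : F) := by
    intro v
    by_cases hv : v = p
    · exact ⟨0, fun h => absurd hv h⟩
    · obtain ⟨y, hy⟩ := v.exists_valued_sub_le (x ⟨v, hv⟩ : v.Completion) ha'
      exact ⟨y, fun _ => hy⟩
  choose y hy using h1
  have hint : ∀ v : {v : Place Fq F // v ≠ p}, Valued.v (x v : v.1.Completion) ≤ 1 :=
    fun v => (x v).2
  have hy1 : ∀ v, v ≠ p → v.val (y v) ≤ 1 := fun v hv => by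
    rw [← valued_toCompletion]
    have h2 : v.toCompletion (y v) =
        x ⟨v, hv⟩ - ((x ⟨v, hv⟩ : v.Completion) - v.toCompletion (y v)) := by
      ring
    rw [h2]
    exact valued_sub_le (hint ⟨v, hv⟩) ((hy v hv).trans (val_regularRing_le hv a))
  obtain ⟨α, hα⟩ := exists_strong_approx hF p ha y hy1
  have h3 : ∀ v : {v : Place Fq F // v ≠ p},
      Valued.v (((x v : v.1.Completion) - v.1.toCompletion α) / v.1.toCompletion a) ≤ 1 := by
    intro v
    rw [map_div₀, valued_toCompletion]
    have ha'' : 0 < v.1.val (a : F) := by simpa [zero_lt_iff] using ha'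
    rw [div_le_one₀ ha'']
    have h4 : (x v : v.1.Completion) - v.1.toCompletion α =
        (x v - v.1.toCompletion (y v)) - v.1.toCompletion (α - y v) := by
      rw [map_sub]; ring
    rw [h4]
    refine valued_sub_le (hy v.1 v.2) ?_
    rw [valued_toCompletion]
    exact hα v.1 v.2
  refine ⟨α, fun v => ⟨_, h3 v⟩, ?_⟩
  funext v
  apply Subtype.ext
  change (x v : v.1.Completion) = v.1.toCompletion α + v.1.toCompletion a *
    (((x v : v.1.Completion) - v.1.toCompletion α) / v.1.toCompletion a)
  rw [mul_div_cancel₀ _ (v.1.toCompletion_ne_zero ha')]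
  ring

/-- The indicator function of the set of the places that divide `a`. -/
theorem exists_idempotent_hatRing {a : p.regularRing} (ha : a ≠ 0) :
    ∃ e : p.HatRing, e * e = e ∧
      (∀ b : p.regularRing, (∃ c d : p.regularRing, b * c + a * d = 1) →
        ∃ u : p.HatRing, algebraMap p.regularRing p.HatRing b * u * e = e) ∧
      ∃ u : p.HatRing, algebraMap p.regularRing p.HatRing a * u * (1 - e) = 1 - e := by
  classical
  have ha' : (a : F) ≠ 0 := fun h => ha (Subtype.ext h)
  let e : p.HatRing := fun v => if v.1.val (a : F) < 1 then 1 else 0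
  have hinv : ∀ (v : {v : Place Fq F // v ≠ p}) (b : p.regularRing), v.1.val (b : F) = 1 →
      (v.1.toCompletion (b : F))⁻¹ ∈ v.1.integers := fun v b hb => by
    refine (Valuation.mem_integer_iff _ _).2 ?_
    rw [map_inv₀, valued_toCompletion]
    simp [hb]
  refine ⟨e, ?_, ?_, ?_⟩
  · funext v
    change e v * e v = e v
    simp only [e]
    split_ifs <;> simp
  · rintro b ⟨c, d, hcd⟩
    -- The default value 0 is harmless: where `b` is not a unit, `a` is one, because they are
    -- coprime, and `e` vanishes there.
    let u : p.HatRing := fun v => if h : v.1.val (b : F) = 1 then ⟨_, hinv v b h⟩ else 0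
    refine ⟨u, ?_⟩
    funext v
    change algebraMap p.regularRing p.HatRing b v * u v * e v = e v
    by_cases h1 : v.1.val (a : F) < 1
    · have h2 : v.1.val (b : F) = 1 := by
        by_contra h2
        have hb : v.1.val (b : F) < 1 := lt_of_le_of_ne (val_regularRing_le v.2 b) h2
        have h3 : (b : F) * c + a * d = 1 := congrArg Subtype.val hcd
        have h4 : v.1.val ((b : F) * c + a * d) < 1 := by
          refine Valuation.map_add_lt _ ?_ ?_
          · rw [map_mul]; exact mul_lt_one_of_lt_of_le₀ hb (val_regularRing_le v.2 c)
          · rw [map_mul]; exact mul_lt_one_of_lt_of_le₀ h1 (val_regularRing_le v.2 d)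
        rw [h3, map_one] at h4
        exact lt_irrefl _ h4
      have he : e v = 1 := if_pos h1
      have hu : u v = ⟨_, hinv v b h2⟩ := dif_pos h2
      rw [he, hu, mul_one]
      apply Subtype.ext
      change v.1.toCompletion (b : F) * (v.1.toCompletion (b : F))⁻¹ = 1
      refine mul_inv_cancel₀ (v.1.toCompletion_ne_zero ?_)
      intro h0; rw [h0] at h2; simp at h2
    · have he : e v = 0 := if_neg h1
      rw [he, mul_zero]
  · let u : p.HatRing := fun v => if h : v.1.val (a : F) = 1 then ⟨_, hinv v a h⟩ else 0
    refine ⟨u, ?_⟩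
    funext v
    change algebraMap p.regularRing p.HatRing a v * u v * (1 - e v) = 1 - e v
    by_cases h1 : v.1.val (a : F) < 1
    · have he : e v = 1 := if_pos h1
      rw [he, sub_self, mul_zero]
    · have h2 := le_antisymm (val_regularRing_le v.2 a) (not_lt.1 h1)
      have he : e v = 0 := if_neg h1
      have hu : u v = ⟨_, hinv v a h2⟩ := dif_pos h2
      rw [he, hu, sub_zero, mul_one]
      apply Subtype.ext
      exact mul_inv_cancel₀ (v.1.toCompletion_ne_zero ha')

/-- Over a Dedekind domain torsion-free modules are flat; this is the source of the injectivity of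
`hatOrderMap`. -/
instance : Module.IsTorsionFree p.regularRing p.HatRing := by
  refine Module.IsTorsionFree.of_smul_eq_zero fun a x hax => ?_
  by_cases ha : a = 0
  · exact Or.inl ha
  right
  funext v
  apply Subtype.ext
  have h1 : v.1.toCompletion (a : F) * (x v : v.1.Completion) = 0 := by
    have h2 := congrArg Subtype.val (congrFun hax v)
    rw [Algebra.smul_def] at h2
    exact h2
  exact (mul_eq_zero.1 h1).resolve_left
    (v.1.toCompletion_ne_zero fun h => ha (Subtype.ext h))

/-- The homomorphism from the adeles away from `p` to the completion at `v`. -/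
def adeleEval (v : {v : Place Fq F // v ≠ p}) : p.AdeleRing →ₐ[p.regularRing] v.1.Completion :=
  Algebra.TensorProduct.lift
    (IsScalarTower.toAlgHom p.regularRing F v.1.Completion)
    ({ v.1.integers.subtype.comp (Pi.evalRingHom _ v) with commutes' := fun _ => rfl } :
      p.HatRing →ₐ[p.regularRing] v.1.Completion)
    (fun _ _ => Commute.all _ _)

theorem adeleEval_tmul (v : {v : Place Fq F // v ≠ p}) (x : F) (α : p.HatRing) :
    adeleEval v (x ⊗ₜ α) = v.1.toCompletion x * (α v : v.1.Completion) :=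
  Algebra.TensorProduct.lift_tmul _ _ _ _ _

/-- Evaluation at `v` shows that `x` is integral at every place `v ≠ p`: the intersection of `F` and
`Â` is `A`. -/
theorem mem_regularRing_of_tmul_eq {x : F} {α : p.HatRing}
    (h : (x ⊗ₜ[p.regularRing] (1 : p.HatRing) : p.AdeleRing) = 1 ⊗ₜ α) : x ∈ p.regularRing := by
  intro v hv
  have h1 := (adeleEval_tmul ⟨v, hv⟩ x 1).symm.trans
    ((congrArg (adeleEval ⟨v, hv⟩) h).trans (adeleEval_tmul ⟨v, hv⟩ 1 α))
  have h2 : v.toCompletion x = (α ⟨v, hv⟩ : v.Completion) := by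
    rw [map_one, one_mul] at h1
    rw [← h1]
    exact (mul_one _).symm
  rw [← val_le_one_iff, ← valued_toCompletion, h2]
  exact (α ⟨v, hv⟩).2

end HatRing

end Place

end DLattice

/-! ### Modules over an algebra finite over a central subring -/

namespace DLattice

section SimpleModules

variable {R : Type*} [Ring R]
variable {T : Type*} [AddCommGroup T] [Module R T] [IsSimpleModule R T]

/-- Let `T = Rt` and let the `yᵢ` span `R` over `A`. An element that kills all `yᵢt` kills `T`,
because `A` acts centrally. So `r ↦ (r yᵢ t)ᵢ` has the desired kernel. -/
theorem exists_pi_of_isSimpleModule (A : Type*) [CommRing A] [Algebra A R]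
    [Module.Finite A R]
    : ∃ (k : ℕ) (e : R →ₗ[R] Fin k → T),
    LinearMap.ker e ≤ Module.annihilator R T := by
  obtain ⟨k, y, hy⟩ := Module.Finite.exists_fin (R := A) (M := R)
  have := IsSimpleModule.nontrivial R T
  obtain ⟨t, ht⟩ := exists_ne (0 : T)
  refine ⟨k, LinearMap.pi fun i => LinearMap.toSpanSingleton R T (y i • t), fun o ho => ?_⟩
  rw [Module.mem_annihilator]
  intro t'
  obtain ⟨z, rfl⟩ := IsSimpleModule.toSpanSingleton_surjective R ht t'
  have hz : z ∈ Submodule.span A (Set.range y) := hy ▸ Submodule.mem_top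
  change o • z • t = 0
  induction hz using Submodule.span_induction with
  | mem x hx =>
    obtain ⟨i, rfl⟩ := hx
    exact congrFun (LinearMap.mem_ker.1 ho) i
  | zero => simp
  | add x x' _ _ hx hx' => rw [add_smul, smul_add, hx, hx', add_zero]
  | smul a x _ hx =>
    rw [smul_smul, Algebra.mul_smul_comm, Algebra.smul_def, mul_smul, ← smul_smul o, hx, smul_zero]

variable {N : Type*} [AddCommGroup N] [Module R N]

/-- Each cyclic submodule of `N` is a quotient of `R/ker e`, a submodule of a power of `T`. -/
theorem isSemisimpleModule_of_annihilator_le (A : Type*) [CommRing A] [Algebra A R]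
    [Module.Finite A R]
    (h : Module.annihilator R T ≤ Module.annihilator R N) : IsSemisimpleModule R N := by
  obtain ⟨k, e, he⟩ := exists_pi_of_isSimpleModule A (R := R) (T := T)
  have : IsSemisimpleModule R (R ⧸ LinearMap.ker e) :=
    IsSemisimpleModule.congr e.quotKerEquivRange
  refine isSemisimpleModule_of_isSemisimpleModule_submodule'
    (p := fun n : N => LinearMap.range (LinearMap.toSpanSingleton R N n)) (fun n => ?_) ?_
  · have hn : LinearMap.ker e ≤ LinearMap.ker (LinearMap.toSpanSingleton R N n) := fun o ho =>
      (Module.mem_annihilator.1 (h (he ho)) n :)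
    rw [← Submodule.range_liftQ _ _ hn]
    exact IsSemisimpleModule.range _
  · rw [eq_top_iff]
    intro n _
    exact Submodule.mem_iSup_of_mem n ⟨1, one_smul _ _⟩

/-- The simple module `N` is a quotient of the semisimple module `R/ker e`. A section embeds it in a
power of `T`, and a non-zero coordinate of the embedding is an isomorphism by Schur's lemma. -/
theorem nonempty_linearEquiv_of_annihilator_le (A : Type*) [CommRing A] [Algebra A R]
    [Module.Finite A R]
    [IsSimpleModule R N]
    (h : Module.annihilator R T ≤ Module.annihilator R N) : Nonempty (N ≃ₗ[R] T) := by
  obtain ⟨k, e, he⟩ := exists_pi_of_isSimpleModule A (R := R) (T := T)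
  have : IsSemisimpleModule R (R ⧸ LinearMap.ker e) :=
    IsSemisimpleModule.congr e.quotKerEquivRange
  have := IsSimpleModule.nontrivial R N
  obtain ⟨n, hn0⟩ := exists_ne (0 : N)
  have hn : LinearMap.ker e ≤ LinearMap.ker (LinearMap.toSpanSingleton R N n) := fun o ho =>
    (Module.mem_annihilator.1 (h (he ho)) n :)
  let g := Submodule.liftQ _ _ hn
  have hg : Function.Surjective g := by
    rw [← LinearMap.range_eq_top, Submodule.range_liftQ, LinearMap.range_eq_top]
    exact IsSimpleModule.toSpanSingleton_surjective R hn0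
  obtain ⟨s, hs⟩ := IsSemisimpleModule.lifting_property g hg LinearMap.id
  let q : (R ⧸ LinearMap.ker e) →ₗ[R] (Fin k → T) := Submodule.liftQ _ e le_rfl
  have hq : Function.Injective q := LinearMap.ker_eq_bot.1 (Submodule.ker_liftQ_eq_bot _ _ _ le_rfl)
  have hsn : q (s n) ≠ 0 := by
    intro h0
    have h1 : s n = 0 := hq (h0.trans (map_zero q).symm)
    have h2 : g (s n) = n := LinearMap.congr_fun hs n
    rw [h1, map_zero] at h2
    exact hn0 h2.symm
  obtain ⟨i, hi⟩ := Function.ne_iff.1 hsn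
  have h3 : (LinearMap.proj i).comp (q.comp s) ≠ 0 := fun h0 => hi (LinearMap.congr_fun h0 n)
  exact ⟨LinearEquiv.ofBijective _ (LinearMap.bijective_of_ne_zero h3)⟩

/-- Modules killed by the annihilator of a simple module `T` are sums of copies of `T`. -/
theorem exists_linearEquiv_fun_of_annihilator_le (A : Type*) [CommRing A] [Algebra A R]
    [Module.Finite A R]
    [Module.Finite R N]
    (h : Module.annihilator R T ≤ Module.annihilator R N) :
    ∃ n : ℕ, Nonempty (N ≃ₗ[R] Fin n → T) := by
  have := isSemisimpleModule_of_annihilator_le A h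
  have hi : IsIsotypicOfType R N T := fun m _ =>
    nonempty_linearEquiv_of_annihilator_le A (h.trans fun o ho =>
      Module.mem_annihilator.2 fun x => Subtype.ext (Module.mem_annihilator.1 ho x))
  exact hi.linearEquiv_fun

/-- Both modules are powers of `T`, and the larger power projects onto the smaller. No comparison of
ranks is needed to know which one is larger. -/
theorem exists_surjective_or_surjective (A : Type*) [CommRing A] [Algebra A R]
    [Module.Finite A R]
    {N' : Type*} [AddCommGroup N'] [Module R N']
    [Module.Finite R N] [Module.Finite R N']
    (h : Module.annihilator R T ≤ Module.annihilator R N)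
    (h' : Module.annihilator R T ≤ Module.annihilator R N') :
    (∃ f : N →ₗ[R] N', Function.Surjective f) ∨ ∃ f : N' →ₗ[R] N, Function.Surjective f := by
  obtain ⟨n, ⟨e⟩⟩ := exists_linearEquiv_fun_of_annihilator_le A h
  obtain ⟨m, ⟨e'⟩⟩ := exists_linearEquiv_fun_of_annihilator_le A h'
  rcases le_total m n with hmn | hmn
  · left
    exact ⟨e'.symm.toLinearMap.comp ((LinearMap.funLeft R T (Fin.castLE hmn)).comp e.toLinearMap),
      e'.symm.surjective.comp ((LinearMap.funLeft_surjective_of_injective R T _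
        (Fin.castLE_injective hmn)).comp e.surjective)⟩
  · right
    exact ⟨e.symm.toLinearMap.comp ((LinearMap.funLeft R T (Fin.castLE hmn)).comp e'.toLinearMap),
      e.symm.surjective.comp ((LinearMap.funLeft_surjective_of_injective R T _
        (Fin.castLE_injective hmn)).comp e'.surjective)⟩

variable (T) in
/-- The annihilator of a simple module is a maximal two-sided ideal. -/
theorem sup_annihilator_eq_top (A : Type*) [CommRing A] [Algebra A R]
    [Module.Finite A R]
    (X : Ideal R) [X.IsTwoSided]
    (h : ¬ X ≤ Module.annihilator R T) : X ⊔ Module.annihilator R T = ⊤ := by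
  by_contra hne
  -- The simple module `R/n` is killed by the two-sided ideals contained in `n`. Being killed by the
  -- annihilator of `T` makes it isomorphic to `T`, and then `X`, which also kills it, kills `T`.
  obtain ⟨n, hn, hle⟩ := Ideal.exists_le_maximal _ hne
  have : IsSimpleModule R (R ⧸ n) := isSimpleModule_iff_isCoatom.2 hn.out
  have hkill : ∀ Y : Ideal R, Y.IsTwoSided → Y ≤ n → Y ≤ Module.annihilator R (R ⧸ n) := by
    intro Y hY hYn y hy
    rw [Module.mem_annihilator]
    intro z
    obtain ⟨z, rfl⟩ := Submodule.Quotient.mk_surjective _ z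
    rw [← Submodule.Quotient.mk_smul, Submodule.Quotient.mk_eq_zero]
    exact hYn (Ideal.mul_mem_right _ _ hy)
  obtain ⟨e⟩ := nonempty_linearEquiv_of_annihilator_le A (T := T) (N := R ⧸ n)
    (hkill _ inferInstance (le_sup_right.trans hle))
  exact h ((hkill X inferInstance (le_sup_left.trans hle)).trans
    e.annihilator_eq.le)

end SimpleModules

end DLattice

/-! ### Two-sided ideals of a maximal order -/

namespace DLattice

section Orders

variable {A D : Type*} [CommRing A] [Ring D] [Algebra A D]

/-- An abstract form of maximality for orders over `A` in the `A`-algebra `D`. -/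
structure IsMaximalFullOrder (O : Subalgebra A D) : Prop where
  finite : Module.Finite A O
  exists_smul_mem : ∀ x : D, ∃ a : A, a ≠ 0 ∧ a • x ∈ O
  isUnit_algebraMap : ∀ a : A, a ≠ 0 → IsUnit (algebraMap A D a)
  le_of_le : ∀ O' : Subalgebra A D, O ≤ O' → Module.Finite A O' → O' ≤ O

/-- A two-sided ideal of the order `O`, which contains a non-zero element of `A`. -/
structure IsTwoSidedIdeal (O : Subalgebra A D) (X : Submodule A D) : Prop where
  le : ∀ x ∈ X, x ∈ O
  mul_left : ∀ o ∈ O, ∀ x ∈ X, o * x ∈ X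
  mul_right : ∀ o ∈ O, ∀ x ∈ X, x * o ∈ X
  exists_mem : ∃ a : A, a ≠ 0 ∧ algebraMap A D a ∈ X

variable {O : Subalgebra A D}

namespace IsMaximalFullOrder

/-- Multiplication by `a` embeds `O'` in the noetherian `A`-module `O`, so `O'` is finite over `A`
and maximality applies. This is how maximality is used below, always with a ring of multipliers as
`O'`. -/
theorem mem_of_smul_mem [IsNoetherianRing A] [Module.IsTorsionFree A D]
    (hO : IsMaximalFullOrder O) {O' : Subalgebra A D} (hle : O ≤ O')
    {a : A} (ha : IsRegular a) (h : ∀ x ∈ O', a • x ∈ O) : O' ≤ O := by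
  have := hO.finite
  refine hO.le_of_le O' hle ?_
  let f : O' →ₗ[A] O :=
    { toFun := fun x => ⟨a • (x : D), h x x.2⟩
      map_add' := fun x y => Subtype.ext (smul_add a (x : D) y)
      map_smul' := fun c x => Subtype.ext (smul_comm a c (x : D)) }
  have hf : Function.Injective f := fun x y hxy =>
    Subtype.ext (Module.IsTorsionFree.isSMulRegular ha (congrArg Subtype.val hxy))
  have := isNoetherian_of_injective f hf
  infer_instance

end IsMaximalFullOrder

namespace IsTwoSidedIdeal

variable {X Y M : Submodule A D}

theorem self [Nontrivial A] : IsTwoSidedIdeal O (Subalgebra.toSubmodule O) where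
  le _ hx := hx
  mul_left _ ho _ hx := O.mul_mem ho hx
  mul_right _ ho _ hx := O.mul_mem hx ho
  exists_mem := ⟨1, one_ne_zero, by rw [map_one]; exact O.one_mem⟩

theorem mul [NoZeroDivisors A] (hX : IsTwoSidedIdeal O X) (hY : IsTwoSidedIdeal O Y) :
    IsTwoSidedIdeal O (X * Y) where
  le z hz := by
    induction hz using Submodule.mul_induction_on' with
    | mem_mul_mem x hx y hy => exact O.mul_mem (hX.le x hx) (hY.le y hy)
    | add x _ y _ hx hy => exact O.add_mem hx hy
  mul_left o ho z hz := by
    induction hz using Submodule.mul_induction_on' with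
    | mem_mul_mem x hx y hy =>
      rw [← mul_assoc]
      exact Submodule.mul_mem_mul (hX.mul_left o ho x hx) hy
    | add x _ y _ hx hy => rw [mul_add]; exact add_mem hx hy
  mul_right o ho z hz := by
    induction hz using Submodule.mul_induction_on' with
    | mem_mul_mem x hx y hy =>
      rw [mul_assoc]
      exact Submodule.mul_mem_mul hx (hY.mul_right o ho y hy)
    | add x _ y _ hx hy => rw [add_mul]; exact add_mem hx hy
  exists_mem := by
    obtain ⟨a, ha, haX⟩ := hX.exists_mem
    obtain ⟨b, hb, hbY⟩ := hY.exists_mem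
    exact ⟨a * b, mul_ne_zero ha hb, by rw [map_mul]; exact Submodule.mul_mem_mul haX hbY⟩

theorem mul_le_left (hX : IsTwoSidedIdeal O X) (hY : ∀ y ∈ Y, y ∈ O) : X * Y ≤ X :=
  Submodule.mul_le.2 fun x hx y hy => hX.mul_right y (hY y hy) x hx

theorem mul_le_right (hX : ∀ y ∈ X, y ∈ O) (hY : IsTwoSidedIdeal O Y) : X * Y ≤ Y :=
  Submodule.mul_le.2 fun x hx y hy => hY.mul_left x (hX x hx) y hy

theorem order_mul (hX : IsTwoSidedIdeal O X) : Subalgebra.toSubmodule O * X = X :=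
  le_antisymm (Submodule.mul_le.2 fun o ho x hx => hX.mul_left o ho x hx)
    fun x hx => by
      simpa using Submodule.mul_mem_mul (show (1 : D) ∈ Subalgebra.toSubmodule O from O.one_mem) hx

theorem mul_order (hX : IsTwoSidedIdeal O X) : X * Subalgebra.toSubmodule O = X :=
  le_antisymm (Submodule.mul_le.2 fun x hx o ho => hX.mul_right o ho x hx)
    fun x hx => by
      simpa using Submodule.mul_mem_mul hx (show (1 : D) ∈ Subalgebra.toSubmodule O from O.one_mem)

theorem eq_order_of_one_mem (hX : IsTwoSidedIdeal O X) (h : (1 : D) ∈ X) :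
    X = Subalgebra.toSubmodule O :=
  le_antisymm hX.le fun o ho => by simpa using hX.mul_left o ho 1 h

theorem exists_mul_add_eq_one (hX : IsTwoSidedIdeal O X) (hM : IsTwoSidedIdeal O M)
    (h₁ : ∃ x ∈ X, ∃ m ∈ M, x + m = 1) (h₂ : ∃ y ∈ Y, ∃ m ∈ M, y + m = 1) :
    ∃ x ∈ X * Y, ∃ m ∈ M, x + m = 1 := by
  obtain ⟨x, hx, m, hm, h1⟩ := h₁
  obtain ⟨y, hy, n, hn, h2⟩ := h₂
  refine ⟨x * y, Submodule.mul_mem_mul hx hy, x * n + m, add_mem (hM.mul_left x (hX.le x hx) n hn)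
    hm, ?_⟩
  rw [← add_assoc, ← mul_add, h2, mul_one, h1]

section Inverse

variable [IsDomain A] [IsNoetherianRing A] [Module.IsTorsionFree A D]

/-- The left multipliers of `X` form a ring that contains `O`; since `X` contains a non-zero `a ∈
A`, the product of this ring with `a` lies in `X ⊂ O`. -/
theorem mem_of_mul_mem (hO : IsMaximalFullOrder O) (hX : IsTwoSidedIdeal O X) {y : D}
    (h : ∀ x ∈ X, y * x ∈ X) : y ∈ O := by
  let O' : Subalgebra A D :=
    { carrier := {y | ∀ x ∈ X, y * x ∈ X}
      mul_mem' := fun {y z} hy hz x hx => by rw [mul_assoc]; exact hy _ (hz x hx)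
      add_mem' := fun {y z} hy hz x hx => by rw [add_mul]; exact add_mem (hy x hx) (hz x hx)
      algebraMap_mem' := fun r x hx => by
        rw [← Algebra.smul_def]; exact X.smul_mem r hx }
  obtain ⟨a, ha, haX⟩ := hX.exists_mem
  refine hO.mem_of_smul_mem (O' := O') (fun o ho x hx => hX.mul_left o ho x hx)
    (IsRegular.of_ne_zero ha) (fun x hx => ?_) (x := y) h
  rw [Algebra.smul_def, Algebra.commutes]
  exact hX.le _ (hx _ haX)

theorem mem_of_mul_mem' (hO : IsMaximalFullOrder O) (hX : IsTwoSidedIdeal O X) {y : D}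
    (h : ∀ x ∈ X, x * y ∈ X) : y ∈ O := by
  let O' : Subalgebra A D :=
    { carrier := {y | ∀ x ∈ X, x * y ∈ X}
      mul_mem' := fun {y z} hy hz x hx => by rw [← mul_assoc]; exact hz _ (hy x hx)
      add_mem' := fun {y z} hy hz x hx => by rw [mul_add]; exact add_mem (hy x hx) (hz x hx)
      algebraMap_mem' := fun r x hx => by
        rw [← Algebra.commutes, ← Algebra.smul_def]; exact X.smul_mem r hx }
  obtain ⟨a, ha, haX⟩ := hX.exists_mem
  refine hO.mem_of_smul_mem (O' := O') (fun o ho x hx => hX.mul_right o ho x hx)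
    (IsRegular.of_ne_zero ha) (fun x hx => ?_) (x := y) h
  rw [Algebra.smul_def]
  exact hX.le _ (hx _ haX)

end Inverse

end IsTwoSidedIdeal

/-- The elements of `D` that multiply `X` into the order `O`. -/
def idealInverse (O : Subalgebra A D) (X : Submodule A D) : Submodule A D where
  carrier := {z | ∀ x ∈ X, z * x ∈ O}
  add_mem' hy hz x hx := by rw [add_mul]; exact add_mem (hy x hx) (hz x hx)
  zero_mem' x _ := by rw [zero_mul]; exact O.zero_mem
  smul_mem' c z hz x hx := by rw [smul_mul_assoc]; exact O.smul_mem (hz x hx) c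

namespace IsTwoSidedIdeal

variable {X Y M : Submodule A D}

theorem one_mem_idealInverse (hX : IsTwoSidedIdeal O X) : (1 : D) ∈ idealInverse O X :=
  fun x hx => by rw [one_mul]; exact hX.le x hx

theorem idealInverse_mul_left {o : D} (ho : o ∈ O) {z : D} (hz : z ∈ idealInverse O X) :
    o * z ∈ idealInverse O X := fun x hx => by rw [mul_assoc]; exact O.mul_mem ho (hz x hx)

theorem idealInverse_mul_right (hX : IsTwoSidedIdeal O X) {o : D} (ho : o ∈ O) {z : D}
    (hz : z ∈ idealInverse O X) : z * o ∈ idealInverse O X := fun x hx => by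
  rw [mul_assoc]; exact hz _ (hX.mul_left o ho x hx)

variable [IsDomain A] [IsNoetherianRing A] [Module.IsTorsionFree A D]

/-- Left and right inverses agree: `zX ⊂ O` gives `(Xz)X ⊂ X`, so that `Xz` consists of left
multipliers of `X`, and symmetrically. -/
theorem mem_idealInverse_iff (hO : IsMaximalFullOrder O) (hX : IsTwoSidedIdeal O X) {z : D} :
    z ∈ idealInverse O X ↔ ∀ x ∈ X, x * z ∈ O := by
  constructor
  · intro h x hx
    refine mem_of_mul_mem hO hX fun y hy => ?_
    rw [mul_assoc]
    exact hX.mul_right _ (h y hy) x hx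
  · intro h x hx
    refine mem_of_mul_mem' hO hX fun y hy => ?_
    rw [← mul_assoc]
    exact hX.mul_left _ (h y hy) x hx

end IsTwoSidedIdeal

section Annihilator

variable (T : Type*) [AddCommGroup T] [Module O T]

/-- The annihilator of an `O`-module, as a submodule of `D`. -/
def annihilatorIn : Submodule A D :=
  ((Module.annihilator O T).restrictScalars A).map O.val.toLinearMap

variable {T}

theorem mem_annihilatorIn {x : D} :
    x ∈ annihilatorIn (O := O) T ↔ ∃ h : x ∈ O, ∀ t : T, (⟨x, h⟩ : O) • t = 0 := by
  constructor
  · rintro ⟨y, hy, rfl⟩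
    exact ⟨y.2, Module.mem_annihilator.1 hy⟩
  · rintro ⟨h, hx⟩
    exact ⟨⟨x, h⟩, Module.mem_annihilator.2 hx, rfl⟩

theorem isTwoSidedIdeal_annihilatorIn {a : A} (ha : a ≠ 0)
    (h : ∀ t : T, algebraMap A O a • t = 0) : IsTwoSidedIdeal O (annihilatorIn (O := O) T) where
  le x hx := (mem_annihilatorIn.1 hx).1
  mul_left o ho x hx := by
    obtain ⟨hx, h⟩ := mem_annihilatorIn.1 hx
    refine mem_annihilatorIn.2 ⟨O.mul_mem ho hx, fun t => ?_⟩
    have : (⟨o * x, O.mul_mem ho hx⟩ : O) = ⟨o, ho⟩ * ⟨x, hx⟩ := rfl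
    rw [this, mul_smul, h, smul_zero]
  mul_right o ho x hx := by
    obtain ⟨hx, h⟩ := mem_annihilatorIn.1 hx
    refine mem_annihilatorIn.2 ⟨O.mul_mem hx ho, fun t => ?_⟩
    have : (⟨x * o, O.mul_mem hx ho⟩ : O) = ⟨x, hx⟩ * ⟨o, ho⟩ := rfl
    rw [this, mul_smul, h]
  exists_mem := ⟨a, ha, mem_annihilatorIn.2 ⟨O.algebraMap_mem a, h⟩⟩

theorem one_notMem_annihilatorIn [Nontrivial T] : (1 : D) ∉ annihilatorIn (O := O) T := by
  intro h
  obtain ⟨_, h⟩ := mem_annihilatorIn.1 h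
  obtain ⟨t, ht⟩ := exists_ne (0 : T)
  exact ht ((one_smul O t).symm.trans (h t))

theorem IsTwoSidedIdeal.exists_add_eq_one (hO : IsMaximalFullOrder O) [IsSimpleModule O T]
    {X : Submodule A D} (hX : IsTwoSidedIdeal O X) (h : ¬ X ≤ annihilatorIn (O := O) T) :
    ∃ x ∈ X, ∃ m ∈ annihilatorIn (O := O) T, x + m = 1 := by
  have := hO.finite
  let I : Ideal O :=
    { carrier := {o | (o : D) ∈ X}
      add_mem' := fun hx hy => X.add_mem hx hy
      zero_mem' := X.zero_mem
      smul_mem' := fun c x hx => hX.mul_left c c.2 x hx }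
  have hI : I.IsTwoSided := ⟨fun b hb => hX.mul_right b b.2 _ hb⟩
  have h1 : ¬ I ≤ Module.annihilator O T := fun hle => h fun x hx =>
    mem_annihilatorIn.2 ⟨hX.le x hx, Module.mem_annihilator.1
      (hle (show ⟨x, hX.le x hx⟩ ∈ I from hx))⟩
  have h2 := sup_annihilator_eq_top T A I h1
  obtain ⟨x, hx, m, hm, hxm⟩ := Submodule.mem_sup.1 (h2 ▸ Submodule.mem_top : (1 : O) ∈ _)
  exact ⟨x, hx, m, mem_annihilatorIn.2 ⟨m.2, Module.mem_annihilator.1 hm⟩,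
    congrArg Subtype.val hxm⟩

end Annihilator

end Orders

end DLattice

/-! ### Invertibility of the two-sided primes -/

namespace DLattice

section Orders

theorem finite_quotient_span_algebraMap {A R : Type*} [CommRing A] [Ring.HasFiniteQuotients A]
    [Ring R] [Algebra A R] [Module.Finite A R] {a : A} (ha : a ≠ 0) :
    Finite (R ⧸ Ideal.span {algebraMap A R a}) := by
  have ht : Module.IsTorsionBySet A (R ⧸ Ideal.span {algebraMap A R a})
      (Ideal.span {a} : Ideal A) := by
    rw [Module.isTorsionBySet_span_singleton_iff]
    intro x
    obtain ⟨x, rfl⟩ := Submodule.Quotient.mk_surjective _ x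
    rw [← Submodule.Quotient.mk_smul, Submodule.Quotient.mk_eq_zero, Algebra.smul_def,
      Algebra.commutes]
    exact Ideal.mul_mem_left _ _ (Ideal.mem_span_singleton_self _)
  let : Module (A ⧸ Ideal.span {a}) (R ⧸ Ideal.span {algebraMap A R a}) := ht.module
  have : IsScalarTower A (A ⧸ Ideal.span {a}) (R ⧸ Ideal.span {algebraMap A R a}) :=
    ht.isScalarTower
  have : Module.Finite (A ⧸ Ideal.span {a}) (R ⧸ Ideal.span {algebraMap A R a}) :=
    Module.Finite.of_restrictScalars_finite A _ _
  have : Finite (A ⧸ Ideal.span {a}) :=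
    Ring.HasFiniteQuotients.finiteQuotient (by simpa using ha)
  exact Module.finite_of_finite (A ⧸ Ideal.span {a})

variable {A D : Type*} [CommRing A] [IsDomain A] [Ring.HasFiniteQuotients A] [Ring D] [Algebra A D]
  [Module.IsTorsionFree A D] {O : Subalgebra A D}
variable {T : Type*} [AddCommGroup T] [Module O T] [IsSimpleModule O T]

open IsTwoSidedIdeal

/-- Suppose `M⁻¹ ⊂ O`. Descending through the left submodules `J` of the finite module `O/aO`, one
builds two-sided ideals `X` and `Y` such that `X` maps into `J`, `Y` is comaximal with `M`, and `X⁻¹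
⊂ Y⁻¹`. At each step `X` is multiplied by an ideal that kills the next simple factor. The case `J =
0` is contradictory. -/
theorem not_idealInverse_annihilatorIn_le (hO : IsMaximalFullOrder O) {a : A} (ha : a ≠ 0)
    (hT : ∀ t : T, algebraMap A O a • t = 0) :
    ¬ idealInverse O (annihilatorIn (O := O) T) ≤ Subalgebra.toSubmodule O := by
  intro hle
  have := hO.finite
  have := IsSimpleModule.nontrivial O T
  set M := annihilatorIn (O := O) T with hMdef
  have hM : IsTwoSidedIdeal O M := isTwoSidedIdeal_annihilatorIn ha hT
  have : Finite (O ⧸ Ideal.span {algebraMap A O a}) := finite_quotient_span_algebraMap ha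
  have good : ∀ J : Submodule O (O ⧸ Ideal.span {algebraMap A O a}),
      ∃ X Y : Submodule A D, IsTwoSidedIdeal O X ∧ IsTwoSidedIdeal O Y ∧
        (∀ o : O, (o : D) ∈ X → Submodule.Quotient.mk o ∈ J) ∧
        (∃ y ∈ Y, ∃ m ∈ M, y + m = 1) ∧ idealInverse O X ≤ idealInverse O Y := by
    intro J
    induction J using WellFoundedGT.induction with
    | ind J ih =>
    by_cases hJ : J = ⊤
    · exact ⟨_, _, self, self, fun o _ => hJ ▸ Submodule.mem_top,
        ⟨1, O.one_mem, 0, M.zero_mem, add_zero 1⟩, le_rfl⟩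
    obtain ⟨J₂, hcov⟩ := exists_covBy_of_wellFoundedLT (a := J) (fun h => hJ h.eq_top)
    obtain ⟨X₂, Y₂, hX₂, hY₂, hXJ, hYM, hinv⟩ := ih J₂ hcov.lt
    have hsimple := (covBy_iff_quot_is_simple hcov.le).1 hcov
    set T' := J₂ ⧸ Submodule.comap J₂.subtype J with hT'
    have hkill : ∀ t : T', algebraMap A O a • t = 0 := by
      intro t
      obtain ⟨⟨t, ht⟩, rfl⟩ := Submodule.Quotient.mk_surjective _ t
      obtain ⟨x, rfl⟩ := Submodule.Quotient.mk_surjective _ t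
      rw [← Submodule.Quotient.mk_smul, Submodule.Quotient.mk_eq_zero, Submodule.mem_comap]
      have : algebraMap A O a • (Submodule.Quotient.mk x : O ⧸ Ideal.span {algebraMap A O a}) =
          0 := by
        rw [← Submodule.Quotient.mk_smul, Submodule.Quotient.mk_eq_zero, smul_eq_mul,
          Algebra.commutes]
        exact Ideal.mul_mem_left _ _ (Ideal.mem_span_singleton_self _)
      change algebraMap A O a • (Submodule.Quotient.mk x : O ⧸ Ideal.span {algebraMap A O a}) ∈ J
      rw [this]
      exact J.zero_mem
    have hX₁ : IsTwoSidedIdeal O (annihilatorIn (O := O) T') :=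
      isTwoSidedIdeal_annihilatorIn ha hkill
    have hmem : ∀ Z : Submodule A D, Z ≤ annihilatorIn (O := O) T' →
        ∀ o : O, (o : D) ∈ Z * X₂ → Submodule.Quotient.mk o ∈ J := by
      rintro Z hZ ⟨o, ho'⟩ ho
      change o ∈ Z * X₂ at ho
      induction ho using Submodule.mul_induction_on' with
      | mem_mul_mem x hx y hy =>
        obtain ⟨hxO, hx⟩ := mem_annihilatorIn.1 (hZ hx)
        have h1 := hx (Submodule.Quotient.mk ⟨Submodule.Quotient.mk ⟨y, hX₂.le y hy⟩,
          hXJ ⟨y, hX₂.le y hy⟩ hy⟩)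
        rw [← Submodule.Quotient.mk_smul, Submodule.Quotient.mk_eq_zero] at h1
        exact h1
      | add x hx y hy hx' hy' =>
        have hZ' : ∀ z ∈ Z, z ∈ O := fun z hz => hX₁.le z (hZ hz)
        have hZX : ∀ z ∈ Z * X₂, z ∈ O := fun z hz => hX₂.le z (mul_le_right hZ' hX₂ hz)
        exact J.add_mem (hx' (hZX x hx)) (hy' (hZX y hy))
    -- If `M` kills the simple factor, `X₂` may be multiplied by `M` with `Y₂` unchanged, because
    -- `M⁻¹ ⊂ O` makes `(MX₂)⁻¹ ⊂ X₂⁻¹`. Otherwise the annihilator of the factor is comaximal with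
    -- `M`, and both ideals are multiplied by it.
    by_cases hMX : M ≤ annihilatorIn (O := O) T'
    · refine ⟨M * X₂, Y₂, hM.mul hX₂, hY₂, hmem M hMX, hYM, le_trans (fun z hz => ?_) hinv⟩
      rw [mem_idealInverse_iff hO hX₂]
      intro x hx
      refine hle ?_
      rw [mem_idealInverse_iff hO hM]
      intro m hm
      rw [← mul_assoc]
      exact (mem_idealInverse_iff hO (hM.mul hX₂)).1 hz _ (Submodule.mul_mem_mul hm hx)
    · obtain ⟨m, hm, x, hx, hmx⟩ := hM.exists_add_eq_one hO hMX
      refine ⟨annihilatorIn (O := O) T' * X₂, annihilatorIn (O := O) T' * Y₂, hX₁.mul hX₂,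
        hX₁.mul hY₂, hmem _ le_rfl, hX₁.exists_mul_add_eq_one hM ⟨x, hx, m, hm, ?_⟩ hYM,
        fun z hz w hw => ?_⟩
      · rw [add_comm, hmx]
      · induction hw using Submodule.mul_induction_on' with
        | mem_mul_mem x hx y hy =>
          rw [← mul_assoc]
          refine hinv (fun x' hx' => ?_) y hy
          rw [mul_assoc]
          exact hz _ (Submodule.mul_mem_mul hx hx')
        | add x _ y _ hx hy => rw [mul_add]; exact O.add_mem hx hy
  -- Now `X ⊂ aO`, so `a⁻¹ ∈ X⁻¹ ⊂ Y⁻¹` and `Y ⊂ aO ⊂ M`, although `Y` is comaximal with `M`.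
  obtain ⟨X, Y, hX, hY, hXJ, ⟨y, hy, m, hm, hym⟩, hinv⟩ := good ⊥
  obtain ⟨u, hu⟩ := hO.isUnit_algebraMap a ha
  have hub : ∀ x : D, (↑u⁻¹ : D) * (x * algebraMap A D a) = x := fun x => by
    rw [← Algebra.commutes, ← hu, ← mul_assoc, Units.inv_mul, one_mul]
  have hbX : (↑u⁻¹ : D) ∈ idealInverse O X := by
    intro x hx
    have h1 := hXJ ⟨x, hX.le x hx⟩ hx
    rw [Submodule.mem_bot, Submodule.Quotient.mk_eq_zero, Ideal.mem_span_singleton'] at h1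
    obtain ⟨c, hc⟩ := h1
    have h2 : (c : D) * algebraMap A D a = x := congrArg Subtype.val hc
    rw [← h2, hub]
    exact c.2
  have h3 : (↑u⁻¹ : D) * y ∈ O := hinv hbX y hy
  have h4 : y ∈ M := by
    refine mem_annihilatorIn.2 ⟨hY.le y hy, fun t => ?_⟩
    have : (⟨y, hY.le y hy⟩ : O) = ⟨_, h3⟩ * algebraMap A O a := Subtype.ext <| by
      change y = (↑u⁻¹ : D) * y * algebraMap A D a
      rw [mul_assoc, hub]
    rw [this, mul_smul, hT, smul_zero]
  exact one_notMem_annihilatorIn (O := O) (T := T) (hym ▸ M.add_mem h4 hm)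

/-- The products `M⁻¹M` and `MM⁻¹` are two-sided ideals that contain `M`. By maximality of `M` each
is `O` or `M`. If one were `M`, the elements of `M⁻¹` would be multipliers of `M`, hence in `O`. -/
theorem idealInverse_mul_annihilatorIn (hO : IsMaximalFullOrder O) {a : A} (ha : a ≠ 0)
    (hT : ∀ t : T, algebraMap A O a • t = 0) :
    idealInverse O (annihilatorIn (O := O) T) * annihilatorIn (O := O) T =
        Subalgebra.toSubmodule O ∧
      annihilatorIn (O := O) T * idealInverse O (annihilatorIn (O := O) T) =
        Subalgebra.toSubmodule O := by
  have := IsSimpleModule.nontrivial O T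
  have hnle := not_idealInverse_annihilatorIn_le hO ha hT
  set M := annihilatorIn (O := O) T with hMdef
  have hM : IsTwoSidedIdeal O M := isTwoSidedIdeal_annihilatorIn ha hT
  obtain ⟨c, hc, hcM⟩ := hM.exists_mem
  have h1 : IsTwoSidedIdeal O (idealInverse O M * M) :=
    { le := fun z hz => by
        induction hz using Submodule.mul_induction_on' with
        | mem_mul_mem x hx y hy => exact hx y hy
        | add x _ y _ hx hy => exact O.add_mem hx hy
      mul_left := fun o ho z hz => by
        induction hz using Submodule.mul_induction_on' with
        | mem_mul_mem x hx y hy =>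
          rw [← mul_assoc]
          exact Submodule.mul_mem_mul (idealInverse_mul_left ho hx) hy
        | add x _ y _ hx hy => rw [mul_add]; exact add_mem hx hy
      mul_right := fun o ho z hz => by
        induction hz using Submodule.mul_induction_on' with
        | mem_mul_mem x hx y hy =>
          rw [mul_assoc]
          exact Submodule.mul_mem_mul hx (hM.mul_right o ho y hy)
        | add x _ y _ hx hy => rw [add_mul]; exact add_mem hx hy
      exists_mem := ⟨c, hc, by simpa using Submodule.mul_mem_mul hM.one_mem_idealInverse hcM⟩ }
  have h2 : IsTwoSidedIdeal O (M * idealInverse O M) :=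
    { le := fun z hz => by
        induction hz using Submodule.mul_induction_on' with
        | mem_mul_mem x hx y hy => exact (mem_idealInverse_iff hO hM).1 hy x hx
        | add x _ y _ hx hy => exact O.add_mem hx hy
      mul_left := fun o ho z hz => by
        induction hz using Submodule.mul_induction_on' with
        | mem_mul_mem x hx y hy =>
          rw [← mul_assoc]
          exact Submodule.mul_mem_mul (hM.mul_left o ho x hx) hy
        | add x _ y _ hx hy => rw [mul_add]; exact add_mem hx hy
      mul_right := fun o ho z hz => by
        induction hz using Submodule.mul_induction_on' with
        | mem_mul_mem x hx y hy =>
          rw [mul_assoc]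
          exact Submodule.mul_mem_mul hx (hM.idealInverse_mul_right ho hy)
        | add x _ y _ hx hy => rw [add_mul]; exact add_mem hx hy
      exists_mem := ⟨c, hc, by simpa using Submodule.mul_mem_mul hcM hM.one_mem_idealInverse⟩ }
  have key : ∀ Z : Submodule A D, IsTwoSidedIdeal O Z → M ≤ Z → ¬ Z ≤ M →
      Z = Subalgebra.toSubmodule O := by
    intro Z hZ hMZ hZM
    obtain ⟨x, hx, m, hm, hxm⟩ := hZ.exists_add_eq_one hO hZM
    exact hZ.eq_order_of_one_mem (hxm ▸ Z.add_mem hx (hMZ hm))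
  constructor
  · refine key _ h1 (fun m hm => by
      simpa using Submodule.mul_mem_mul hM.one_mem_idealInverse hm) fun hle => hnle fun z hz => ?_
    exact mem_of_mul_mem hO hM fun x hx => hle (Submodule.mul_mem_mul hz hx)
  · refine key _ h2 (fun m hm => by
      simpa using Submodule.mul_mem_mul hm hM.one_mem_idealInverse) fun hle => hnle fun z hz => ?_
    exact mem_of_mul_mem' hO hM fun x hx => hle (Submodule.mul_mem_mul hx hz)

end Orders

end DLattice

/-! ### A single two-sided prime over each maximal ideal of the centre -/

namespace DLattice

/-- Intended for the monoid of submodules of `D`: `s` is the order, which acts as an identity on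
ideals without being 1, and `c` is 1 or generated by a central element. -/
theorem pow_succ_mul_pow_succ_of_mul_eq {S : Type*} [Monoid S] {x y c s : S} (h : x * y = c * s)
    (hc : Commute c x) (hs : s * y = y) (n : ℕ) :
    x ^ (n + 1) * y ^ (n + 1) = c ^ (n + 1) * s := by
  induction n with
  | zero => simpa using h
  | succ n ih =>
    have h1 : s * y ^ (n + 1) = y ^ (n + 1) := by rw [pow_succ', ← mul_assoc, hs]
    rw [pow_succ x, pow_succ' y, mul_assoc, ← mul_assoc x, h, mul_assoc c, h1, ← mul_assoc,
      ← (hc.pow_right (n + 1)).eq, mul_assoc, ih, ← mul_assoc, ← pow_succ']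

section Orders

variable {A D : Type*} [CommRing A] [Ring D] [Algebra A D] {O : Subalgebra A D}

theorem mem_span_algebraMap_mul {a : A} {X : Submodule A D} {z : D} :
    z ∈ Submodule.span A {algebraMap A D a} * X ↔ ∃ x ∈ X, z = a • x := by
  constructor
  · intro hz
    induction hz using Submodule.mul_induction_on' with
    | mem_mul_mem y hy x hx =>
      obtain ⟨b, rfl⟩ := Submodule.mem_span_singleton.1 hy
      exact ⟨b • x, X.smul_mem b hx, by
        rw [smul_mul_assoc, ← Algebra.smul_def, smul_comm]⟩
    | add y _ y' _ hy hy' =>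
      obtain ⟨x, hx, rfl⟩ := hy
      obtain ⟨x', hx', rfl⟩ := hy'
      exact ⟨x + x', X.add_mem hx hx', (smul_add _ _ _).symm⟩
  · rintro ⟨x, hx, rfl⟩
    rw [Algebra.smul_def]
    exact Submodule.mul_mem_mul (Submodule.mem_span_singleton_self _) hx

theorem commute_span_algebraMap (a : A) (X : Submodule A D) :
    Commute (Submodule.span A {algebraMap A D a}) X := by
  refine le_antisymm (Submodule.mul_le.2 fun y hy x hx => ?_)
    (Submodule.mul_le.2 fun x hx y hy => ?_)
  all_goals
    obtain ⟨b, rfl⟩ := Submodule.mem_span_singleton.1 hy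
    have h : Commute (b • algebraMap A D a) x := (Algebra.commute_algebraMap_left a x).smul_left b
  · rw [h.eq]
    exact Submodule.mul_mem_mul hx hy
  · rw [← h.eq]
    exact Submodule.mul_mem_mul hy hx

theorem exists_eq_smul_of_mem_span_smul {N : Type*} [AddCommGroup N] [Module A N] {a : A}
    {X : Submodule A N} {z : N} (hz : z ∈ Ideal.span {a} • X) : ∃ x ∈ X, z = a • x := by
  induction hz using Submodule.smul_induction_on' with
  | smul r hr x hx =>
    obtain ⟨b, rfl⟩ := Ideal.mem_span_singleton'.1 hr
    exact ⟨b • x, X.smul_mem b hx, by rw [smul_smul, mul_comm]⟩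
  | add y _ y' _ hy hy' =>
    obtain ⟨x, hx, rfl⟩ := hy
    obtain ⟨x', hx', rfl⟩ := hy'
    exact ⟨x + x', X.add_mem hx hx', (smul_add _ _ _).symm⟩

/-- An element that commutes with `O` modulo a high power of `a` is central modulo `a`. -/
theorem exists_eq_algebraMap_add_smul [IsNoetherianRing A] [Module.Finite A O]
    (hcenter : ∀ x ∈ O, (∀ y ∈ O, x * y = y * x) → ∃ α : A, x = algebraMap A D α) (a : A) :
    ∃ N : ℕ, ∀ x ∈ O, (∀ y ∈ O, ∃ o ∈ O, x * y - y * x = a ^ N • o) →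
      ∃ α : A, ∃ o ∈ O, x = algebraMap A D α + a • o := by
  obtain ⟨k, y, hy⟩ := Module.Finite.exists_fin (R := A) (M := O)
  let φ : O →ₗ[A] (Fin k → O) :=
    LinearMap.pi fun i => LinearMap.mulRight A (y i) - LinearMap.mulLeft A (y i)
  have hφ : ∀ x i, φ x i = x * y i - y i * x := fun x i => rfl
  -- Artin–Rees for the map `φ` of commutators with the generators: a value of `φ` divisible by
  -- `a^(n+1)` is `a φ(x')`. Then `x - ax'` commutes with `O`, hence lies in `A`.
  obtain ⟨n, hn⟩ := Ideal.exists_pow_inf_eq_pow_smul (Ideal.span {a}) (LinearMap.range φ)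
  refine ⟨n + 1, fun x hx hxy => ?_⟩
  have h1 : φ ⟨x, hx⟩ ∈ Ideal.span {a} ^ (n + 1) • (⊤ : Submodule A (Fin k → O)) ⊓
      LinearMap.range φ := by
    refine ⟨?_, LinearMap.mem_range_self _ _⟩
    choose o ho hxo using fun i => hxy (y i) (y i).2
    have : φ ⟨x, hx⟩ = a ^ (n + 1) • fun i => (⟨o i, ho i⟩ : O) := by
      ext i
      exact hxo i
    rw [this]
    exact Submodule.smul_mem_smul (Ideal.pow_mem_pow (Ideal.mem_span_singleton_self a) _)
      Submodule.mem_top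
  rw [hn (n + 1) (Nat.le_succ n), Nat.add_sub_cancel_left, pow_one] at h1
  obtain ⟨_, ⟨-, x', rfl⟩, h3⟩ := exists_eq_smul_of_mem_span_smul h1
  obtain ⟨α, hα⟩ := hcenter (x - a • (x' : D)) (O.sub_mem hx (O.smul_mem x'.2 a)) fun z hz => by
    have hz' : (⟨z, hz⟩ : O) ∈ Submodule.span A (Set.range y) := hy ▸ Submodule.mem_top
    have key : ∀ w : O, (⟨x, hx⟩ - a • x') * w = w * (⟨x, hx⟩ - a • x') := by
      intro w
      have hw : w ∈ Submodule.span A (Set.range y) := hy ▸ Submodule.mem_top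
      induction hw using Submodule.span_induction with
      | mem w hw =>
        obtain ⟨i, rfl⟩ := hw
        have h4 := congrFun h3 i
        rw [← map_smul, hφ, hφ] at h4
        rw [sub_mul, mul_sub, sub_eq_sub_iff_sub_eq_sub, h4]
      | zero => simp
      | add w w' _ _ hw hw' => rw [mul_add, add_mul, hw, hw']
      | smul c w _ hw => rw [mul_smul_comm, smul_mul_assoc, hw]
    exact congrArg Subtype.val (key ⟨z, hz⟩)
  exact ⟨α, x', x'.2, by rw [← hα]; abel⟩

end Orders

section Power

variable {A D : Type*} [CommRing A] [IsDomain A] [Ring D] [Algebra A D] {O : Subalgebra A D}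

open IsTwoSidedIdeal

theorem IsTwoSidedIdeal.pow_succ {X : Submodule A D} (hX : IsTwoSidedIdeal O X) (n : ℕ) :
    IsTwoSidedIdeal O (X ^ (n + 1)) := by
  induction n with
  | zero => simpa using hX
  | succ n ih => rw [_root_.pow_succ]; exact ih.mul hX

theorem IsTwoSidedIdeal.pow_succ_le {X : Submodule A D} (hX : IsTwoSidedIdeal O X) (n : ℕ) :
    X ^ (n + 1) ≤ X := by
  induction n with
  | zero => simp
  | succ n ih => rw [_root_.pow_succ]; exact mul_le_right (hX.pow_succ n).le hX

theorem IsTwoSidedIdeal.exists_pow_add_eq_one {X M : Submodule A D} (hX : IsTwoSidedIdeal O X)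
    (hM : IsTwoSidedIdeal O M) (h : ∃ x ∈ X, ∃ m ∈ M, x + m = 1) (n : ℕ) :
    ∃ x ∈ X ^ (n + 1), ∃ m ∈ M, x + m = 1 := by
  induction n with
  | zero => simpa using h
  | succ n ih => rw [_root_.pow_succ]; exact (hX.pow_succ n).exists_mul_add_eq_one hM ih h

variable [Ring.HasFiniteQuotients A] [Module.IsTorsionFree A D]

/-- If `a` were in all powers of `M`, the elements that multiply some power of `M` into `O` would
form a ring `U` with `aU ⊂ O`. Maximality gives `U ⊂ O`, but `M⁻¹ ⊂ U`. -/
theorem exists_algebraMap_notMem_pow (hO : IsMaximalFullOrder O) {M : Submodule A D}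
    (hM : IsTwoSidedIdeal O M) (hnle : ¬ idealInverse O M ≤ Subalgebra.toSubmodule O)
    {a : A} (ha : a ≠ 0) : ∃ n : ℕ, algebraMap A D a ∉ M ^ (n + 1) := by
  by_contra! hall
  refine hnle fun z hz => ?_
  have hexp : ∀ n k : ℕ, M ^ (n + k + 1 + 1) = M ^ (k + 1) * M ^ (n + 1) := fun n k => by
    rw [← pow_add]
    congr 1
    ring
  let U : Subalgebra A D :=
    { carrier := {x | ∃ n, ∀ m ∈ M ^ (n + 1), x * m ∈ O}
      mul_mem' := by
        rintro x y ⟨n, hx⟩ ⟨k, hy⟩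
        refine ⟨n + k + 1, fun m hm => ?_⟩
        rw [hexp] at hm
        induction hm using Submodule.mul_induction_on' with
        | mem_mul_mem m hm m' hm' =>
          rw [mul_assoc, ← mul_assoc y]
          exact hx _ ((hM.pow_succ n).mul_left _ (hy m hm) m' hm')
        | add m _ m' _ hm hm' => rw [mul_add]; exact O.add_mem hm hm'
      add_mem' := by
        rintro x y ⟨n, hx⟩ ⟨k, hy⟩
        refine ⟨n + k + 1, fun m hm => ?_⟩
        rw [hexp] at hm
        rw [add_mul]
        exact O.add_mem (hx m (mul_le_right (hM.pow_succ k).le (hM.pow_succ n) hm))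
          (hy m ((hM.pow_succ k).mul_le_left (hM.pow_succ n).le hm))
      algebraMap_mem' := fun r =>
        ⟨0, fun m hm => O.mul_mem (O.algebraMap_mem r) ((hM.pow_succ 0).le m hm)⟩ }
  refine hO.mem_of_smul_mem (O' := U)
    (fun o ho => ⟨0, fun m hm => O.mul_mem ho ((hM.pow_succ 0).le m hm)⟩)
    (IsRegular.of_ne_zero ha) ?_ (x := z) ⟨0, fun m hm => hz m (by simpa using hm)⟩
  rintro x ⟨n, hx⟩
  rw [Algebra.smul_def, Algebra.commutes]
  exact hx _ (hall n)

variable {T : Type*} [AddCommGroup T] [Module O T] [IsSimpleModule O T]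

/-- Over a maximal ideal of the centre of a maximal order there is only one two-sided prime. -/
theorem exists_annihilatorIn_pow_le (hO : IsMaximalFullOrder O)
    (hcenter : ∀ x ∈ O, (∀ y ∈ O, x * y = y * x) → ∃ α : A, x = algebraMap A D α)
    (P : Ideal A) [P.IsMaximal] {a : A} (ha : a ≠ 0) (haP : a ∈ P)
    (hT : ∀ α ∈ P, ∀ t : T, algebraMap A O α • t = 0) :
    ∃ e : ℕ, annihilatorIn (O := O) T ^ (e + 1) ≤ P • Subalgebra.toSubmodule O := by
  have := IsSimpleModule.nontrivial O T
  have := hO.finite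
  have hnle := not_idealInverse_annihilatorIn_le hO ha (hT a haP)
  obtain ⟨hWM, hMW⟩ := idealInverse_mul_annihilatorIn hO ha (hT a haP)
  have hM : IsTwoSidedIdeal O (annihilatorIn (O := O) T) :=
    isTwoSidedIdeal_annihilatorIn ha (hT a haP)
  have hPM : ∀ α ∈ P, algebraMap A D α ∈ annihilatorIn (O := O) T := fun α hα =>
    mem_annihilatorIn.2 ⟨O.algebraMap_mem α, hT α hα⟩
  have h1M : (1 : D) ∉ annihilatorIn (O := O) T := one_notMem_annihilatorIn
  set M := annihilatorIn (O := O) T with hMdef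
  set S := Subalgebra.toSubmodule O with hS
  set V := idealInverse O M with hV
  have hSV : S * V = V := le_antisymm
    (Submodule.mul_le.2 fun o ho z hz => idealInverse_mul_left ho hz)
    fun z hz => by simpa using Submodule.mul_mem_mul (show (1 : D) ∈ S from O.one_mem) hz
  have hVS : V * S = V := le_antisymm
    (Submodule.mul_le.2 fun z hz o ho => hM.idealInverse_mul_right ho hz)
    fun z hz => by simpa using Submodule.mul_mem_mul hz (show (1 : D) ∈ S from O.one_mem)
  -- the exact power of `M` containing `a`
  classical
  have hex := exists_algebraMap_notMem_pow hO hM hnle ha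
  obtain ⟨e, he⟩ : ∃ e, Nat.find hex = e + 1 := by
    refine Nat.exists_eq_succ_of_ne_zero fun h0 => ?_
    have := Nat.find_spec hex
    rw [h0] at this
    exact this (by simpa using hPM a haP)
  have hae : algebraMap A D a ∈ M ^ (e + 1) := not_not.1 (Nat.find_min hex (by omega))
  have hae' : algebraMap A D a ∉ M ^ (e + 1 + 1) := he ▸ Nat.find_spec hex
  refine ⟨e, ?_⟩
  have hQ := hM.pow_succ e
  set Q := M ^ (e + 1) with hQdef
  set W := V ^ (e + 1) with hWdef
  set c := Submodule.span A {algebraMap A D a} with hc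
  have hWQ : W * Q = S := by
    have := pow_succ_mul_pow_succ_of_mul_eq (c := 1) (hWM.trans (one_mul S).symm)
      (Commute.one_left V) hM.order_mul e
    simpa using this
  have hQW : Q * W = S := by
    have := pow_succ_mul_pow_succ_of_mul_eq (c := 1) (hMW.trans (one_mul S).symm)
      (Commute.one_left M) hSV e
    simpa using this
  have hSW : S * W = W := by rw [hWdef, pow_succ', ← mul_assoc, hSV]
  have hWS : W * S = W := by rw [hWdef, _root_.pow_succ, mul_assoc, hVS]
  have hcQ : c ≤ Q := by rw [hc, Submodule.span_singleton_le_iff_mem]; exact hae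
  -- With `Q = M^(e+1)`, the ideal `I = aQ⁻¹` is the cofactor of `Q` in `aO`. It is contained in `O`
  -- because `a ∈ Q`, and not contained in `M` because `a ∉ M^(e+2)`.
  set I := c * W with hI
  have hIQ : I * Q = c * S := by rw [hI, mul_assoc, hWQ]
  have hQI : Q * I = c * S := by
    rw [hI, ← mul_assoc, ← (commute_span_algebraMap a Q).eq, mul_assoc, hQW]
  have h1W : (1 : D) ∈ W := by
    have h1V : (1 : Submodule A D) ≤ V := Submodule.one_le.2 hM.one_mem_idealInverse
    exact Submodule.one_le.1 (one_le_pow_of_one_le' h1V _)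
  have haI : algebraMap A D a ∈ I := by
    simpa using Submodule.mul_mem_mul (Submodule.mem_span_singleton_self (algebraMap A D a)) h1W
  have hIint : IsTwoSidedIdeal O I :=
    { le := by
        have : I ≤ S := hQW ▸ mul_le_mul_left hcQ W
        exact this
      mul_left := fun o ho x hx => by
        have : S * I = I := by
          rw [hI, ← mul_assoc, ← (commute_span_algebraMap a S).eq, mul_assoc, hSW]
        exact this ▸ Submodule.mul_mem_mul (show o ∈ S from ho) hx
      mul_right := fun o ho x hx => by
        have : I * S = I := by rw [hI, mul_assoc, hWS]
        exact this ▸ Submodule.mul_mem_mul hx (show o ∈ S from ho)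
      exists_mem := ⟨a, ha, haI⟩ }
  have hInle : ¬ I ≤ M := fun hle => hae' <| by
    have h1 : c * S ≤ M ^ (e + 1 + 1) := by
      rw [← hIQ, pow_succ']
      exact mul_le_mul_left hle Q
    exact h1 (mem_span_algebraMap_mul.2 ⟨1, O.one_mem, (Algebra.algebraMap_eq_smul_one a)⟩)
  obtain ⟨N, hN⟩ := exists_eq_algebraMap_add_smul hcenter a
  -- `I` and `M` are comaximal, so their powers are too. Since `εOμ` and `μOε` lie in `a^(N+1)O`,
  -- the element `ε` is central modulo `a^(N+1)`, and therefore congruent modulo `a` to some `α ∈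
  -- A`. Centrality of `D` enters here.
  obtain ⟨ε, hε, μ, hμ, hεμ⟩ : ∃ ε ∈ I ^ (N + 1), ∃ μ ∈ Q ^ (N + 1), ε + μ = 1 := by
    obtain ⟨x, hx, m, hm, h⟩ :=
      hIint.exists_pow_add_eq_one hM (hIint.exists_add_eq_one hO hInle) N
    obtain ⟨m', hm', x', hx', h'⟩ := hM.exists_pow_add_eq_one (hIint.pow_succ N)
      ⟨m, hm, x, hx, by rw [add_comm, h]⟩ e
    obtain ⟨m', hm', x', hx', h'⟩ := hQ.exists_pow_add_eq_one (hIint.pow_succ N)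
      ⟨m', hm', x', hx', h'⟩ N
    exact ⟨x', hx', m', hm', by rw [add_comm, h']⟩
  have hcpow : c ^ (N + 1) = Submodule.span A {algebraMap A D (a ^ (N + 1))} := by
    rw [hc, Submodule.span_pow, Set.singleton_pow, map_pow]
  have hIQN : I ^ (N + 1) * Q ^ (N + 1) = Submodule.span A {algebraMap A D (a ^ (N + 1))} * S := by
    rw [← hcpow]
    exact pow_succ_mul_pow_succ_of_mul_eq hIQ (commute_span_algebraMap a I) hQ.order_mul N
  have hQIN : Q ^ (N + 1) * I ^ (N + 1) = Submodule.span A {algebraMap A D (a ^ (N + 1))} * S := by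
    rw [← hcpow]
    exact pow_succ_mul_pow_succ_of_mul_eq hQI (commute_span_algebraMap a Q) hIint.order_mul N
  obtain ⟨α, o, ho, hα⟩ := hN ε ((hIint.pow_succ N).le ε hε) fun y hy => by
    have h1 : ε * y - y * ε = (ε * y) * μ - μ * (y * ε) := by
      have h2 : ε * y = (ε * y) * (ε + μ) := by rw [hεμ, mul_one]
      have h3 : y * ε = (ε + μ) * (y * ε) := by rw [hεμ, one_mul]
      rw [mul_add] at h2
      rw [add_mul] at h3
      calc ε * y - y * ε = (ε * y * ε + ε * y * μ) - (ε * (y * ε) + μ * (y * ε)) := by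
            rw [← h2, ← h3]
        _ = _ := by rw [mul_assoc ε y ε]; abel
    obtain ⟨o₁, ho₁, h₁⟩ := mem_span_algebraMap_mul.1 (hIQN ▸ Submodule.mul_mem_mul
      ((hIint.pow_succ N).mul_right y hy ε hε) hμ)
    obtain ⟨o₂, ho₂, h₂⟩ := mem_span_algebraMap_mul.1 (hQIN ▸ Submodule.mul_mem_mul hμ
      ((hIint.pow_succ N).mul_left y hy ε hε))
    refine ⟨a • (o₁ - o₂), O.smul_mem (O.sub_mem ho₁ ho₂) a, ?_⟩
    rw [h1, h₁, h₂, ← smul_sub, smul_smul, _root_.pow_succ]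
  -- Otherwise `ε`, and with it `1 = ε + μ`, would lie in `M`.
  have hαP : α ∉ P := fun hαP => h1M <| by
    rw [← hεμ, hα, Algebra.smul_def]
    exact M.add_mem (M.add_mem (hPM α hαP) (hM.mul_right o ho _ (hPM a haP)))
      (hM.pow_succ_le e (hQ.pow_succ_le N hμ))
  have hαI : algebraMap A D α ∈ I := by
    have : algebraMap A D α = ε - algebraMap A D a * o := by
      rw [hα, Algebra.smul_def, add_sub_cancel_right]
    rw [this]
    exact I.sub_mem (hIint.pow_succ_le N hε) (hIint.mul_right o ho _ haI)
  -- Since `α ∈ I`, one has `αQ ⊂ IQ = aO ⊂ PO`; as `α` is invertible modulo `P`, this gives `Q ⊂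
  -- PO`.
  obtain ⟨β, π, hπ, hβ⟩ := Ideal.IsMaximal.exists_inv ‹P.IsMaximal› hαP
  intro x hx
  have h1 : algebraMap A D α * x ∈ c * S := hIQ ▸ Submodule.mul_mem_mul hαI hx
  obtain ⟨s, hs, h1⟩ := mem_span_algebraMap_mul.1 h1
  have h2 : x = β • (a • s) + π • x := by
    rw [← h1, ← Algebra.smul_def, smul_smul, ← add_smul, hβ, one_smul]
  rw [h2]
  exact add_mem (Submodule.smul_mem _ _ (Submodule.smul_mem_smul haP hs))
    (Submodule.smul_mem_smul hπ (hQ.le x hx))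

end Power

end DLattice

/-! ### Projective lattices and locally principal lattices -/

namespace DLattice

section Lattices

variable {A D : Type*} [CommRing A] [Ring D] [Algebra A D] {O : Subalgebra A D}

/-- The left ideal multiples `O x` of an element `x`. -/
def orderSpan (O : Subalgebra A D) (x : D) : Submodule A D :=
  (Subalgebra.toSubmodule O).map (LinearMap.mulRight A x)

/-- Nakayama's lemma. Localisation at `P` is expressed by a denominator `r` congruent to 1 modulo
`P`. -/
theorem exists_mem_sub_one_smul_le (L : Submodule O D) [Module.Finite A O] [Module.Finite O L]
    {x : D} {P : Ideal A} (h : L.restrictScalars A ≤ orderSpan O x ⊔ P • L.restrictScalars A) :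
    ∃ r : A, r - 1 ∈ P ∧ ∀ l ∈ L, r • l ∈ orderSpan O x := by
  have : Module.Finite A L := Module.Finite.trans O L
  have hfg : (L.restrictScalars A).FG := Module.Finite.iff_fg.1 ‹Module.Finite A L›
  obtain ⟨r, hr, hle⟩ := Submodule.exists_sub_one_mem_and_smul_le_of_fg_of_le_sup hfg le_rfl h
  exact ⟨r, hr, fun l hl => hle (Submodule.smul_mem_pointwise_smul l r _ hl)⟩

theorem ideal_smul_mul_le (P : Ideal A) (L : Submodule O D) :
    (P • Subalgebra.toSubmodule O) * L.restrictScalars A ≤ P • L.restrictScalars A := by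
  refine Submodule.mul_le.2 fun m hm l hl => ?_
  induction hm using Submodule.smul_induction_on' with
  | smul p hp s hs =>
    rw [smul_mul_assoc]
    exact Submodule.smul_mem_smul hp (L.smul_mem ⟨s, hs⟩ hl)
  | add y _ y' _ hy hy' => rw [add_mul]; exact add_mem hy hy'

theorem exists_ideal_eq_smul_top (P : Ideal A) :
    ∃ J : Ideal O, ∀ x : O, x ∈ J ↔ x ∈ P • (⊤ : Submodule A O) := by
  refine ⟨{ (P • (⊤ : Submodule A O)).toAddSubmonoid with
    smul_mem' := fun c x hx => ?_ }, fun x => Iff.rfl⟩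
  change c * x ∈ P • (⊤ : Submodule A O)
  replace hx : x ∈ P • (⊤ : Submodule A O) := hx
  induction hx using Submodule.smul_induction_on' with
  | smul p hp s _ =>
    rw [mul_smul_comm]
    exact Submodule.smul_mem_smul hp Submodule.mem_top
  | add y _ y' _ hy hy' => rw [mul_add]; exact add_mem hy hy'

/-- By Nakayama's lemma `PO ≠ O`; a maximal left ideal that contains `PO` gives the simple module.
-/
theorem exists_isSimpleModule_of_isMaximal [IsDomain A] [Module.IsTorsionFree A D] [Nontrivial D]
    [Module.Finite A O] (P : Ideal A) [P.IsMaximal] :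
    ∃ n : Ideal O, IsSimpleModule O (O ⧸ n) ∧
      ∀ α ∈ P, ∀ t : O ⧸ n, algebraMap A O α • t = 0 := by
  obtain ⟨J, hJmem⟩ := exists_ideal_eq_smul_top (O := O) P
  have hJ : J ≠ ⊤ := by
    intro hJ
    have hle : (⊤ : Submodule A O) ≤ P • (⊤ : Submodule A O) := fun x _ => by
      exact (hJmem x).1 (hJ ▸ Submodule.mem_top)
    obtain ⟨r, hr, h⟩ := Submodule.exists_sub_one_mem_and_smul_eq_zero_of_fg_of_le_smul P ⊤
      Module.Finite.fg_top hle
    have h1 : r • (1 : D) = 0 := congrArg Subtype.val (h 1 Submodule.mem_top)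
    by_cases hr0 : r = 0
    · rw [hr0, zero_sub, neg_mem_iff] at hr
      exact Ideal.IsPrime.ne_top' ((Ideal.eq_top_iff_one P).2 hr)
    · exact one_ne_zero (Module.IsTorsionFree.isSMulRegular (IsRegular.of_ne_zero hr0)
        (h1.trans (smul_zero r).symm))
  obtain ⟨n, hn, hle⟩ := Ideal.exists_le_maximal J hJ
  refine ⟨n, isSimpleModule_iff_isCoatom.2 hn.out, fun α hα t => ?_⟩
  obtain ⟨t, rfl⟩ := Submodule.Quotient.mk_surjective _ t
  rw [← Submodule.Quotient.mk_smul, Submodule.Quotient.mk_eq_zero, smul_eq_mul, ← Algebra.smul_def]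
  exact hle ((hJmem _).2 (Submodule.smul_mem_smul hα Submodule.mem_top))

/-- A lattice in `D` that is locally generated by one element is projective. -/
theorem projective_of_local_generator [IsDomain A] [IsDedekindFiniteMonoid D] [Nontrivial D]
    (hO : IsMaximalFullOrder O) (L : Submodule O D) {s : A} (hs : s ≠ 0)
    (hsL : algebraMap A D s ∈ L) (hloc : ∀ P : Ideal A, P.IsMaximal →
      ∃ x ∈ L, ∃ b ∉ P, ∀ l ∈ L, b • l ∈ orderSpan O x) : Module.Projective O L := by
  let τ : (L →₀ O) →ₗ[O] L := Finsupp.linearCombination O id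
  -- The elements `b` for which multiplication by `b` on `L` factors through the free module on `L`.
  -- A local generator at `P` supplies such a `b` outside `P`, so `B` is the unit ideal, and `b = 1`
  -- gives a splitting.
  let B : Ideal A :=
    { carrier := {b | ∃ σ : L →ₗ[O] (L →₀ O), ∀ l : L, τ (σ l) = algebraMap A O b • l}
      add_mem' := by
        rintro b b' ⟨σ, hσ⟩ ⟨σ', hσ'⟩
        exact ⟨σ + σ', fun l => by rw [LinearMap.add_apply, map_add, hσ, hσ', map_add, add_smul]⟩
      zero_mem' := ⟨0, fun l => by simp⟩
      smul_mem' := by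
        rintro c b ⟨σ, hσ⟩
        let m : L →ₗ[O] L :=
          { toFun := fun l => algebraMap A O c • l
            map_add' := smul_add _
            map_smul' := fun o l => by
              rw [smul_smul, Algebra.commutes, ← smul_smul, RingHom.id_apply] }
        refine ⟨σ.comp m, fun l => ?_⟩
        rw [LinearMap.comp_apply, hσ]
        change algebraMap A O b • algebraMap A O c • l = _
        rw [smul_smul, ← map_mul, mul_comm, smul_eq_mul] }
  have hB : B = ⊤ := by
    by_contra hne
    obtain ⟨P, hP, hle⟩ := Ideal.exists_le_maximal _ hne
    obtain ⟨x, hxL, b, hbP, hb⟩ := hloc P hP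
    have hb0 : b ≠ 0 := fun h0 => hbP (h0 ▸ P.zero_mem)
    obtain ⟨u, hu⟩ := hO.isUnit_algebraMap (b * s) (mul_ne_zero hb0 hs)
    obtain ⟨o₁, ho₁, h₁⟩ := hb _ hsL
    have h₁ : o₁ * x = u := by
      rw [hu, map_mul, ← Algebra.smul_def]
      exact h₁
    have h2 : (↑u⁻¹ * o₁) * x = 1 := by rw [mul_assoc, h₁, Units.inv_mul]
    have h3 : x * (↑u⁻¹ * o₁) = 1 := mul_eq_one_symm h2
    refine hbP (hle ?_)
    -- The map `l ↦ b l x⁻¹`, which is integral because `bL ⊂ Ox`.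
    let f : L →ₗ[O] O :=
      { toFun := fun l => ⟨b • (l : D) * (↑u⁻¹ * o₁), by
          obtain ⟨o, ho, hol⟩ := hb l l.2
          have hol : o * x = b • (l : D) := hol
          rw [← hol, mul_assoc, h3, mul_one]
          exact ho⟩
        map_add' := fun l l' => Subtype.ext <| by
          change b • ((l : D) + l') * _ = b • (l : D) * _ + b • (l' : D) * _
          rw [smul_add, add_mul]
        map_smul' := fun o l => Subtype.ext <| by
          change b • ((o : D) * l) * _ = (o : D) * (b • (l : D) * _)
          rw [← mul_smul_comm, mul_assoc] }
    refine ⟨(Finsupp.lsingle ⟨x, hxL⟩).comp f, fun l => ?_⟩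
    change Finsupp.linearCombination O id (Finsupp.single _ (f l)) = _
    rw [Finsupp.linearCombination_single]
    refine Subtype.ext ?_
    change b • (l : D) * (↑u⁻¹ * o₁) * x = algebraMap A D b * l
    rw [mul_assoc, h2, mul_one, Algebra.smul_def]
  obtain ⟨σ, hσ⟩ := (hB ▸ Submodule.mem_top : (1 : A) ∈ B)
  exact ⟨σ, fun l => by
    have := hσ l
    rwa [map_one, one_smul] at this⟩

variable [IsDedekindDomain A] [Ring.HasFiniteQuotients A]

/-- A projective lattice in `D` over a maximal order is locally generated by one element. -/
theorem exists_local_generator [Module.IsTorsionFree A D] [IsDedekindFiniteMonoid D] [Nontrivial D]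
    (hO : IsMaximalFullOrder O)
    (hcenter : ∀ x ∈ O, (∀ y ∈ O, x * y = y * x) → ∃ α : A, x = algebraMap A D α)
    (L : Submodule O D) [Module.Finite O L] [Module.Projective O L] {s : A} (hs : s ≠ 0)
    (hsL : algebraMap A D s ∈ L) (P : Ideal A) [hP : P.IsMaximal] {a : A} (ha : a ≠ 0)
    (haP : a ∈ P) :
    ∃ x ∈ L, ∃ b ∉ P, ∀ l ∈ L, b • l ∈ orderSpan O x := by
  have := hO.finite
  have hP1 : ∀ r : A, r - 1 ∈ P → r ∉ P := fun r hr hr' => hP.ne_top <|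
      (Ideal.eq_top_iff_one P).2 <| by
    simpa using P.sub_mem hr' hr
  obtain ⟨n, hsimple, hT⟩ := exists_isSimpleModule_of_isMaximal (O := O) P
  obtain ⟨e, he⟩ := exists_annihilatorIn_pow_le hO hcenter P ha haP hT
  have hM : IsTwoSidedIdeal O (annihilatorIn (O := O) (O ⧸ n)) :=
    isTwoSidedIdeal_annihilatorIn ha (hT a haP)
  set M := annihilatorIn (O := O) (O ⧸ n) with hMdef
  set K := Module.annihilator O (O ⧸ n) with hK
  have hKM : ∀ k ∈ K, (k : D) ∈ M := fun k hk => ⟨k, hk, rfl⟩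
  have h1 : K ≤ Module.annihilator O (O ⧸ K) := fun k hk => Module.mem_annihilator.2 fun z => by
    obtain ⟨z, rfl⟩ := Submodule.Quotient.mk_surjective _ z
    rw [← Submodule.Quotient.mk_smul, Submodule.Quotient.mk_eq_zero]
    exact Ideal.mul_mem_right _ _ hk
  have h2 : K ≤ Module.annihilator O (L ⧸ (K • ⊤ : Submodule O L)) := fun k hk =>
    Module.mem_annihilator.2 fun z => by
      obtain ⟨z, rfl⟩ := Submodule.Quotient.mk_surjective _ z
      rw [← Submodule.Quotient.mk_smul, Submodule.Quotient.mk_eq_zero]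
      exact Submodule.smul_mem_smul hk Submodule.mem_top
  -- `O/M` and `L/ML` are both killed by `M`, so one of them surjects onto the other.
  rcases exists_surjective_or_surjective A (T := O ⧸ n) h1 h2 with ⟨f, hf⟩ | ⟨f, hf⟩
  · obtain ⟨x, hx⟩ := Submodule.Quotient.mk_surjective _ (f (Submodule.Quotient.mk 1))
    have hstep : L.restrictScalars A ≤ orderSpan O (x : D) ⊔ M * L.restrictScalars A := by
      intro l hl
      obtain ⟨z, hz⟩ := hf (Submodule.Quotient.mk ⟨l, hl⟩)
      obtain ⟨o, rfl⟩ := Submodule.Quotient.mk_surjective _ z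
      have h3 : (Submodule.Quotient.mk o : O ⧸ K) = o • Submodule.Quotient.mk 1 := by
        rw [← Submodule.Quotient.mk_smul, smul_eq_mul, mul_one]
      rw [h3, map_smul, ← hx, ← Submodule.Quotient.mk_smul, eq_comm, Submodule.Quotient.eq] at hz
      have h4 : ∀ w : L, w ∈ (K • ⊤ : Submodule O L) → (w : D) ∈ M * L.restrictScalars A := by
        intro w hw
        induction hw using Submodule.smul_induction_on' with
        | smul k hk w _ => exact Submodule.mul_mem_mul (hKM k hk) w.2
        | add w _ w' _ hw hw' => exact add_mem hw hw'
      rw [← add_sub_cancel ((o • x : L) : D) l]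
      exact Submodule.add_mem_sup ⟨o, o.2, rfl⟩ (h4 _ hz)
    -- The containment `L ⊂ Ox + ML` is iterated until the power of `M` lies in `PO`; only then does
    -- Nakayama's lemma over `A` apply.
    have hiter : ∀ k : ℕ,
        L.restrictScalars A ≤ orderSpan O (x : D) ⊔ M ^ (k + 1) * L.restrictScalars A := by
      intro k
      induction k with
      | zero => simpa using hstep
      | succ k ih =>
        refine ih.trans (sup_le le_sup_left ?_)
        refine (mul_le_mul_right hstep _).trans ?_
        rw [Submodule.mul_sup, ← mul_assoc, ← pow_succ]
        refine sup_le_sup_right (Submodule.mul_le.2 ?_) _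
        rintro m hm _ ⟨o, ho, rfl⟩
        exact ⟨m * o, O.mul_mem ((hM.pow_succ k).le m hm) ho, mul_assoc _ _ _⟩
    obtain ⟨r, hr, h⟩ := exists_mem_sub_one_smul_le L (x := x) (P := P) <|
      (hiter e).trans (sup_le_sup_left
        ((mul_le_mul_left he _).trans (ideal_smul_mul_le P L)) _)
    exact ⟨x, x.2, r, hP1 r hr, h⟩
  -- Projectivity lifts the surjection to `h : L → O`, which becomes surjective after localising at
  -- `P` by the same iteration. This is the only use of projectivity here.
  · obtain ⟨h, hh⟩ := Module.projective_lifting_property (Submodule.mkQ K)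
      (f.comp (Submodule.mkQ (K • ⊤ : Submodule O L))) (Submodule.mkQ_surjective _)
    let R : Submodule A D := ((LinearMap.range h).restrictScalars A).map O.val.toLinearMap
    have hR : ∀ l : L, (h l : D) ∈ R := fun l => ⟨h l, ⟨l, rfl⟩, rfl⟩
    have hstep : Subalgebra.toSubmodule O ≤ R ⊔ M := by
      intro o ho
      obtain ⟨z, hz⟩ := hf (Submodule.Quotient.mk ⟨o, ho⟩)
      obtain ⟨l, rfl⟩ := Submodule.Quotient.mk_surjective _ z
      have h3 : (Submodule.Quotient.mk (h l) : O ⧸ K) = f (Submodule.Quotient.mk l) :=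
        LinearMap.congr_fun hh l
      rw [← h3, eq_comm, Submodule.Quotient.eq] at hz
      rw [← add_sub_cancel ((h l : O) : D) o]
      exact Submodule.add_mem_sup (hR l) (hKM _ hz)
    have hiter : ∀ k : ℕ, Subalgebra.toSubmodule O ≤ R ⊔ M ^ (k + 1) := by
      intro k
      induction k with
      | zero => simpa using hstep
      | succ k ih =>
        refine ih.trans (sup_le le_sup_left ?_)
        rw [← (hM.pow_succ k).mul_order]
        refine (mul_le_mul_right hstep _).trans ?_
        rw [Submodule.mul_sup, ← pow_succ]
        refine sup_le_sup_right (Submodule.mul_le.2 ?_) _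
        rintro m hm _ ⟨_, ⟨l, rfl⟩, rfl⟩
        have h4 := hR ((⟨m, (hM.pow_succ k).le m hm⟩ : O) • l)
        rw [map_smul] at h4
        exact h4
    have hfg : (Subalgebra.toSubmodule O).FG := Module.Finite.iff_fg.1 hO.finite
    obtain ⟨b, hb, hle⟩ := Submodule.exists_sub_one_mem_and_smul_le_of_fg_of_le_sup hfg le_rfl
      ((hiter e).trans (sup_le_sup_left he _))
    have hbP := hP1 b hb
    have hb0 : b ≠ 0 := fun h0 => hbP (h0 ▸ P.zero_mem)
    obtain ⟨_, ⟨x, rfl⟩, hx⟩ := hle (Submodule.smul_mem_pointwise_smul (1 : D) b _ O.one_mem)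
    have hx : ((h x : O) : D) = b • (1 : D) := hx
    refine ⟨x, x.2, b, hbP, fun l hl => ?_⟩
    set c : D := ((h ⟨algebraMap A D s, hsL⟩ : O) : D) with hc
    have hcancel : ∀ {r : A} {y z : D}, r ≠ 0 → r • y = r • z → y = z := fun hr h =>
      Module.IsTorsionFree.isSMulRegular (IsRegular.of_ne_zero hr) h
    -- An `O`-linear map between lattices in `D` is a right multiplication, here by `c/s`. With
    -- `h(x) = b` this makes `x` inverse to `c` up to the central element `bs`, so that `b l = h(l)
    -- x`.
    have key : ∀ l : L, s • ((h l : O) : D) = (l : D) * c := by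
      intro l
      obtain ⟨r, hr, hrl⟩ := hO.exists_smul_mem (l : D)
      have h5 : (⟨r • (l : D), hrl⟩ : O) • (⟨algebraMap A D s, hsL⟩ : L) =
          algebraMap A O (r * s) • l := Subtype.ext <| by
        change r • (l : D) * algebraMap A D s = algebraMap A D (r * s) * l
        rw [← Algebra.commutes, ← Algebra.smul_def, ← Algebra.smul_def, smul_smul, mul_comm]
      have h6 := congrArg (fun z : L => ((h z : O) : D)) h5
      simp only [map_smul] at h6
      change r • (l : D) * c = algebraMap A D (r * s) * (h l : O) at h6
      refine hcancel hr ?_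
      rw [smul_smul, Algebra.smul_def, ← h6, smul_mul_assoc]
    obtain ⟨u, hu⟩ := hO.isUnit_algebraMap (b * s) (mul_ne_zero hb0 hs)
    have hucomm : ∀ y : D, (u : D) * y = y * u := fun y => by rw [hu]; exact Algebra.commutes _ _
    have hxc : (x : D) * c = u := by
      rw [← key x, hx, smul_smul, hu, Algebra.algebraMap_eq_smul_one, mul_comm]
    have hcx : c * x = u := by
      have h7 : (x : D) * (c * ↑u⁻¹) = 1 := by rw [← mul_assoc, hxc, Units.mul_inv]
      have h8 := mul_eq_one_symm h7
      calc c * x = c * (↑u⁻¹ * (u : D)) * x := by rw [Units.inv_mul, mul_one]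
        _ = c * ↑u⁻¹ * x * u := by rw [← mul_assoc, mul_assoc _ (u : D), hucomm, ← mul_assoc]
        _ = u := by rw [h8, one_mul]
    refine ⟨h ⟨l, hl⟩, (h ⟨l, hl⟩).2, hcancel hs ?_⟩
    change s • (((h ⟨l, hl⟩ : O) : D) * x) = s • b • l
    rw [← smul_mul_assoc, key, mul_assoc]
    change l * (c * x) = _
    rw [hcx, hu, ← Algebra.commutes, ← Algebra.smul_def, smul_smul, mul_comm]

/-- By the Chinese remainder theorem some `x ∈ L` is congruent, modulo `QL`, to a local generator at
each of the finitely many `Q` that contain `a`. By Nakayama's lemma it generates `L` at all of them.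
-/
theorem exists_generator_modulo [Module.Finite A O] (L : Submodule O D) [Module.Finite O L] {a : A}
    (ha : a ≠ 0) (hloc : ∀ P : Ideal A, P.IsMaximal → a ∈ P →
      ∃ x ∈ L, ∃ b ∉ P, ∀ l ∈ L, b • l ∈ orderSpan O x) :
    ∃ x ∈ L, ∃ b c d : A, b * c + a * d = 1 ∧ ∀ l ∈ L, b • l ∈ orderSpan O x := by
  classical
  have hfin : {P : Ideal A | P.IsMaximal ∧ a ∈ P}.Finite :=
    (Ring.HasFiniteQuotients.finite_setOfPred_mem a ha).subset fun P hP => hP.2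
  set S := hfin.toFinset with hS
  have hmem : ∀ P, P ∈ S ↔ P.IsMaximal ∧ a ∈ P := fun P => hfin.mem_toFinset
  choose! y hyL b hbP hb using fun P (hP : P ∈ S) => hloc P ((hmem P).1 hP).1 ((hmem P).1 hP).2
  have hcrt : ∀ P : Ideal A, ∃ r : A, ∀ Q ∈ S, r - (if Q = P then 1 else 0) ∈ Q := by
    intro P
    obtain ⟨r, hr⟩ := IsDedekindDomain.exists_forall_sub_mem_ideal (s := S) (fun Q : Ideal A => Q)
      (fun _ => 1) (fun Q hQ => by
        have := ((hmem Q).1 hQ).1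
        refine Ideal.prime_of_isPrime ?_ this.isPrime
        rintro rfl
        exact ha (by simpa using ((hmem _).1 hQ).2)) (fun _ _ _ _ h => h)
      (fun Q => if (Q : Ideal A) = P then 1 else 0)
    exact ⟨r, fun Q hQ => by simpa using hr Q hQ⟩
  choose r hr using hcrt
  let x : D := ∑ P ∈ S, r P • y P
  have hxL : x ∈ L := Submodule.sum_mem (L.restrictScalars A) fun P hP =>
    (L.restrictScalars A).smul_mem _ (hyL P hP)
  have hxy : ∀ Q ∈ S, y Q - x ∈ Q • L.restrictScalars A := by
    intro Q hQ
    have : x - y Q = ∑ P ∈ S, (r P - if Q = P then 1 else 0) • y P := by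
      simp only [sub_smul, Finset.sum_sub_distrib, ite_smul, one_smul, zero_smul,
        Finset.sum_ite_eq, hQ, if_true, x]
    rw [← neg_mem_iff, neg_sub, this]
    exact Submodule.sum_mem _ fun P hP => Submodule.smul_mem_smul (hr P Q hQ) (hyL P hP)
  let B : Ideal A :=
    { carrier := {b | ∀ l ∈ L, b • l ∈ orderSpan O x}
      add_mem' := fun {b b'} hb hb' l hl => by rw [add_smul]; exact add_mem (hb l hl) (hb' l hl)
      zero_mem' := fun l _ => by rw [zero_smul]; exact zero_mem _
      smul_mem' := fun c b hb l hl => by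
        rw [smul_eq_mul, mul_smul]; exact Submodule.smul_mem _ _ (hb l hl) }
  -- `B` is the conductor of `L` into `Ox`. For each `Q` containing `a` it has an element congruent
  -- to 1 modulo `Q`, so it is comaximal with `a`.
  have hB : B ⊔ Ideal.span {a} = ⊤ := by
    by_contra hne
    obtain ⟨Q, hQ, hle⟩ := Ideal.exists_le_maximal _ hne
    have haQ : a ∈ Q := hle (Ideal.mem_sup_right (Ideal.mem_span_singleton_self a))
    have hQS := (hmem Q).2 ⟨hQ, haQ⟩
    obtain ⟨β, π, hπ, hβ⟩ := hQ.exists_inv (hbP Q hQS)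
    obtain ⟨r, hr, h⟩ := exists_mem_sub_one_smul_le L (x := x) (P := Q) <| by
      intro l hl
      obtain ⟨o, ho, hol⟩ := hb Q hQS l hl
      have hol : o * y Q = b Q • l := hol
      have h1 : l = β • (o * x) + (β • (o * (y Q - x)) + π • l) := by
        rw [← add_assoc, ← smul_add, ← mul_add, add_sub_cancel, hol, smul_smul, ← add_smul, hβ,
          one_smul]
      rw [h1]
      refine Submodule.add_mem_sup (Submodule.smul_mem _ _ ⟨o, ho, rfl⟩)
        (add_mem (Submodule.smul_mem _ _ ?_) (Submodule.smul_mem_smul hπ hl))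
      have h2 := hxy Q hQS
      generalize y Q - x = w at h2
      induction h2 using Submodule.smul_induction_on' with
      | smul p hp s hs =>
        rw [mul_smul_comm]
        exact Submodule.smul_mem_smul hp (L.smul_mem ⟨o, ho⟩ hs)
      | add w _ w' _ hw hw' => rw [mul_add]; exact add_mem hw hw'
    have hrB : r ∈ B := h
    exact hQ.ne_top ((Ideal.eq_top_iff_one Q).2 (by
      simpa using Q.sub_mem (hle (Ideal.mem_sup_left hrB)) hr))
  obtain ⟨b', hb', z, hz, hbz⟩ := Submodule.mem_sup.1 (hB ▸ Submodule.mem_top : (1 : A) ∈ _)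
  obtain ⟨d, rfl⟩ := Ideal.mem_span_singleton'.1 hz
  exact ⟨x, hxL, b', 1, d, by rw [mul_one, mul_comm a, hbz], hb'⟩

end Lattices

end DLattice

/-! ### Lattices and their adelic spans -/

namespace DLattice

section HatSpan

variable {A D H E : Type*} [CommRing A] [Ring D] [Algebra A D] [CommRing H] [Ring E]

/-- The additive subgroup generated by the products of the elements of `L` and of `H`. -/
def hatSpan (ι : D →+* E) (η : H →+* E) (L : Set D) : AddSubgroup E :=
  AddSubgroup.closure {y | ∃ x ∈ L, ∃ α, y = ι x * η α}

variable {ι : D →+* E} {η : H →+* E} {O : Subalgebra A D}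

theorem map_mul_map_mem_hatSpan {L : Set D} {x : D} (hx : x ∈ L) (α : H) :
    ι x * η α ∈ hatSpan ι η L :=
  AddSubgroup.subset_closure ⟨x, hx, α, rfl⟩

theorem map_mem_hatSpan {L : Set D} {x : D} (hx : x ∈ L) : ι x ∈ hatSpan ι η L := by
  simpa using map_mul_map_mem_hatSpan (ι := ι) (η := η) hx 1

theorem one_mem_hatSpan : (1 : E) ∈ hatSpan ι η (O : Set D) := by
  simpa using map_mem_hatSpan (ι := ι) (η := η) (L := (O : Set D)) O.one_mem

theorem hatSpan_induction {L : Set D} {q : E → Prop} {y : E} (hy : y ∈ hatSpan ι η L)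
    (mem : ∀ x ∈ L, ∀ α, q (ι x * η α)) (zero : q 0) (add : ∀ y z, q y → q z → q (y + z))
    (neg : ∀ y, q y → q (-y)) : q y := by
  unfold hatSpan at hy
  induction hy using AddSubgroup.closure_induction with
  | mem y hy =>
    obtain ⟨x, hx, α, rfl⟩ := hy
    exact mem x hx α
  | zero => exact zero
  | add y z _ _ hy hz => exact add y z hy hz
  | neg y _ hy => exact neg y hy

theorem mul_mem_of_mem_hatSpan {G : AddSubgroup E} {L : Set D} {y : E} (hy : y ∈ hatSpan ι η L)
    (w : E) (hw : ∀ x ∈ L, ∀ α, w * (ι x * η α) ∈ G) : w * y ∈ G :=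
  hatSpan_induction (q := fun y => w * y ∈ G) hy hw (by simp)
    (fun y z hy hz => by rw [mul_add]; exact add_mem hy hz)
    (fun y hy => by rw [mul_neg]; exact neg_mem hy)

theorem mem_mul_of_mem_hatSpan {G : AddSubgroup E} {L : Set D} {y : E} (hy : y ∈ hatSpan ι η L)
    (w : E) (hw : ∀ x ∈ L, ∀ α, (ι x * η α) * w ∈ G) : y * w ∈ G :=
  hatSpan_induction (q := fun y => y * w ∈ G) hy hw (by simp)
    (fun y z hy hz => by rw [add_mul]; exact add_mem hy hz)
    (fun y hy => by rw [neg_mul]; exact neg_mem hy)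

theorem map_right_mem_hatSpan (α : H) : η α ∈ hatSpan ι η (O : Set D) := by
  simpa using map_mul_map_mem_hatSpan (ι := ι) (η := η) (L := (O : Set D)) O.one_mem α

variable [Algebra A H]

/-- The properties of `D → D ⊗ 𝔸` and `Â → D ⊗ 𝔸` that are needed to compare lattices in `D`
with their adelic spans. -/
structure IsAdelicExtension {A D H E : Type*} [CommRing A] [Ring D] [Algebra A D] [CommRing H]
    [Algebra A H] [Ring E] (O : Subalgebra A D) (ι : D →+* E) (η : H →+* E) : Prop where
  comm : ∀ α y, η α * y = y * η α
  map_algebraMap : ∀ a : A, η (algebraMap A H a) = ι (algebraMap A D a)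
  exists_mul_mem : ∀ y, ∃ a : A, a ≠ 0 ∧ ι (algebraMap A D a) * y ∈ hatSpan ι η (O : Set D)
  mem_of_mem : ∀ x, ι x ∈ hatSpan ι η (O : Set D) → x ∈ O
  approx : ∀ a : A, a ≠ 0 → ∀ α : H, ∃ (α₀ : A) (β : H),
    α = algebraMap A H α₀ + algebraMap A H a * β
  idempotent : ∀ a : A, a ≠ 0 → ∃ e : H, e * e = e ∧
    (∀ b : A, (∃ c d : A, b * c + a * d = 1) → ∃ u, algebraMap A H b * u * e = e) ∧
    ∃ u, algebraMap A H a * u * (1 - e) = 1 - e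

namespace IsAdelicExtension

variable (h : IsAdelicExtension O ι η)
include h

theorem mul_mem_hatSpan (L : Submodule O D) {w y : E} (hw : w ∈ hatSpan ι η (O : Set D))
    (hy : y ∈ hatSpan ι η (L : Set D)) : w * y ∈ hatSpan ι η (L : Set D) := by
  refine mem_mul_of_mem_hatSpan hw _ fun o ho α => ?_
  refine mul_mem_of_mem_hatSpan hy _ fun x hx β => ?_
  have : ι o * η α * (ι x * η β) = ι (o * x) * η (α * β) := by
    rw [map_mul, map_mul, mul_assoc, ← mul_assoc (η α), h.comm α (ι x)]
    simp only [mul_assoc]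
  rw [this]
  exact map_mul_map_mem_hatSpan (L.smul_mem ⟨o, ho⟩ hx) _

theorem mul_mem_hatSpan_self {w y : E} (hw : w ∈ hatSpan ι η (O : Set D))
    (hy : y ∈ hatSpan ι η (O : Set D)) : w * y ∈ hatSpan ι η (O : Set D) := by
  refine mem_mul_of_mem_hatSpan hw _ fun o ho α => ?_
  refine mul_mem_of_mem_hatSpan hy _ fun x hx β => ?_
  have : ι o * η α * (ι x * η β) = ι (o * x) * η (α * β) := by
    rw [map_mul, map_mul, mul_assoc, ← mul_assoc (η α), h.comm α (ι x)]
    simp only [mul_assoc]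
  rw [this]
  exact map_mul_map_mem_hatSpan (O.mul_mem ho hx) _

/-- Modulo any non-zero element of `A`, the adelic span of `L` is `L`. -/
theorem exists_eq_add (L : Submodule A D) {a : A} (ha : a ≠ 0) {y : E}
    (hy : y ∈ hatSpan ι η (L : Set D)) :
    ∃ l ∈ L, ∃ y' ∈ hatSpan ι η (L : Set D), y = ι l + ι (algebraMap A D a) * y' := by
  refine hatSpan_induction
    (q := fun y => ∃ l ∈ L, ∃ y' ∈ hatSpan ι η (L : Set D), y = ι l + ι (algebraMap A D a) * y')
    hy (fun x hx α => ?_) ⟨0, L.zero_mem, 0, zero_mem _, by simp⟩ ?_ ?_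
  · obtain ⟨α₀, β, rfl⟩ := h.approx a ha α
    refine ⟨α₀ • x, L.smul_mem α₀ hx, ι x * η β, map_mul_map_mem_hatSpan hx β, ?_⟩
    rw [map_add, map_mul, h.map_algebraMap, mul_add, Algebra.smul_def, Algebra.commutes, map_mul,
      ← h.map_algebraMap a, ← mul_assoc, ← mul_assoc, h.comm]
  · rintro _ _ ⟨l, hl, y, hy, rfl⟩ ⟨m, hm, z, hz, rfl⟩
    exact ⟨l + m, L.add_mem hl hm, y + z, add_mem hy hz, by rw [map_add, mul_add]; abel⟩
  · rintro _ ⟨l, hl, y, hy, rfl⟩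
    exact ⟨-l, L.neg_mem hl, -y, neg_mem hy, by rw [map_neg, mul_neg]; abel⟩

theorem map_algebraMap_mul (a : A) (y : E) :
    ι (algebraMap A D a) * y = y * ι (algebraMap A D a) := by
  rw [← h.map_algebraMap, h.comm]

/-- A lattice is the intersection of its adelic span with `D`. -/
theorem mem_of_map_mem (hO : IsMaximalFullOrder O) (L : Submodule O D) {a b : A} (ha : a ≠ 0)
    (haL : ∀ o ∈ O, a • o ∈ L) (hb : b ≠ 0) (hbL : ∀ l ∈ L, b • l ∈ O) [NoZeroDivisors A] {x : D}
    (hx : ι x ∈ hatSpan ι η (L : Set D)) : x ∈ L := by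
  -- The modulus `ab` is chosen so that `x - l` lies in `abÂL ⊂ a(O ⊗ Â)`. Then `(x - l)/a` is in
  -- `O`, and `aO ⊂ L`.
  obtain ⟨l, hl, y, hy, hxy⟩ := h.exists_eq_add (L.restrictScalars A) (mul_ne_zero ha hb) hx
  have hby : ι (algebraMap A D b) * y ∈ hatSpan ι η (O : Set D) := by
    refine mul_mem_of_mem_hatSpan hy _ fun z hz α => ?_
    rw [← mul_assoc, ← map_mul, ← Algebra.smul_def]
    exact map_mul_map_mem_hatSpan (hbL z hz) α
  obtain ⟨u, hu⟩ := hO.isUnit_algebraMap a ha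
  have h1 : ι (↑u⁻¹ * (x - l)) = ι (algebraMap A D b) * y := by
    rw [map_mul, map_sub, hxy, add_sub_cancel_left, map_mul, map_mul, ← hu, ← mul_assoc,
      ← mul_assoc, ← map_mul, Units.inv_mul, map_one, one_mul]
  have h2 := haL _ (h.mem_of_mem _ (h1 ▸ hby))
  rw [Algebra.smul_def, ← hu, ← mul_assoc, Units.mul_inv, one_mul] at h2
  rw [← sub_add_cancel x l]
  exact L.add_mem h2 hl

omit h in
/-- The lattice in `D` defined by an adelic point. -/
theorem exists_lattice (h : IsAdelicExtension O ι η) (g : Eˣ) : ∃ L : Submodule O D,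
    ∀ x, x ∈ L ↔ ι x * g ∈ hatSpan ι η (O : Set D) :=
  ⟨{ carrier := {x | ι x * g ∈ hatSpan ι η (O : Set D)}
     add_mem' := fun {x y} hx hy => by
       have := add_mem (Set.mem_ofPred.1 hx) (Set.mem_ofPred.1 hy)
       rw [Set.mem_ofPred, map_add, add_mul]
       exact this
     zero_mem' := by
       rw [Set.mem_ofPred, map_zero, zero_mul]
       exact zero_mem _
     smul_mem' := fun o x hx => by
       have := h.mul_mem_hatSpan_self (map_mem_hatSpan o.2) (Set.mem_ofPred.1 hx)
       rw [Set.mem_ofPred, ← mul_assoc, ← map_mul] at *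
       exact this }, fun _ => Iff.rfl⟩

variable (g : Eˣ) (L : Submodule O D) (hL : ∀ x, x ∈ L ↔ ι x * g ∈ hatSpan ι η (O : Set D))
include hL

theorem exists_smul_mem_lattice : ∃ a : A, a ≠ 0 ∧ ∀ o ∈ O, a • o ∈ L := by
  obtain ⟨a, ha, hag⟩ := h.exists_mul_mem (g : E)
  refine ⟨a, ha, fun o ho => (hL _).2 ?_⟩
  rw [Algebra.smul_def, Algebra.commutes, map_mul, mul_assoc]
  exact h.mul_mem_hatSpan_self (map_mem_hatSpan ho) hag

theorem exists_smul_lattice_mem : ∃ b : A, b ≠ 0 ∧ ∀ l ∈ L, b • l ∈ O := by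
  obtain ⟨b, hb, hbg⟩ := h.exists_mul_mem (↑g⁻¹ : E)
  refine ⟨b, hb, fun l hl => h.mem_of_mem _ ?_⟩
  have h1 : ι (b • l) = (ι l * g) * (ι (algebraMap A D b) * ↑g⁻¹) := by
    rw [h.map_algebraMap_mul, mul_assoc, ← mul_assoc (g : E), Units.mul_inv, one_mul,
      ← map_mul, Algebra.smul_def, Algebra.commutes]
  rw [h1]
  exact h.mul_mem_hatSpan_self ((hL l).1 hl) hbg

/-- For the converse, `by` is integral for some `b`. Approximating it by `o ∈ O` modulo `ba` gives
`y = o/b + av` with `v` integral. Here `av ∈ ÂL` because `aO ⊂ L`, and `o/b ∈ L` because `(o/b)g =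
yg - v(ag)` is integral. -/
theorem mem_hatSpan_lattice_iff (hO : IsMaximalFullOrder O) [NoZeroDivisors A] (y : E) :
    y ∈ hatSpan ι η (L : Set D) ↔ y * g ∈ hatSpan ι η (O : Set D) := by
  constructor
  · intro hy
    refine mem_mul_of_mem_hatSpan hy _ fun x hx α => ?_
    rw [mul_assoc, h.comm, ← mul_assoc]
    exact h.mul_mem_hatSpan_self ((hL x).1 hx) (map_right_mem_hatSpan α)
  · intro hy
    obtain ⟨a, ha, hag⟩ := h.exists_mul_mem (g : E)
    obtain ⟨b, hb, hby⟩ := h.exists_mul_mem y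
    obtain ⟨u, hu⟩ := hO.isUnit_algebraMap b hb
    obtain ⟨o, ho, v, hv, hov⟩ := h.exists_eq_add (Subalgebra.toSubmodule O) (mul_ne_zero hb ha) hby
    have h1 : y = ι (↑u⁻¹ * o) + ι (algebraMap A D a) * v := by
      calc y = ι ↑u⁻¹ * (ι (algebraMap A D b) * y) := by
            rw [← hu, ← mul_assoc, ← map_mul, Units.inv_mul, map_one, one_mul]
        _ = _ := by
            rw [hov, mul_add, ← map_mul, ← mul_assoc, ← map_mul, map_mul (algebraMap A D), ← hu,
              ← mul_assoc, Units.inv_mul, one_mul]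
    have h2 : ι (algebraMap A D a) * v ∈ hatSpan ι η (L : Set D) := by
      refine mul_mem_of_mem_hatSpan hv _ fun z hz α => ?_
      rw [← mul_assoc, ← map_mul, ← Algebra.smul_def]
      refine map_mul_map_mem_hatSpan ((hL _).2 ?_) α
      rw [Algebra.smul_def, Algebra.commutes, map_mul, mul_assoc]
      exact h.mul_mem_hatSpan_self (map_mem_hatSpan hz) hag
    rw [h1]
    refine add_mem (map_mem_hatSpan ((hL _).2 ?_)) h2
    have h3 : ι (↑u⁻¹ * o) * g = y * g - v * (ι (algebraMap A D a) * g) := by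
      rw [h1, add_mul, ← mul_assoc v, ← h.map_algebraMap_mul, add_sub_cancel_right]
    rw [h3]
    exact sub_mem hy (h.mul_mem_hatSpan_self hv hag)

theorem finite_lattice (hO : IsMaximalFullOrder O) [IsDomain A] [IsNoetherianRing A]
    [Module.IsTorsionFree A D] : Module.Finite O L := by
  obtain ⟨b, hb, hbL⟩ := h.exists_smul_lattice_mem g L hL
  have := hO.finite
  let f : L →ₗ[O] O :=
    { toFun := fun x => ⟨b • (x : D), hbL x x.2⟩
      map_add' := fun x y => Subtype.ext (smul_add b (x : D) y)
      map_smul' := fun c x => Subtype.ext (mul_smul_comm b (c : D) (x : D)).symm }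
  have hf : Function.Injective f := fun x y hxy => Subtype.ext
    (Module.IsTorsionFree.isSMulRegular (IsRegular.of_ne_zero hb) (congrArg Subtype.val hxy))
  have : IsNoetherianRing O := isNoetherian_of_tower A inferInstance
  have := isNoetherian_of_injective f hf
  infer_instance

/-- The element `g⁻¹` lies in `ÂL`. An `x ∈ L` congruent to it modulo some non-zero `a ∈ P`
generates `L` modulo `P`, hence locally at `P`. -/
theorem projective_lattice (hO : IsMaximalFullOrder O) [IsDomain A] [IsNoetherianRing A]
    [Module.IsTorsionFree A D] [IsDedekindFiniteMonoid D] [Nontrivial D] (hA : ¬ IsField A) :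
    Module.Projective O L := by
  have := hO.finite
  have := h.finite_lattice g L hL hO
  obtain ⟨s, hs, hsL⟩ := h.exists_smul_mem_lattice g L hL
  have hspan := h.mem_hatSpan_lattice_iff g L hL hO
  refine projective_of_local_generator hO L hs
    (by simpa [Algebra.algebraMap_eq_smul_one] using hsL 1 O.one_mem) fun P hP => ?_
  obtain ⟨a, haP, ha⟩ := Submodule.exists_mem_ne_zero_of_ne_bot
    (Ring.ne_bot_of_isMaximal_of_not_isField hP hA)
  obtain ⟨u, hu⟩ := hO.isUnit_algebraMap a ha
  obtain ⟨x, hx, y, hy, hxy⟩ := h.exists_eq_add (L.restrictScalars A) ha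
    ((hspan ↑g⁻¹).2 (by rw [Units.inv_mul]; exact one_mem_hatSpan))
  obtain ⟨r, hr, hrL⟩ := exists_mem_sub_one_smul_le L (x := x) (P := P) <| by
    intro l hl
    obtain ⟨o, ho, w, hw, how⟩ := h.exists_eq_add (Subalgebra.toSubmodule O) ha ((hL l).1 hl)
    have h1 : ι (l - o * x) = ι (algebraMap A D a) * (ι o * y + w * ↑g⁻¹) := by
      have h2 : ι l = (ι o + ι (algebraMap A D a) * w) * ↑g⁻¹ := by
        rw [← how, mul_assoc, Units.mul_inv, mul_one]
      have h3 : ι o * ↑g⁻¹ = ι (o * x) + ι (algebraMap A D a) * (ι o * y) := by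
        rw [hxy, mul_add, map_mul, ← mul_assoc, ← mul_assoc, h.map_algebraMap_mul]
      rw [map_sub, h2, add_mul, h3, mul_add, mul_assoc]
      abel
    have h4 : ↑u⁻¹ * (l - o * x) ∈ L := by
      refine (hL _).2 ((hspan _).1 ?_)
      rw [map_mul, h1, ← mul_assoc, ← map_mul, ← hu, Units.inv_mul, map_one, one_mul]
      refine add_mem (h.mul_mem_hatSpan L (map_mem_hatSpan ho) hy) ((hspan _).2 ?_)
      rw [mul_assoc, Units.inv_mul, mul_one]
      exact hw
    have h5 : l = o * x + a • (↑u⁻¹ * (l - o * x)) := by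
      rw [Algebra.smul_def, ← hu, ← mul_assoc, Units.mul_inv, one_mul, add_sub_cancel]
    rw [h5]
    exact Submodule.add_mem_sup ⟨o, ho, rfl⟩ (Submodule.smul_mem_smul haP h4)
  refine ⟨x, hx, r, fun hrP => hP.ne_top ((Ideal.eq_top_iff_one P).2 ?_), hrL⟩
  simpa using P.sub_mem hrP hr

omit hL in
theorem add_mul_add_of_idempotent {e : H} (he : e * e = e) (x y x' y' : D) :
    (ι x * η e + ι y * η (1 - e)) * (ι x' * η e + ι y' * η (1 - e)) =
      ι (x * x') * η e + ι (y * y') * η (1 - e) := by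
  have key : ∀ (x x' : D) (α β : H), ι x * η α * (ι x' * η β) = ι (x * x') * η (α * β) := by
    intro x x' α β
    rw [map_mul, map_mul, mul_assoc, ← mul_assoc (η α), h.comm α (ι x')]
    simp only [mul_assoc]
  have h1 : e * (1 - e) = 0 := by rw [mul_sub, mul_one, he, sub_self]
  have h2 : (1 - e) * e = 0 := by rw [sub_mul, one_mul, he, sub_self]
  have h3 : (1 - e) * (1 - e) = 1 - e := by rw [mul_sub, mul_one, h2, sub_zero]
  simp only [add_mul, mul_add, key, he, h1, h2, h3, map_zero, mul_zero, add_zero, zero_add]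

omit hL in
/-- The adelic span of a projective lattice is generated by one adelic point. -/
theorem exists_unit_of_projective (hO : IsMaximalFullOrder O)
    (hcenter : ∀ x ∈ O, (∀ y ∈ O, x * y = y * x) → ∃ α : A, x = algebraMap A D α)
    [IsDedekindDomain A] [Ring.HasFiniteQuotients A] [Module.IsTorsionFree A D]
    [IsDedekindFiniteMonoid D] [Nontrivial D] (hA : ¬ IsField A)
    [Module.Finite O L] [Module.Projective O L] {s r : A} (hs : s ≠ 0)
    (hsL : algebraMap A D s ∈ L) (hr : r ≠ 0) (hrL : ∀ l ∈ L, r • l ∈ O) :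
    ∃ g : Eˣ, ∀ y, y ∈ hatSpan ι η (L : Set D) ↔ y * g ∈ hatSpan ι η (O : Set D) := by
  have := hO.finite
  -- The non-unit `t` enters the modulus only to ensure `b ≠ 0` below: `b = 0` would make `t` a
  -- unit.
  obtain ⟨t, ht, htu⟩ : ∃ t : A, t ≠ 0 ∧ ¬ IsUnit t := by
    by_contra! hall
    exact hA ⟨exists_pair_ne A, mul_comm, fun {a} ha => (hall a ha).exists_right_inv⟩
  have ha : t * r * s ≠ 0 := mul_ne_zero (mul_ne_zero ht hr) hs
  obtain ⟨x, hx, b, c, d, hbc, hbL⟩ := exists_generator_modulo L ha fun P hP haP =>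
    exists_local_generator hO hcenter L hs hsL P ha haP
  obtain ⟨e, he, heb, u, hu⟩ := h.idempotent _ ha
  obtain ⟨v, hv⟩ := heb b ⟨c, d, hbc⟩
  have hb : b ≠ 0 := by
    rintro rfl
    refine htu (IsUnit.of_mul_eq_one (r * s * d) ?_)
    rw [← hbc]
    ring
  obtain ⟨S, hS⟩ := hO.isUnit_algebraMap s hs
  obtain ⟨X, rfl⟩ : IsUnit x := by
    obtain ⟨w, hw⟩ := hO.isUnit_algebraMap (b * s) (mul_ne_zero hb hs)
    obtain ⟨o, ho, hox⟩ := hbL _ hsL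
    have hox : o * x = w := by
      rw [hw, map_mul, ← Algebra.smul_def]
      exact hox
    have h2 : (↑w⁻¹ * o) * x = 1 := by rw [mul_assoc, hox, Units.inv_mul]
    exact ⟨⟨x, _, mul_eq_one_symm h2, h2⟩, rfl⟩
  -- `g⁻¹` equals the generator `x` at the places dividing `a = trs`, and `s` at all others, where
  -- `r` and `s` are units and `L` agrees with `O`.
  let g : Eˣ :=
    { val := ι ↑X⁻¹ * η e + ι ↑S⁻¹ * η (1 - e)
      inv := ι ↑X * η e + ι ↑S * η (1 - e)
      val_inv := by
        rw [h.add_mul_add_of_idempotent he, Units.inv_mul, Units.inv_mul, ← mul_add, ← map_add,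
          add_sub_cancel, map_one, map_one, one_mul]
      inv_val := by
        rw [h.add_mul_add_of_idempotent he, Units.mul_inv, Units.mul_inv, ← mul_add, ← map_add,
          add_sub_cancel, map_one, map_one, one_mul] }
  have hginv : (↑g⁻¹ : E) ∈ hatSpan ι η (L : Set D) := by
    refine add_mem (map_mul_map_mem_hatSpan hx _) (map_mul_map_mem_hatSpan ?_ _)
    rw [hS]
    exact hsL
  refine ⟨g, fun y => ⟨fun hy => mem_mul_of_mem_hatSpan hy _ fun l hl α => ?_, fun hy => ?_⟩⟩
  · rw [mul_assoc, h.comm, ← mul_assoc]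
    refine h.mul_mem_hatSpan_self ?_ (map_right_mem_hatSpan α)
    -- On the support of `e` one divides by `b`, and elsewhere by `trs`; the numerators `blx⁻¹` and
    -- `trl` are in `O`.
    have h1 : ι l * (g : E) = ι (b • l * ↑X⁻¹) * η (v * e) +
        ι ((t * r * s) • l * ↑S⁻¹) * η (u * (1 - e)) := by
      change ι l * (ι ↑X⁻¹ * η e + ι ↑S⁻¹ * η (1 - e)) = _
      have h2 : ∀ (k : A) (z : D) (β γ : H), algebraMap A H k * β * γ = γ →
          ι l * (ι z * η γ) = ι (k • l * z) * η (β * γ) := by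
        intro k z β γ hk
        rw [smul_mul_assoc, Algebra.smul_def, Algebra.commutes, map_mul ι, map_mul ι,
          ← h.map_algebraMap, mul_assoc, mul_assoc, ← map_mul η, ← mul_assoc (algebraMap A H k), hk]
      rw [mul_add, h2 b _ v e hv, h2 _ _ u _ hu]
    rw [h1]
    refine add_mem (map_mul_map_mem_hatSpan ?_ _) (map_mul_map_mem_hatSpan ?_ _)
    · obtain ⟨o, ho, hol⟩ := hbL l hl
      have hol : o * ↑X = b • l := hol
      rw [← hol, mul_assoc, Units.mul_inv, mul_one]
      exact ho
    · rw [mul_comm _ s, mul_smul, smul_mul_assoc, Algebra.smul_def, ← hS,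
        show (S : D) * ((t * r) • l * ↑S⁻¹) = (t * r) • l * (↑S * ↑S⁻¹) by
          rw [← mul_assoc, hS, Algebra.commutes, mul_assoc], Units.mul_inv, mul_one, mul_smul]
      exact O.smul_mem (hrL l hl) t
  · have h1 : y = y * g * ↑g⁻¹ := by rw [mul_assoc, Units.mul_inv, mul_one]
    rw [h1]
    exact h.mul_mem_hatSpan L hy hginv

end IsAdelicExtension

end HatSpan

end DLattice

/-! ### Maximal orders and the adelic algebra -/

namespace DLattice

section Concrete

variable {Fq F : Type*} [Field Fq] [Field F] [Algebra Fq F] {p : Place Fq F}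
variable {D : Type*} [Ring D] [Algebra F D]

instance : Module.IsTorsionFree p.regularRing D where
  isSMulRegular {a} ha x y hxy := by
    have h0 : (a : F) ≠ 0 := fun h => ha.ne_zero (Subtype.ext h)
    exact smul_right_injective D h0 hxy

theorem isMaximalFullOrder [Finite Fq] (hF : IsCurveFunctionField Fq F)
    {O : Subalgebra p.regularRing D} (hO : IsMaximalOrder p O) : IsMaximalFullOrder O where
  finite := hO.prop.finite
  exists_smul_mem x := by
    have := Place.isFractionRing hF p
    have hx : x ∈ Submodule.span F (O : Set D) := hO.prop.span_eq_top ▸ Submodule.mem_top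
    induction hx using Submodule.span_induction with
    | mem x hx => exact ⟨1, one_ne_zero, by rw [one_smul]; exact hx⟩
    | zero => exact ⟨1, one_ne_zero, by rw [smul_zero]; exact O.zero_mem⟩
    | add x y _ _ hx hy =>
      obtain ⟨a, ha, hx⟩ := hx
      obtain ⟨b, hb, hy⟩ := hy
      refine ⟨a * b, mul_ne_zero ha hb, ?_⟩
      rw [smul_add]
      exact O.add_mem (by rw [mul_comm, mul_smul]; exact O.smul_mem hx b)
        (by rw [mul_smul]; exact O.smul_mem hy a)
    | smul f x _ hx =>
      obtain ⟨a, ha, hx⟩ := hx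
      obtain ⟨n, d, hd, rfl⟩ := IsFractionRing.div_surjective (A := p.regularRing) f
      refine ⟨d * a, mul_ne_zero (nonZeroDivisors.ne_zero hd) ha, ?_⟩
      have hd0 : algebraMap p.regularRing F d ≠ 0 := by
        simpa using nonZeroDivisors.ne_zero hd
      have : (d * a) • (algebraMap p.regularRing F n / algebraMap p.regularRing F d) • x =
          n • a • x := by
        rw [← algebraMap_smul F (d * a), ← algebraMap_smul F n, ← algebraMap_smul F a, smul_smul,
          smul_smul, map_mul]
        congr 1
        field_simp
      rw [this]
      exact O.smul_mem hx n
  isUnit_algebraMap a ha := by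
    rw [IsScalarTower.algebraMap_apply p.regularRing F D]
    exact (IsUnit.mk0 _ (fun h => ha (Subtype.ext h))).map _
  le_of_le O' hle hfin := hO.le_of_ge (y := O') ⟨hfin, top_le_iff.1 <| by
    rw [← hO.prop.span_eq_top]
    exact Submodule.span_mono hle⟩ hle

/-- Since `O` spans `D`, such an `x` is in the centre `F`; it is integral over `A`, which is
integrally closed. -/
theorem exists_algebraMap_of_commute [Finite Fq] [Algebra.IsCentral F D] [Nontrivial D]
    (hF : IsCurveFunctionField Fq F)
    {O : Subalgebra p.regularRing D} (hO : IsMaximalOrder p O) :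
    ∀ x ∈ O, (∀ y ∈ O, x * y = y * x) → ∃ α : p.regularRing, x = algebraMap p.regularRing D α := by
  intro x hx hcomm
  have := Place.isFractionRing hF p
  have := Place.isDedekindDomain hF p
  have := hO.prop.finite
  have h1 : x ∈ Subalgebra.center F D := by
    rw [Subalgebra.mem_center_iff]
    intro y
    have hy : y ∈ Submodule.span F (O : Set D) := hO.prop.span_eq_top ▸ Submodule.mem_top
    induction hy using Submodule.span_induction with
    | mem y hy => exact (hcomm y hy).symm
    | zero => simp
    | add y z _ _ hy hz => rw [add_mul, mul_add, hy, hz]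
    | smul f y _ hy => rw [smul_mul_assoc, mul_smul_comm, hy]
  obtain ⟨f, rfl⟩ := Algebra.mem_bot.1 (Algebra.IsCentral.out h1)
  have h2 : IsIntegral p.regularRing (algebraMap F D f) :=
    (IsIntegral.of_finite p.regularRing (⟨_, hx⟩ : O)).map O.val
  have h3 : IsIntegral p.regularRing f :=
    (isIntegral_algHom_iff (IsScalarTower.toAlgHom p.regularRing F D)
      (algebraMap F D).injective).1 h2
  obtain ⟨α, hα⟩ := IsIntegrallyClosed.isIntegral_iff.1 h3
  exact ⟨α, by rw [← hα, ← IsScalarTower.algebraMap_apply]⟩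

end Concrete

section Tensor

variable {A F D H : Type*} [CommRing A] [Field F] [Algebra A F] [Ring D] [Algebra F D]
  [CommRing H] [Algebra A H]

variable (A F D H) in
/-- The inclusion of `D` in `D ⊗ (F ⊗ H)`. -/
def tensorLeft : D →+* D ⊗[F] (F ⊗[A] H) := Algebra.TensorProduct.includeLeftRingHom

variable (A F D H) in
/-- The inclusion of `H` in `D ⊗ (F ⊗ H)`. -/
def tensorRight : H →+* D ⊗[F] (F ⊗[A] H) :=
  (Algebra.TensorProduct.includeRight : F ⊗[A] H →ₐ[F] D ⊗[F] (F ⊗[A] H)).toRingHom.comp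
    (Algebra.TensorProduct.includeRight : H →ₐ[A] F ⊗[A] H).toRingHom

theorem tensorLeft_mul_tensorRight (x : D) (α : H) :
    tensorLeft A F D H x * tensorRight A F D H α = x ⊗ₜ[F] ((1 : F) ⊗ₜ[A] α) := by
  change (x ⊗ₜ[F] (1 : F ⊗[A] H)) * ((1 : D) ⊗ₜ[F] ((1 : F) ⊗ₜ[A] α)) = _
  rw [Algebra.TensorProduct.tmul_mul_tmul, mul_one, one_mul]

theorem tensorRight_comm (α : H) (y : D ⊗[F] (F ⊗[A] H)) :
    tensorRight A F D H α * y = y * tensorRight A F D H α := by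
  change ((1 : D) ⊗ₜ[F] ((1 : F) ⊗ₜ[A] α)) * y = y * ((1 : D) ⊗ₜ[F] ((1 : F) ⊗ₜ[A] α))
  induction y using TensorProduct.induction_on with
  | zero => rw [mul_zero, zero_mul]
  | add y z hy hz => rw [mul_add, add_mul, hy, hz]
  | tmul x y =>
    rw [Algebra.TensorProduct.tmul_mul_tmul, Algebra.TensorProduct.tmul_mul_tmul, one_mul, mul_one,
      mul_comm]

variable [Algebra A D] [IsScalarTower A F D]

theorem tensorRight_algebraMap (a : A) :
    tensorRight A F D H (algebraMap A H a) = tensorLeft A F D H (algebraMap A D a) := by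
  change (1 : D) ⊗ₜ[F] ((1 : F) ⊗ₜ[A] algebraMap A H a) = (algebraMap A D a) ⊗ₜ[F] (1 : F ⊗[A] H)
  have h1 : (1 : F) ⊗ₜ[A] algebraMap A H a = algebraMap A F a • (1 : F ⊗[A] H) := by
    rw [Algebra.TensorProduct.one_def, TensorProduct.smul_tmul', smul_eq_mul, mul_one,
      Algebra.algebraMap_eq_smul_one a, Algebra.algebraMap_eq_smul_one a, TensorProduct.smul_tmul]
  rw [h1, ← TensorProduct.smul_tmul, IsScalarTower.algebraMap_apply A F D,
    ← Algebra.algebraMap_eq_smul_one]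

variable {O : Subalgebra A D}

theorem mem_hatSpan_iff_exists_map (f : O ⊗[A] H →ₐ[A] D ⊗[F] (F ⊗[A] H))
    (hf : ∀ (x : O) (α : H), f (x ⊗ₜ α) = (x : D) ⊗ₜ[F] ((1 : F) ⊗ₜ[A] α))
    (y : D ⊗[F] (F ⊗[A] H)) :
    y ∈ hatSpan (tensorLeft A F D H) (tensorRight A F D H) (O : Set D) ↔ ∃ u, y = f u := by
  constructor
  · intro hy
    refine hatSpan_induction (q := fun y => ∃ u, y = f u) hy ?_ ⟨0, (map_zero f).symm⟩ ?_ ?_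
    · intro x hx α
      exact ⟨⟨x, hx⟩ ⊗ₜ α, by rw [hf, tensorLeft_mul_tensorRight]⟩
    · rintro _ _ ⟨u, rfl⟩ ⟨v, rfl⟩
      exact ⟨u + v, (map_add f _ _).symm⟩
    · rintro _ ⟨u, rfl⟩
      exact ⟨-u, (map_neg f _).symm⟩
  · rintro ⟨u, rfl⟩
    induction u using TensorProduct.induction_on with
    | zero => rw [map_zero]; exact zero_mem _
    | add u v hu hv => rw [map_add]; exact add_mem hu hv
    | tmul x α =>
      rw [hf, ← tensorLeft_mul_tensorRight]
      exact map_mul_map_mem_hatSpan x.2 α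

/-- Under `D ⊗ (F ⊗ H) ≅ D ⊗ H` the map `f` is the inclusion of `O` in `D` tensored with the flat
module `H`. -/
theorem injective_of_apply_tmul [Module.Flat A H] (f : O ⊗[A] H →ₐ[A] D ⊗[F] (F ⊗[A] H))
    (hf : ∀ (x : O) (α : H), f (x ⊗ₜ α) = (x : D) ⊗ₜ[F] ((1 : F) ⊗ₜ[A] α)) :
    Function.Injective f := by
  let e := (TensorProduct.AlgebraTensorModule.cancelBaseChange A F F D H).symm
  have h1 : Function.Injective (LinearMap.rTensor H O.val.toLinearMap) :=
    Module.Flat.rTensor_preserves_injective_linearMap _ Subtype.val_injective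
  have h2 : ∀ u, f u = e (LinearMap.rTensor H O.val.toLinearMap u) := by
    intro u
    induction u using TensorProduct.induction_on with
    | zero => rw [map_zero, map_zero, map_zero]
    | add u v hu hv => rw [map_add, hu, hv, map_add, map_add]
    | tmul x α => rw [hf]; rfl
  intro u v huv
  rw [h2, h2] at huv
  exact h1 (e.injective huv)

theorem exists_algebraMap_mul_mem_hatSpan [IsDomain A] [IsFractionRing A F]
    (hO : IsMaximalFullOrder O) (y : D ⊗[F] (F ⊗[A] H)) : ∃ a : A, a ≠ 0 ∧
      tensorLeft A F D H (algebraMap A D a) * y ∈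
        hatSpan (tensorLeft A F D H) (tensorRight A F D H) (O : Set D) := by
  have hadd : ∀ y z : D ⊗[F] (F ⊗[A] H),
      (∃ a : A, a ≠ 0 ∧ tensorLeft A F D H (algebraMap A D a) * y ∈
        hatSpan (tensorLeft A F D H) (tensorRight A F D H) (O : Set D)) →
      (∃ a : A, a ≠ 0 ∧ tensorLeft A F D H (algebraMap A D a) * z ∈
        hatSpan (tensorLeft A F D H) (tensorRight A F D H) (O : Set D)) →
      ∃ a : A, a ≠ 0 ∧ tensorLeft A F D H (algebraMap A D a) * (y + z) ∈
        hatSpan (tensorLeft A F D H) (tensorRight A F D H) (O : Set D) := by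
    rintro y z ⟨a, ha, hy⟩ ⟨b, hb, hz⟩
    have hmul : ∀ (c : A) (w : D ⊗[F] (F ⊗[A] H)),
        w ∈ hatSpan (tensorLeft A F D H) (tensorRight A F D H) (O : Set D) →
        tensorLeft A F D H (algebraMap A D c) * w ∈
          hatSpan (tensorLeft A F D H) (tensorRight A F D H) (O : Set D) := fun c w hw =>
      mul_mem_of_mem_hatSpan hw _ fun x hx α => by
        rw [← mul_assoc, ← map_mul]
        exact map_mul_map_mem_hatSpan (O.mul_mem (O.algebraMap_mem c) hx) α
    refine ⟨a * b, mul_ne_zero ha hb, ?_⟩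
    rw [mul_add]
    refine add_mem ?_ ?_
    · rw [mul_comm a, map_mul, map_mul, mul_assoc]
      exact hmul b _ hy
    · rw [map_mul, map_mul, mul_assoc]
      exact hmul a _ hz
  induction y using TensorProduct.induction_on with
  | zero => exact ⟨1, one_ne_zero, by rw [mul_zero]; exact zero_mem _⟩
  | add y z hy hz => exact hadd y z hy hz
  | tmul x y =>
    induction y using TensorProduct.induction_on with
    | zero => exact ⟨1, one_ne_zero, by rw [TensorProduct.tmul_zero, mul_zero]; exact zero_mem _⟩
    | add y z hy hz => rw [TensorProduct.tmul_add]; exact hadd _ _ hy hz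
    | tmul f α =>
      obtain ⟨a, ha, hax⟩ := hO.exists_smul_mem (f • x)
      refine ⟨a, ha, ?_⟩
      have : tensorLeft A F D H (algebraMap A D a) * x ⊗ₜ[F] (f ⊗ₜ[A] α) =
          tensorLeft A F D H (a • f • x) * tensorRight A F D H α := by
        rw [tensorLeft_mul_tensorRight]
        change (algebraMap A D a) ⊗ₜ[F] (1 : F ⊗[A] H) * x ⊗ₜ[F] (f ⊗ₜ[A] α) = _
        rw [Algebra.TensorProduct.tmul_mul_tmul, one_mul, ← Algebra.smul_def, smul_comm a f,
          TensorProduct.smul_tmul f, TensorProduct.smul_tmul', smul_eq_mul, mul_one]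
      rw [this]
      exact map_mul_map_mem_hatSpan hax α

theorem exists_mul_coord_eq_algebraMap [IsDomain A] [IsFractionRing A F] [Module.Finite A O]
    {κ : Type*} [Finite κ] (b : Module.Basis κ F D) : ∃ c : A, c ≠ 0 ∧
      ∀ i (o : O), ∃ a : A, algebraMap A F c * b.coord i o = algebraMap A F a := by
  obtain ⟨k, y, hy⟩ := Module.Finite.exists_fin (R := A) (M := O)
  obtain ⟨c, hc⟩ := IsLocalization.exist_integer_multiples_of_finite (nonZeroDivisors A)
    fun ij : κ × Fin k => b.coord ij.1 (y ij.2)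
  refine ⟨c, nonZeroDivisors.ne_zero c.2, fun i o => ?_⟩
  have ho : o ∈ Submodule.span A (Set.range y) := hy ▸ Submodule.mem_top
  induction ho using Submodule.span_induction with
  | mem o ho =>
    obtain ⟨j, rfl⟩ := ho
    obtain ⟨a, ha⟩ := hc (i, j)
    exact ⟨a, by rw [ha, Algebra.smul_def]⟩
  | zero => exact ⟨0, by simp⟩
  | add o o' _ _ ho ho' =>
    obtain ⟨a, ha⟩ := ho
    obtain ⟨a', ha'⟩ := ho'
    exact ⟨a + a', by rw [Subalgebra.coe_add, map_add, mul_add, ha, ha', map_add]⟩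
  | smul r o _ ho =>
    obtain ⟨a, ha⟩ := ho
    refine ⟨r * a, ?_⟩
    rw [Subalgebra.coe_smul, ← algebraMap_smul F r (o : D), map_smul, smul_eq_mul, mul_left_comm,
      ha, map_mul]

/-- The intersection `O'` of `D` with the image of `O ⊗ H` is a ring that contains `O`. In a basis
of `D` the coordinates of its elements have a common denominator `c`, because `F ∩ H = A`. So some
non-zero multiple of `O'` lies in `O`, and maximality concludes. -/
theorem mem_of_tensorLeft_mem_range [IsDomain A] [IsNoetherianRing A] [IsFractionRing A F]
    [Module.IsTorsionFree A D] [FiniteDimensional F D] (hO : IsMaximalFullOrder O)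
    (f : O ⊗[A] H →ₐ[A] D ⊗[F] (F ⊗[A] H))
    (hf : ∀ (x : O) (α : H), f (x ⊗ₜ α) = (x : D) ⊗ₜ[F] ((1 : F) ⊗ₜ[A] α))
    (hFH : ∀ (x : F) (α : H), x ⊗ₜ[A] (1 : H) = 1 ⊗ₜ α → ∃ a : A, x = algebraMap A F a) (x : D)
    (hx : ∃ u, tensorLeft A F D H x = f u) : x ∈ O := by
  have := hO.finite
  let b := Module.finBasis F D
  obtain ⟨c, hc0, hcO⟩ := exists_mul_coord_eq_algebraMap (A := A) (O := O) b
  choose d hd hdO using fun i => hO.exists_smul_mem (b i)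
  have hd' : ∀ i, (∏ j, d j) • b i ∈ O := fun i => by
    obtain ⟨e, he⟩ := Finset.dvd_prod_of_mem d (Finset.mem_univ i)
    rw [he, mul_comm, mul_smul]
    exact O.smul_mem (hdO i) e
  let Λ (i : Fin (Module.finrank F D)) : D ⊗[F] (F ⊗[A] H) →ₗ[F] F ⊗[A] H :=
    (TensorProduct.lid F (F ⊗[A] H)).toLinearMap.comp (LinearMap.rTensor _ (b.coord i))
  have hΛ : ∀ i (z : D) w, Λ i (z ⊗ₜ w) = b.coord i z • w := fun i z w => by
    simp only [Λ, LinearMap.comp_apply, LinearMap.rTensor_tmul, LinearEquiv.coe_coe,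
      TensorProduct.lid_tmul]
  have hΛf : ∀ i u, ∃ α : H, algebraMap A F c • Λ i (f u) = (1 : F) ⊗ₜ[A] α := by
    intro i u
    induction u using TensorProduct.induction_on with
    | zero => exact ⟨0, by rw [map_zero, map_zero, smul_zero, TensorProduct.tmul_zero]⟩
    | add u v hu hv =>
      obtain ⟨α, hα⟩ := hu
      obtain ⟨β, hβ⟩ := hv
      exact ⟨α + β, by rw [map_add, map_add, smul_add, hα, hβ, TensorProduct.tmul_add]⟩
    | tmul o α =>
      obtain ⟨a, ha⟩ := hcO i o
      refine ⟨a • α, ?_⟩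
      rw [hf, hΛ, smul_smul, ha, TensorProduct.smul_tmul', smul_eq_mul, mul_one,
        Algebra.algebraMap_eq_smul_one, TensorProduct.smul_tmul]
  let O' : Subalgebra A D :=
    f.range.comap (Algebra.TensorProduct.includeLeft : D →ₐ[A] D ⊗[F] (F ⊗[A] H))
  refine hO.mem_of_smul_mem (O' := O') (a := (∏ j, d j) * c) (fun o ho => ?_)
    (IsRegular.of_ne_zero (mul_ne_zero (Finset.prod_ne_zero_iff.2 fun i _ => hd i) hc0))
    ?_ (x := x) ?_
  · exact ⟨(⟨o, ho⟩ : O) ⊗ₜ (1 : H), hf _ _⟩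
  · rintro z ⟨u, hu⟩
    have hu : f u = z ⊗ₜ[F] (1 : F ⊗[A] H) := hu
    have hint : ∀ i, ∃ a : A, algebraMap A F c * b.coord i z = algebraMap A F a := by
      intro i
      obtain ⟨α, hα⟩ := hΛf i u
      refine hFH _ α ?_
      rw [← hα, hu, hΛ, smul_smul, Algebra.TensorProduct.one_def, TensorProduct.smul_tmul',
        smul_eq_mul, mul_one]
    choose a ha using hint
    have hz : ((∏ j, d j) * c) • z = ∑ i, a i • (∏ j, d j) • b i := by
      conv_lhs => rw [← b.sum_repr z]
      rw [Finset.smul_sum]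
      refine Finset.sum_congr rfl fun i _ => ?_
      have h1 : c • b.repr z i • b i = a i • b i := by
        rw [← algebraMap_smul F c, smul_smul]
        have h2 : algebraMap A F c * b.repr z i = algebraMap A F (a i) := ha i
        rw [h2, algebraMap_smul]
      rw [mul_smul, h1, smul_comm]
    rw [hz]
    exact O.sum_mem fun i _ => O.smul_mem (hd' i) _
  · obtain ⟨u, hu⟩ := hx
    exact ⟨u, hu.symm⟩

theorem isAdelicExtension [IsDomain A] [IsNoetherianRing A] [IsFractionRing A F]
    [Module.IsTorsionFree A D] [FiniteDimensional F D] (hO : IsMaximalFullOrder O)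
    (f : O ⊗[A] H →ₐ[A] D ⊗[F] (F ⊗[A] H))
    (hf : ∀ (x : O) (α : H), f (x ⊗ₜ α) = (x : D) ⊗ₜ[F] ((1 : F) ⊗ₜ[A] α))
    (hFH : ∀ (x : F) (α : H), x ⊗ₜ[A] (1 : H) = 1 ⊗ₜ α → ∃ a : A, x = algebraMap A F a)
    (happrox : ∀ a : A, a ≠ 0 → ∀ α : H, ∃ (α₀ : A) (β : H),
      α = algebraMap A H α₀ + algebraMap A H a * β)
    (hidem : ∀ a : A, a ≠ 0 → ∃ e : H, e * e = e ∧
      (∀ b : A, (∃ c d : A, b * c + a * d = 1) → ∃ u, algebraMap A H b * u * e = e) ∧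
      ∃ u, algebraMap A H a * u * (1 - e) = 1 - e) :
    IsAdelicExtension O (tensorLeft A F D H) (tensorRight A F D H) where
  comm := tensorRight_comm
  map_algebraMap := tensorRight_algebraMap
  exists_mul_mem := exists_algebraMap_mul_mem_hatSpan hO
  mem_of_mem x hx :=
    mem_of_tensorLeft_mem_range hO f hf hFH x ((mem_hatSpan_iff_exists_map f hf _).1 hx)
  approx := happrox
  idempotent := hidem

end Tensor

section Adelic

variable {Fq F : Type*} [Field Fq] [Field F] [Algebra Fq F] {p : Place Fq F}
variable {D : Type*} [Ring D] [Algebra F D]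

variable (p D) in
/-- The inclusion of `D` in `D ⊗ 𝔸`. -/
def adelicLeft : D →+* AdelicAlgebra p D := tensorLeft p.regularRing F D p.HatRing

variable (p D) in
/-- The inclusion of `Â` in `D ⊗ 𝔸`. -/
def adelicRight : p.HatRing →+* AdelicAlgebra p D := tensorRight p.regularRing F D p.HatRing

theorem adelicSpan_eq_hatSpan (L : Set D) :
    adelicSpan p L = hatSpan (adelicLeft p D) (adelicRight p D) L := by
  have h : ∀ (x : D) (α : p.HatRing), adelicLeft p D x * adelicRight p D α =
      x ⊗ₜ[F] ((1 : F) ⊗ₜ[p.regularRing] α) :=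
    fun x α => tensorLeft_mul_tensorRight (A := p.regularRing) (F := F) x α
  unfold adelicSpan hatSpan
  congr 1
  ext y
  simp only [h]

theorem isAdelicExtension_adelic [Finite Fq] [FiniteDimensional F D]
    (hF : IsCurveFunctionField Fq F) {O : Subalgebra p.regularRing D} (hO : IsMaximalOrder p O) :
    IsAdelicExtension (H := p.HatRing) (E := AdelicAlgebra p D) O (adelicLeft p D)
      (adelicRight p D) := by
  have := Place.isFractionRing hF p
  have := Place.isDedekindDomain hF p
  exact isAdelicExtension (isMaximalFullOrder hF hO) (hatOrderMap p O) (hatOrderMap_tmul p O)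
    (fun x α h => ⟨⟨x, Place.mem_regularRing_of_tmul_eq h⟩, rfl⟩)
    (fun a ha α => Place.hatRing_approx hF ha α) (fun a ha => Place.exists_idempotent_hatRing ha)

theorem mem_hatSpan_iff_exists_hatOrderMap (O : Subalgebra p.regularRing D)
    (y : AdelicAlgebra p D) :
    y ∈ hatSpan (adelicLeft p D) (adelicRight p D) (O : Set D) ↔ ∃ u, y = hatOrderMap p O u :=
  mem_hatSpan_iff_exists_map (hatOrderMap p O) (hatOrderMap_tmul p O) y

theorem hatOrderMap_injective [Finite Fq] (hF : IsCurveFunctionField Fq F)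
    (O : Subalgebra p.regularRing D) : Function.Injective (hatOrderMap p O) := by
  have := Place.isDedekindDomain hF p
  exact injective_of_apply_tmul (hatOrderMap p O) (hatOrderMap_tmul p O)

end Adelic

end DLattice

/-! ### Topology of the completion at infinity -/

namespace DLattice

open Filter Topology

namespace Place

variable {Fq F : Type*} [Field Fq] [Field F] [Algebra Fq F]

instance (v : Place Fq F) : CompleteSpace v.Completion :=
  inferInstanceAs (CompleteSpace v.toValuationSubring.valuation.Completion)

instance (v : Place Fq F) : T0Space v.Completion :=
  inferInstanceAs (T0Space v.toValuationSubring.valuation.Completion)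

theorem exists_val_eq (v : Place Fq F) (γ : v.toValuationSubring.ValueGroup) :
    ∃ y : F, v.val y = γ :=
  v.toValuationSubring.valuation_surjective γ

theorem exists_ball_subset {v : Place Fq F} {s : Set v.Completion} (hs : s ∈ 𝓝 0) :
    ∃ a : F, a ≠ 0 ∧ {x | Valued.v x ≤ v.val a} ⊆ s := by
  obtain ⟨γ, hγ⟩ := Valued.mem_nhds_zero.1 hs
  obtain ⟨x, hx⟩ := v.exists_val_eq (MonoidWithZeroHom.ValueGroup₀.embedding γ.1)
  obtain ⟨t, ht0, ht⟩ := v.exists_ne_zero_val_lt_one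
  have hx0 : x ≠ 0 := by
    rintro rfl
    rw [map_zero, eq_comm, map_eq_zero] at hx
    exact γ.ne_zero hx
  refine ⟨t * x, mul_ne_zero ht0 hx0, fun y hy => hγ ?_⟩
  rw [Set.mem_ofPred_eq, Valuation.restrict_lt_iff_lt_embedding, ← hx]
  refine lt_of_le_of_lt hy ?_
  rw [map_mul]
  have : 0 < v.val x := by simpa [zero_lt_iff] using hx0
  calc v.val t * v.val x < 1 * v.val x := by gcongr
    _ = v.val x := one_mul _

theorem isClosed_ball (v : Place Fq F) (a : F) :
    IsClosed {x : v.Completion | Valued.v x ≤ v.val a} := by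
  have := Valued.isClosed_closedBall v.Completion (Valued.v.restrict (v.toCompletion a))
  simpa only [Valuation.restrict_le_iff, valued_toCompletion] using this

/-- The ball is closed in a complete space, and finiteness of residues makes it totally bounded. -/
theorem isCompact_ball [Finite Fq] (hF : IsCurveFunctionField Fq F) (v : Place Fq F) {b : F}
    (hb : b ≠ 0) : IsCompact {x : v.Completion | Valued.v x ≤ v.val b} := by
  refine TotallyBounded.isCompact_of_isClosed ?_ (v.isClosed_ball b)
  rw [totallyBounded_iff_subset_finite_iUnion_nhds_zero]
  intro U hU
  obtain ⟨a, ha, haU⟩ := exists_ball_subset hU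
  obtain ⟨T, hT, h⟩ := v.exists_finite_residues hF ha hb
  refine ⟨v.toCompletion '' T, hT.image _, fun x hx => ?_⟩
  have hmin : ∃ c : F, c ≠ 0 ∧ v.val c ≤ v.val a ∧ v.val c ≤ v.val b := by
    rcases le_total (v.val a) (v.val b) with hab | hab
    · exact ⟨a, ha, le_rfl, hab⟩
    · exact ⟨b, hb, hab, le_rfl⟩
  obtain ⟨c, hc, hca, hcb⟩ := hmin
  obtain ⟨y, hy⟩ := v.exists_valued_sub_le x hc
  have hyb : v.val y ≤ v.val b := by
    rw [← valued_toCompletion, ← sub_sub_self x (v.toCompletion y)]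
    exact valued_sub_le hx (hy.trans hcb)
  obtain ⟨τ, hτ, -, hyτ⟩ := h y hyb
  refine Set.mem_biUnion (Set.mem_image_of_mem _ hτ) ?_
  refine ⟨x - v.toCompletion τ, haU ?_, by simp⟩
  have : x - v.toCompletion τ = (x - v.toCompletion y) - v.toCompletion (τ - y) := by
    rw [map_sub]; ring
  rw [Set.mem_ofPred_eq, this]
  refine valued_sub_le (hy.trans hca) ?_
  rw [valued_toCompletion, Valuation.map_sub_swap]
  exact hyτ

theorem exists_regularRing_approx_completion [Finite Fq] (hF : IsCurveFunctionField Fq F)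
    (p : Place Fq F) :
    ∃ c : F, c ≠ 0 ∧ ∀ x : p.Completion, ∃ a : p.regularRing,
      Valued.v (x - p.toCompletion a) ≤ p.val c := by
  obtain ⟨c, hc, h⟩ := p.exists_regularRing_approx hF
  refine ⟨c, hc, fun x => ?_⟩
  obtain ⟨y, hy⟩ := p.exists_valued_sub_le x hc
  obtain ⟨a, ha, hya⟩ := h y
  refine ⟨⟨a, ha⟩, ?_⟩
  have : x - p.toCompletion a = (x - p.toCompletion y) - p.toCompletion (a - y) := by
    rw [map_sub]; ring
  change Valued.v (x - p.toCompletion a) ≤ _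
  rw [this]
  refine valued_sub_le hy ?_
  rw [valued_toCompletion, Valuation.map_sub_swap]
  exact hya

section Norm

variable {p : Place Fq F} {C : Type*} [NontriviallyNormedField C] [Algebra p.Completion C]

/-- Only continuity relates the norm of `C` to the valuation. The powers of `x` stay in a compact
ball, so their norms are bounded, which forces `‖x‖ ≤ 1`. -/
theorem norm_algebraMap_le_one [Finite Fq] (hF : IsCurveFunctionField Fq F)
    (hC : Continuous (algebraMap p.Completion C)) {x : p.Completion} (hx : Valued.v x ≤ 1) :
    ‖algebraMap p.Completion C x‖ ≤ 1 := by
  have hcomp := p.isCompact_ball hF (one_ne_zero (α := F))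
  obtain ⟨B, hB⟩ := (hcomp.image (hC.norm)).bddAbove
  by_contra! h
  obtain ⟨n, hn⟩ := pow_unbounded_of_one_lt B h
  refine absurd (hB ⟨x ^ n, ?_, rfl⟩) (not_le.2 (by simpa using hn))
  rw [Set.mem_ofPred_eq, map_pow, map_one]
  exact pow_le_one₀ (zero_le) hx

theorem norm_algebraMap_le [Finite Fq] (hF : IsCurveFunctionField Fq F)
    (hC : Continuous (algebraMap p.Completion C)) {x y : p.Completion}
    (hxy : Valued.v x ≤ Valued.v y) :
    ‖algebraMap p.Completion C x‖ ≤ ‖algebraMap p.Completion C y‖ := by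
  by_cases hy : y = 0
  · rw [hy, map_zero, le_zero_iff, map_eq_zero] at hxy
    rw [hxy, hy]
  · have h1 := norm_algebraMap_le_one hF hC (x := x / y) (by
      rw [map_div₀]
      exact div_le_one_of_le₀ hxy zero_le)
    rwa [map_div₀, norm_div, div_le_one (by simpa using hy)] at h1

theorem one_le_norm_of_mem_regularRing [Finite Fq] (hF : IsCurveFunctionField Fq F)
    (hC : Continuous (algebraMap p.Completion C)) {a : F} (ha : a ∈ p.regularRing)
    (ha0 : a ≠ 0) : 1 ≤ ‖algebraMap p.Completion C (p.toCompletion a)‖ := by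
  have h1 : 1 ≤ p.val a := not_lt.1 fun h => ha0 (eq_zero_of_mem_regularRing hF ha h)
  have := norm_algebraMap_le hF hC (x := 1) (y := p.toCompletion a) (by
    rw [map_one, valued_toCompletion]; exact h1)
  simpa using this

/-- The linear form does not vanish on the compact set of integral vectors with some coordinate
equal to 1, so it has a positive minimum `ε` there. Dividing a vector by its largest coordinate
brings it into this set. -/
theorem exists_mul_norm_le [Finite Fq] (hF : IsCurveFunctionField Fq F)
    (hC : Continuous (algebraMap p.Completion C)) {d : ℕ} {z : Fin d → C}
    (hz : ∀ c : Fin d → p.Completion, c ≠ 0 → ∑ i, algebraMap p.Completion C (c i) * z i ≠ 0) :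
    ∃ ε : ℝ, 0 < ε ∧ ∀ (c : Fin d → p.Completion) (j : Fin d),
      ε * ‖algebraMap p.Completion C (c j)‖ ≤ ‖∑ i, algebraMap p.Completion C (c i) * z i‖ := by
  rcases isEmpty_or_nonempty (Fin d) with hd | hd
  · exact ⟨1, one_pos, fun c j => isEmptyElim j⟩
  have hcomp := p.isCompact_ball hF (one_ne_zero (α := F))
  let f : (Fin d → p.Completion) → ℝ := fun c => ‖∑ i, algebraMap p.Completion C (c i) * z i‖
  have hf : Continuous f := by
    refine (continuous_finsetSum _ fun i _ => ?_).norm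
    exact (hC.comp (continuous_apply i)).mul continuous_const
  let S : Set (Fin d → p.Completion) :=
    ⋃ j : Fin d, Set.pi Set.univ
      (fun _ : Fin d => {x : p.Completion | Valued.v x ≤ p.val (1 : F)}) ∩
      {c | c j = 1}
  have hS : IsCompact S := isCompact_iUnion fun j =>
    (isCompact_univ_pi fun _ => hcomp).inter_right
      (isClosed_eq (continuous_apply j) continuous_const)
  have hSne : S.Nonempty := ⟨1, Set.mem_iUnion.2 ⟨Classical.arbitrary _, fun i _ => by
    rw [Set.mem_ofPred_eq, Pi.one_apply, map_one, map_one], rfl⟩⟩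
  obtain ⟨c₀, hc₀, hmin⟩ := hS.exists_isMinOn hSne hf.continuousOn
  have hc₀0 : c₀ ≠ 0 := by
    rintro rfl
    obtain ⟨j, -, hj⟩ := Set.mem_iUnion.1 hc₀
    exact zero_ne_one hj
  refine ⟨f c₀, norm_pos_iff.2 (hz c₀ hc₀0), fun c j => ?_⟩
  obtain ⟨m, hm⟩ := Finite.exists_max fun i => Valued.v (c i)
  by_cases hcm : c m = 0
  · have : c j = 0 := by
      have := hm j
      simpa only [hcm, map_zero, le_zero_iff, map_eq_zero] using this
    rw [this, map_zero, norm_zero, mul_zero]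
    exact norm_nonneg _
  have h1 : f c = f (fun i => c i / c m) * ‖algebraMap p.Completion C (c m)‖ := by
    simp only [f]
    rw [← norm_mul, Finset.sum_mul]
    congr 1
    refine Finset.sum_congr rfl fun i _ => ?_
    have : algebraMap p.Completion C (c m) ≠ 0 := by simpa using hcm
    rw [map_div₀]
    field_simp
  have h2 : f c₀ ≤ f fun i => c i / c m := by
    refine hmin (Set.mem_iUnion.2 ⟨m, fun i _ => ?_, div_self hcm⟩)
    rw [Set.mem_ofPred_eq, map_one, map_div₀]
    exact div_le_one_of_le₀ (hm i) zero_le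
  change _ ≤ f c
  rw [h1]
  exact mul_le_mul h2 (norm_algebraMap_le hF hC (hm j)) (norm_nonneg _) (norm_nonneg _)

end Norm

end Place

end DLattice

/-! ### Discrete lattices and the Drinfeld space -/

namespace DLattice

section Discrete

variable {Fq F : Type*} [Field Fq] [Field F] [Algebra Fq F] {p : Place Fq F}
variable {C : Type*} [NontriviallyNormedField C] [Algebra p.Completion C]
variable {d : ℕ} {D : Type*} [Ring D] [Algebra F D]
variable (θ : p.Completion ⊗[F] D ≃ₐ[p.Completion] Matrix (Fin d) (Fin d) p.Completion)

theorem stdRep_apply (x : D) (i j : Fin d) :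
    stdRep C θ x i j = algebraMap p.Completion C (θ (1 ⊗ₜ x) i j) := rfl

theorem stdRep_smul (f : F) (x : D) :
    stdRep C θ (f • x) = algebraMap p.Completion C (p.toCompletion f) • stdRep C θ x := by
  ext i j
  have h : (1 : p.Completion) ⊗ₜ[F] (f • x) = p.toCompletion f • ((1 : p.Completion) ⊗ₜ[F] x) := by
    rw [TensorProduct.tmul_smul, TensorProduct.smul_tmul', TensorProduct.smul_tmul',
      Algebra.smul_def, smul_eq_mul]
    rfl
  rw [Matrix.smul_apply, stdRep_apply, stdRep_apply, h, map_smul, Matrix.smul_apply, smul_eq_mul,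
    map_mul, smul_eq_mul]

/-- The coordinates of a matrix in the basis given by a basis of `D`. -/
def matrixCoord {κ : Type*} (b : Module.Basis κ F D) (i : κ) :
    Matrix (Fin d) (Fin d) p.Completion →ₗ[p.Completion] p.Completion :=
  ((b.baseChange p.Completion).coord i).comp θ.symm.toLinearMap

theorem matrixCoord_apply {κ : Type*} (b : Module.Basis κ F D) (i : κ) (x : D) :
    matrixCoord θ b i (θ (1 ⊗ₜ x)) = p.toCompletion (b.coord i x) := by
  have h : matrixCoord θ b i (θ (1 ⊗ₜ x)) =
      (b.baseChange p.Completion).repr (θ.symm (θ (1 ⊗ₜ x))) i := rfl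
  rw [h, AlgEquiv.symm_apply_apply, Module.Basis.baseChange_repr_tmul, Algebra.smul_def, mul_one]
  rfl

theorem sum_matrixCoord_smul {κ : Type*} [Fintype κ] (b : Module.Basis κ F D)
    (m : Matrix (Fin d) (Fin d) p.Completion) :
    ∑ i, matrixCoord θ b i m • θ (1 ⊗ₜ b i) = m := by
  apply θ.symm.injective
  rw [map_sum]
  conv_rhs => rw [← (b.baseChange p.Completion).sum_repr (θ.symm m)]
  refine Finset.sum_congr rfl fun i _ => ?_
  rw [map_smul, AlgEquiv.symm_apply_apply, Module.Basis.baseChange_apply]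
  rfl

variable [Finite Fq]

/-- A lattice of full rank acts discretely on a point of the Drinfeld space. -/
theorem exists_pos_forall_norm_lt [FiniteDimensional F D] (hF : IsCurveFunctionField Fq F)
    (hC : Continuous (algebraMap p.Completion C)) {z : Fin d → C}
    (hz : ∀ c : Fin d → p.Completion, c ≠ 0 → ∑ i, algebraMap p.Completion C (c i) * z i ≠ 0)
    {O : Subalgebra p.regularRing D} [Module.Finite p.regularRing O] {L : Set D}
    {b : p.regularRing} (hb : b ≠ 0) (hbL : ∀ l ∈ L, b • l ∈ O) :
    ∃ δ : ℝ, 0 < δ ∧ ∀ l ∈ L, (∀ i, ‖(stdRep C θ l).mulVec z i‖ < δ) → l = 0 := by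
  have := Place.isFractionRing hF p
  have := Place.isDedekindDomain hF p
  let e := Module.finBasis F D
  obtain ⟨ε, hε, hεz⟩ := Place.exists_mul_norm_le hF hC hz
  obtain ⟨c, hc, hcO⟩ := exists_mul_coord_eq_algebraMap (O := O) e
  set k := algebraMap p.Completion C with hk
  let β : ℝ := ‖k (p.toCompletion ((c * b : p.regularRing) : F))‖
  let R : ℝ := ∑ i, β * ∑ s, ∑ t, ‖k (matrixCoord θ e i (Matrix.single s t 1))‖
  have hterm : ∀ i, 0 ≤ β * ∑ s, ∑ t, ‖k (matrixCoord θ e i (Matrix.single s t 1))‖ := fun i => by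
    positivity
  have hR : 0 ≤ R := Finset.sum_nonneg fun i _ => hterm i
  -- A vector below this bound forces the entries of the matrix of `l` to be at most `1/(R+1)`. The
  -- coordinates of `l`, multiplied by `cb`, are elements of `A` of norm at most `R/(R+1) < 1`,
  -- hence zero.
  refine ⟨ε / (R + 1), by positivity, fun l hl hsmall => ?_⟩
  set m := θ (1 ⊗ₜ l) with hm
  have hentry : ∀ s t, ‖k (m s t)‖ ≤ 1 / (R + 1) := by
    intro s t
    have h1 := (hεz (m s) t).trans (hsmall s).le
    rw [div_eq_mul_one_div ε] at h1
    exact le_of_mul_le_mul_left h1 hε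
  refine e.ext_elem fun i => ?_
  obtain ⟨a, ha⟩ := hcO i ⟨b • l, hbL l hl⟩
  have ha' : ((c * b : p.regularRing) : F) * e.coord i l = a := by
    have h1 : (b • l : D) = (b : F) • l := rfl
    have h2 : (c : F) * e.coord i (b • l) = a := ha
    rw [h1, map_smul, smul_eq_mul, ← mul_assoc] at h2
    exact h2
  have hcoord : k (matrixCoord θ e i m) =
      ∑ s, ∑ t, k (m s t) * k (matrixCoord θ e i (Matrix.single s t 1)) := by
    conv_lhs => rw [Matrix.matrix_eq_sum_single m]
    simp only [map_sum]
    refine Finset.sum_congr rfl fun s _ => Finset.sum_congr rfl fun t _ => ?_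
    rw [← map_mul, ← smul_eq_mul (m s t), ← map_smul, Matrix.smul_single, smul_eq_mul, mul_one]
  have hnorm : ‖k (p.toCompletion (a : F))‖ < 1 := by
    rw [← ha', map_mul, map_mul, norm_mul, ← matrixCoord_apply θ e i l, ← hm, hcoord]
    have h1 : ‖∑ s, ∑ t, k (m s t) * k (matrixCoord θ e i (Matrix.single s t 1))‖ ≤
        1 / (R + 1) * ∑ s, ∑ t, ‖k (matrixCoord θ e i (Matrix.single s t 1))‖ := by
      rw [Finset.mul_sum]
      refine norm_sum_le_of_le _ fun s _ => ?_
      rw [Finset.mul_sum]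
      refine norm_sum_le_of_le _ fun t _ => ?_
      rw [norm_mul]
      exact mul_le_mul_of_nonneg_right (hentry s t) (norm_nonneg _)
    have h2 : β * ∑ s, ∑ t, ‖k (matrixCoord θ e i (Matrix.single s t 1))‖ ≤ R :=
      Finset.single_le_sum (f := fun i => β * ∑ s, ∑ t,
        ‖k (matrixCoord θ e i (Matrix.single s t 1))‖) (fun i _ => hterm i) (Finset.mem_univ i)
    calc _ ≤ β * (1 / (R + 1) * ∑ s, ∑ t, ‖k (matrixCoord θ e i (Matrix.single s t 1))‖) :=
          mul_le_mul_of_nonneg_left h1 (norm_nonneg _)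
      _ = (β * ∑ s, ∑ t, ‖k (matrixCoord θ e i (Matrix.single s t 1))‖) / (R + 1) := by ring
      _ ≤ R / (R + 1) := by gcongr
      _ < 1 := by rw [div_lt_one (by positivity)]; linarith
  have ha0 : (a : F) = 0 := by
    by_contra h0
    exact absurd (Place.one_le_norm_of_mem_regularRing hF hC a.2 h0) (not_le.2 hnorm)
  rw [ha0, mul_eq_zero] at ha'
  have hcb : ((c * b : p.regularRing) : F) ≠ 0 := fun h =>
    mul_ne_zero hc hb (Subtype.ext h)
  simpa using ha'.resolve_left hcb

/-- A point on which a lattice of full rank acts discretely lies in the Drinfeld space. -/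
theorem sum_ne_zero_of_discreteTopology (hF : IsCurveFunctionField Fq F)
    (hC : Continuous (algebraMap p.Completion C)) {z : Fin d → C}
    {κ : Type*} [Finite κ] (e : Module.Basis κ F D) (L : Submodule p.regularRing D)
    (heL : ∀ i, e i ∈ L) (hinj : ∀ x : D, (stdRep C θ x).mulVec z = 0 → x = 0)
    (G : AddSubgroup (Fin d → C)) [DiscreteTopology G]
    (hG : ∀ l ∈ L, (stdRep C θ l).mulVec z ∈ G) (c : Fin d → p.Completion) (hc : c ≠ 0) :
    ∑ i, algebraMap p.Completion C (c i) * z i ≠ 0 := by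
  intro h0
  cases nonempty_fintype κ
  set k := algebraMap p.Completion C with hk
  -- All rows of `m` equal the relation `c`, so `m` kills `z`. Its coordinates `x` in the basis `e`
  -- give a relation over `F_∞` between the vectors `eᵢz`.
  let m : Matrix (Fin d) (Fin d) p.Completion := Matrix.of fun _ j => c j
  obtain ⟨j₀, hj₀⟩ := Function.ne_iff.1 hc
  let x : κ → p.Completion := fun i => matrixCoord θ e i m
  have hxm : ∑ i, x i • θ (1 ⊗ₜ e i) = m := sum_matrixCoord_smul θ e m
  obtain ⟨i₀, hi₀⟩ : ∃ i, x i ≠ 0 := by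
    by_contra! h
    apply hj₀
    have : m j₀ j₀ = 0 := by rw [← hxm]; simp [h]
    exact this
  let w : κ → Fin d → C := fun i => (stdRep C θ (e i)).mulVec z
  have hw : ∑ i, k (x i) • w i = 0 := by
    have h1 : ∀ s, ∑ i, k (x i) * w i s = 0 := by
      intro s
      rw [← h0]
      have h2 : ∀ t, k (c t) = ∑ i, k (x i) * stdRep C θ (e i) s t := by
        intro t
        have h3 : c t = ∑ i, x i * θ (1 ⊗ₜ e i) s t := by
          have : m s t = c t := rfl
          rw [← this, ← hxm, Matrix.sum_apply]
          rfl
        rw [h3, map_sum]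
        simp only [map_mul, stdRep_apply, hk]
      simp only [h2, w, Matrix.mulVec, dotProduct, Finset.mul_sum, Finset.sum_mul]
      rw [Finset.sum_comm]
      simp only [mul_assoc]
    funext s
    simpa using h1 s
  obtain ⟨t, ht, htr⟩ := p.exists_transcendental_mem_regularRing hF
  have htv : 1 < p.val t := Place.one_lt_val_of_mem_regularRing ht htr
  have ht0 : t ≠ 0 := by rintro rfl; simp at htv
  obtain ⟨c₀, hc₀, happ⟩ := p.exists_regularRing_approx_completion hF
  -- Coefficients in `A` at bounded distance from `t^N xᵢ`. The exact combination of the `eᵢz` with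
  -- coefficients `t^N xᵢ` vanishes, so `y N` moves `z` into a compact set that does not depend on
  -- `N`.
  choose a ha using fun (N : ℕ) (i : κ) => happ (p.toCompletion t ^ N * x i)
  let y : ℕ → D := fun N => ∑ i, a N i • e i
  have hyL : ∀ N, y N ∈ L := fun N => L.sum_mem fun i _ => L.smul_mem _ (heL i)
  have hrep : ∀ N, (stdRep C θ (y N)).mulVec z = ∑ i, k (p.toCompletion (a N i)) • w i := by
    intro N
    have h1 : ∀ i, a N i • e i = (a N i : F) • e i := fun i => rfl
    simp only [y, h1, map_sum, stdRep_smul, Matrix.sum_mulVec, Matrix.smul_mulVec, w, hk]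
  let g : (κ → p.Completion) → (Fin d → C) := fun β => - ∑ i, k (β i) • w i
  have hg : Continuous g := by
    refine (continuous_finsetSum _ fun i _ => ?_).neg
    exact (hC.comp (continuous_apply i)).smul continuous_const
  have hQ : IsCompact (g '' Set.pi Set.univ fun _ => {x : p.Completion | Valued.v x ≤ p.val c₀}) :=
    (isCompact_univ_pi fun _ => p.isCompact_ball hF hc₀).image hg
  have hmemQ : ∀ N, (stdRep C θ (y N)).mulVec z ∈
      g '' Set.pi Set.univ fun _ => {x : p.Completion | Valued.v x ≤ p.val c₀} := by
    intro N
    refine ⟨fun i => p.toCompletion t ^ N * x i - p.toCompletion (a N i), fun i _ => ha N i, ?_⟩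
    have h1 : ∑ i, k (p.toCompletion t ^ N * x i) • w i = 0 := by
      simp only [map_mul, mul_smul, ← Finset.smul_sum, hw, smul_zero]
    simp only [g, map_sub, sub_smul, Finset.sum_sub_distrib, h1, zero_sub, neg_neg, hrep]
  have hfin : ((G : Set (Fin d → C)) ∩
      g '' Set.pi Set.univ fun _ => {x : p.Completion | Valued.v x ≤ p.val c₀}).Finite := by
    refine IsCompact.finite (hQ.inter_left AddSubgroup.isClosed_of_discrete) ?_
    exact IsDiscrete.mono (s := (G : Set (Fin d → C))) ⟨‹DiscreteTopology G›⟩ Set.inter_subset_left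
  have := hfin.to_subtype
  -- A discrete subgroup meets a compact set in finitely many points, so one value is taken for
  -- infinitely many `N`; by injectivity the elements `y N` themselves coincide.
  obtain ⟨y₀, hy₀⟩ := Finite.exists_infinite_fiber fun N : ℕ =>
    (⟨(stdRep C θ (y N)).mulVec z, hG _ (hyL N), hmemQ N⟩ : ((G : Set (Fin d → C)) ∩
      g '' Set.pi Set.univ fun _ => {x : p.Completion | Valued.v x ≤ p.val c₀} : Set _))
  have hinf := Set.infinite_coe_iff.1 hy₀
  obtain ⟨N₀, hN₀⟩ := hinf.nonempty
  obtain ⟨x₀, hx₀⟩ := p.exists_val_eq (Valued.v (x i₀))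
  have hx₀0 : x₀ ≠ 0 := by
    rintro rfl
    rw [map_zero, eq_comm, map_eq_zero] at hx₀
    exact hi₀ hx₀
  have htinv : p.val t⁻¹ < 1 := by
    rw [map_inv₀]
    exact inv_lt_one_of_one_lt₀ htv
  -- Beyond `M` the value of `t^N x` at `i₀` is at least that of `c₀t`. The extra factor `t` makes
  -- it strictly larger than that of `c₀`, which bounds the difference of two approximation errors.
  obtain ⟨M, hM⟩ := Place.exists_pow_mul_le_one hF p htinv (c₀ * t / x₀)
  obtain ⟨N, hN, hNlt⟩ := hinf.exists_gt (max N₀ M)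
  have hNN₀ : y N = y N₀ := by
    have h1 : (stdRep C θ (y N)).mulVec z = (stdRep C θ (y N₀)).mulVec z :=
      congrArg Subtype.val (hN.trans hN₀.symm)
    have h2 := hinj (y N - y N₀) (by rw [map_sub, Matrix.sub_mulVec, h1, sub_self])
    exact sub_eq_zero.1 h2
  have haN : (a N i₀ : F) = a N₀ i₀ := by
    have h1 : ∀ N, e.coord i₀ (y N) = a N i₀ := by
      intro N
      have h1 : ∀ i, a N i • e i = (a N i : F) • e i := fun i => rfl
      simp only [y, h1, Module.Basis.coord_apply, e.repr_sum_self]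
    rw [← h1 N, ← h1 N₀, hNN₀]
  have hle : Valued.v ((p.toCompletion t ^ N - p.toCompletion t ^ N₀) * x i₀) ≤ p.val c₀ := by
    have : (p.toCompletion t ^ N - p.toCompletion t ^ N₀) * x i₀ =
        (p.toCompletion t ^ N * x i₀ - p.toCompletion (a N i₀)) -
          (p.toCompletion t ^ N₀ * x i₀ - p.toCompletion (a N₀ i₀)) := by
      rw [haN]; ring
    rw [this]
    exact Place.valued_sub_le (ha N i₀) (ha N₀ i₀)
  have hvt : Valued.v (p.toCompletion t ^ N - p.toCompletion t ^ N₀) = p.val t ^ N := by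
    rw [← map_pow, ← map_pow, ← map_sub, Place.valued_toCompletion, ← map_pow]
    refine p.val.map_sub_eq_of_lt_left ?_
    rw [map_pow, map_pow]
    exact pow_lt_pow_right₀ htv ((le_max_left _ _).trans_lt hNlt)
  rw [map_mul, hvt, ← hx₀] at hle
  have h3 := hM N ((le_max_right _ _).trans hNlt.le)
  rw [map_mul, map_pow, map_inv₀, inv_pow, map_div₀, map_mul] at h3
  have hx₀v : 0 < p.val x₀ := zero_lt_iff.2 ((Valuation.ne_zero_iff _).2 hx₀0)
  have htN : 0 < p.val t ^ N := pow_pos (zero_lt_one.trans htv) N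
  have hc₀v : 0 < p.val c₀ := zero_lt_iff.2 ((Valuation.ne_zero_iff _).2 hc₀)
  rw [inv_mul_le_one₀ htN, div_le_iff₀ hx₀v] at h3
  exact absurd (h3.trans hle) (not_le.2 ((lt_mul_iff_one_lt_right hc₀v).2 htv))

end Discrete

end DLattice

/-! ### Representations of matrix algebras and of `D` -/

namespace DLattice

section Representation

/-- A representation of a matrix algebra over a subfield `K` of `C`, of `C`-dimension the size of
the matrices, is isomorphic to the standard one. -/
theorem exists_linearEquiv_mulVec {K C V : Type*} [Field K] [Field C] [Algebra K C]
    [AddCommGroup V] [Module C V] [Nontrivial V] {d : ℕ} (hd : Module.finrank C V = d)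
    (τ : Matrix (Fin d) (Fin d) K →+* Module.End C V)
    (hτ : ∀ (c : K) (m : Matrix (Fin d) (Fin d) K), τ (c • m) = algebraMap K C c • τ m) :
    ∃ ψ : V ≃ₗ[C] (Fin d → C), ∀ (m : Matrix (Fin d) (Fin d) K) (v : V),
      ψ (τ m v) = (m.map (algebraMap K C)).mulVec (ψ v) := by
  have hd0 : d ≠ 0 := by
    rintro rfl
    have h1 : (1 : Module.End C V) = 0 := by
      rw [← map_one τ, Subsingleton.elim (1 : Matrix (Fin 0) (Fin 0) K) 0, map_zero]
    exact one_ne_zero h1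
  have : NeZero d := ⟨hd0⟩
  have : FiniteDimensional C V := Module.finite_of_finrank_pos (hd ▸ Nat.pos_of_ne_zero hd0)
  let E : Fin d → Fin d → Module.End C V := fun i j => τ (Matrix.single i j 1)
  have hEE : ∀ i j k v, E i j (E j k v) = E i k v := fun i j k v => by
    simp only [E, ← Module.End.mul_apply, ← map_mul, Matrix.single_mul_single_same, mul_one]
  have hEE0 : ∀ i j j' k v, j ≠ j' → E i j (E j' k v) = 0 := fun i j j' k v h => by
    simp only [E, ← Module.End.mul_apply, ← map_mul, Matrix.single_mul_single_of_ne _ _ _ _ h]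
    rw [map_zero, LinearMap.zero_apply]
  have hsum : ∀ (m : Matrix (Fin d) (Fin d) K) (v : V),
      τ m v = ∑ i, ∑ j, algebraMap K C (m i j) • E i j v := by
    intro m v
    conv_lhs => rw [Matrix.matrix_eq_sum_single m]
    simp only [map_sum, LinearMap.sum_apply]
    refine Finset.sum_congr rfl fun i _ => Finset.sum_congr rfl fun j _ => ?_
    rw [show Matrix.single i j (m i j) = m i j • Matrix.single i j (1 : K) by
      rw [Matrix.smul_single, smul_eq_mul, mul_one], hτ]
    rfl
  obtain ⟨v, hv⟩ := exists_ne (0 : V)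
  obtain ⟨i, hi⟩ : ∃ i, E i i v ≠ 0 := by
    by_contra! h
    apply hv
    have h1 : v = τ 1 v := by rw [map_one]; rfl
    rw [h1, hsum]
    refine Finset.sum_eq_zero fun i _ => Finset.sum_eq_zero fun j _ => ?_
    by_cases hij : i = j
    · rw [← hij, h, smul_zero]
    · rw [Matrix.one_apply_ne hij, map_zero, zero_smul]
  -- With `i` such that `E i i v ≠ 0`, the vectors `E j i v` are permuted by the matrix units like
  -- the standard basis. Non-vanishing of `w` gives their independence.
  set w := E 0 i v with hw
  have hw0 : w ≠ 0 := fun h => hi (by rw [← hEE i 0 i, ← hw, h, map_zero])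
  let φ : (Fin d → C) →ₗ[C] V := Fintype.linearCombination C fun j => E j i v
  have hφ : ∀ c, φ c = ∑ j, c j • E j i v := fun c => Fintype.linearCombination_apply C _ c
  have hE : ∀ a b c, E a b (φ c) = c b • E a i v := by
    intro a b c
    rw [hφ, map_sum, Finset.sum_eq_single b]
    · rw [map_smul, hEE]
    · intro j _ hj
      rw [map_smul, hEE0 _ _ _ _ _ hj.symm, smul_zero]
    · exact fun h => absurd (Finset.mem_univ b) h
  have hinj : Function.Injective φ := by
    refine (injective_iff_map_eq_zero φ).2 fun c hc => funext fun j => ?_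
    have h1 := hE 0 j c
    rw [hc, map_zero, eq_comm, smul_eq_zero] at h1
    exact h1.resolve_right hw0
  let ψ := LinearEquiv.ofInjectiveOfFinrankEq φ hinj (by rw [hd, Module.finrank_fin_fun])
  have hψ : ∀ c, ψ c = φ c := fun c => rfl
  refine ⟨ψ.symm, fun m v => ?_⟩
  obtain ⟨c, rfl⟩ := ψ.surjective v
  rw [LinearEquiv.symm_apply_eq, LinearEquiv.symm_apply_apply, hψ, hψ, hsum, hφ (Matrix.mulVec _ _)]
  refine Finset.sum_congr rfl fun a _ => ?_
  simp only [hE, smul_smul, ← Finset.sum_smul]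
  rfl

/-- Over a simple Artinian algebra, a module of the same dimension as the algebra is free of
rank one. -/
theorem nonempty_linearEquiv_of_finrank_eq {F D W : Type*} [Field F] [Ring D] [Algebra F D]
    [IsSimpleRing D] [FiniteDimensional F D] [AddCommGroup W] [Module F W] [Module D W]
    [IsScalarTower F D W] (h : Module.finrank F W = Module.finrank F D) :
    Nonempty (D ≃ₗ[D] W) := by
  have : IsArtinianRing D := isArtinian_of_tower F inferInstance
  have hpos : 0 < Module.finrank F W := h ▸ Module.finrank_pos
  have : FiniteDimensional F W := Module.finite_of_finrank_pos hpos
  have : Module.Finite D W := Module.Finite.of_restrictScalars_finite F D W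
  have : Nontrivial W := Module.nontrivial_of_finrank_pos hpos
  -- Both modules are powers of the unique simple module, and the dimensions over `F` compare the
  -- exponents.
  obtain ⟨m, _, S, hS, ⟨e⟩⟩ := (IsSimpleRing.isIsotypic D D).linearEquiv_fun
  obtain ⟨n, _, T, hT, ⟨f⟩⟩ := (IsSimpleRing.isIsotypic D W).linearEquiv_fun
  obtain ⟨I, ⟨i⟩⟩ := IsSemisimpleRing.exists_linearEquiv_ideal_of_isSimpleModule D T
  have := IsSimpleModule.congr i.symm
  obtain ⟨j⟩ := IsSimpleRing.isIsotypic D D S I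
  have k : T ≃ₗ[D] S := i.trans j
  have e' : D ≃ₗ[F] (Fin m → S) := e.restrictScalars F
  have f' : W ≃ₗ[F] (Fin n → S) := (f.trans (LinearEquiv.piCongrRight fun _ => k)).restrictScalars F
  have : Nontrivial S := IsSimpleModule.nontrivial D S
  have he := e'.finrank_eq
  have hf := f'.finrank_eq
  rw [Module.finrank_pi_fintype, Finset.sum_const, Finset.card_univ, Fintype.card_fin,
    smul_eq_mul] at he hf
  have hmn : n * Module.finrank F S = m * Module.finrank F S := by rw [← hf, ← he, h]
  have hnm : n = m := Nat.eq_of_mul_eq_mul_right (Module.finrank_pos (R := F) (M := S)) hmn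
  subst hnm
  exact ⟨e.trans (f.trans (LinearEquiv.piCongrRight fun _ => k)).symm⟩

end Representation

section StdRep

variable {Fq F : Type*} [Field Fq] [Field F] [Algebra Fq F] {p : Place Fq F}
variable {C : Type*} [NontriviallyNormedField C] [Algebra p.Completion C]
variable {d : ℕ} {D : Type*} [Ring D] [Algebra F D]
variable (θ : p.Completion ⊗[F] D ≃ₐ[p.Completion] Matrix (Fin d) (Fin d) p.Completion)

theorem tmul_right_injective :
    Function.Injective fun x : D => θ ((1 : p.Completion) ⊗ₜ[F] x) :=
  θ.injective.comp (Algebra.TensorProduct.includeRight_injective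
    (FaithfulSMul.algebraMap_injective F p.Completion))

/-- A `d`-dimensional representation of `D` over `C` is isomorphic to the standard one. -/
theorem exists_linearEquiv_stdRep [Algebra F C] [IsScalarTower F p.Completion C] [Nontrivial D]
    {V : Type*} [AddCommGroup V] [Module C V] [Module F V] [Module D V] [SMulCommClass D C V]
    [IsScalarTower F C V] [IsScalarTower F D V] (hd : Module.finrank C V = d) :
    ∃ ψ : V ≃ₗ[C] (Fin d → C), ∀ (x : D) (v : V), ψ (x • v) = (stdRep C θ x).mulVec (ψ v) := by
  have : Nontrivial (Matrix (Fin d) (Fin d) p.Completion) := (tmul_right_injective θ).nontrivial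
  have hd0 : 0 < d := by
    rcases Nat.eq_zero_or_pos d with rfl | h
    · exact absurd (Subsingleton.elim (0 : Matrix (Fin 0) (Fin 0) p.Completion) 1) zero_ne_one
    · exact h
  have : Nontrivial V := Module.nontrivial_of_finrank_pos (R := C) (hd ▸ hd0)
  have : SMulCommClass F C V := IsScalarTower.to_smulCommClass
  let κ : p.Completion →ₐ[F] Module.End C V :=
    ((Algebra.ofId C (Module.End C V)).restrictScalars F).comp
      (IsScalarTower.toAlgHom F p.Completion C)
  -- The actions of `D` and of `F_∞ ⊂ C` commute, so they combine to an action of the matrix algebra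
  -- `F_∞ ⊗ D`.
  let ρ : p.Completion ⊗[F] D →ₐ[F] Module.End C V :=
    Algebra.TensorProduct.lift κ (Algebra.lsmul F C V) (by
      intro c x
      ext v
      exact (smul_comm x (algebraMap p.Completion C c) v).symm)
  have hρt : ∀ (c : p.Completion) (x : D), ρ (c ⊗ₜ[F] x) = κ c * Algebra.lsmul F C V x :=
    fun c x => Algebra.TensorProduct.lift_tmul _ _ _ c x
  have hρ : ∀ (c : p.Completion) (y : p.Completion ⊗[F] D),
      ρ (c • y) = algebraMap p.Completion C c • ρ y := by
    intro c y
    have h1 : c • y = (c ⊗ₜ[F] 1) * y := by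
      rw [Algebra.smul_def]; rfl
    have h2 : ρ (c ⊗ₜ[F] 1) = algebraMap C (Module.End C V) (algebraMap p.Completion C c) := by
      rw [hρt, map_one, mul_one]; rfl
    rw [h1, map_mul, h2, ← Algebra.smul_def]
  obtain ⟨ψ, hψ⟩ := exists_linearEquiv_mulVec hd (ρ.toRingHom.comp θ.symm.toRingEquiv.toRingHom)
    (fun c m => by
      change ρ (θ.symm (c • m)) = _ • ρ (θ.symm m)
      rw [map_smul, hρ])
  refine ⟨ψ, fun x v => ?_⟩
  have h1 : ρ (θ.symm (θ (1 ⊗ₜ x))) v = x • v := by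
    rw [AlgEquiv.symm_apply_apply, hρt, map_one, one_mul]; rfl
  rw [← h1]
  exact hψ _ v

variable {θ} in
/-- Schur's lemma for the standard representation. -/
theorem exists_smul_of_commute_stdRep [FiniteDimensional F D]
    (α : (Fin d → C) →ₗ[C] (Fin d → C))
    (hα : ∀ (x : D) (v : Fin d → C), α ((stdRep C θ x).mulVec v) = (stdRep C θ x).mulVec (α v)) :
    ∃ a : C, ∀ v, α v = a • v := by
  let M := LinearMap.toMatrix' α
  have hM : ∀ v, M.mulVec v = α v := fun v => by
    rw [← Matrix.toLin'_apply, Matrix.toLin'_toMatrix']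
  have hcomm : ∀ x : D, Commute (stdRep C θ x) M := fun x => by
    refine Matrix.mulVec_injective (funext fun v => ?_)
    rw [← Matrix.mulVec_mulVec, ← Matrix.mulVec_mulVec, hM, hM, hα]
  -- The image of `D` spans all matrices over `F_∞`, in particular the matrix units, whose commutant
  -- is the scalars.
  have hcomm' : ∀ m : Matrix (Fin d) (Fin d) p.Completion,
      Commute ((algebraMap p.Completion C).mapMatrix m) M := fun m => by
    rw [← sum_matrixCoord_smul θ (Module.finBasis F D) m, map_sum]
    refine Commute.sum_left _ _ _ fun i _ => ?_
    have h1 : (algebraMap p.Completion C).mapMatrix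
        (matrixCoord θ (Module.finBasis F D) i m • θ (1 ⊗ₜ Module.finBasis F D i)) =
        algebraMap p.Completion C (matrixCoord θ (Module.finBasis F D) i m) •
          stdRep C θ (Module.finBasis F D i) := by
      ext a b
      simp [stdRep_apply]
    rw [h1]
    exact (hcomm _).smul_left _
  obtain ⟨a, ha⟩ := Matrix.mem_range_scalar_of_commute_single (M := M) fun i j _ => by
    have := hcomm' (Matrix.single i j 1)
    rwa [RingHom.mapMatrix_apply, Matrix.map_single, map_one] at this
  refine ⟨a, fun v => ?_⟩
  rw [← hM, ← ha, Matrix.scalar_apply, ← Matrix.smul_one_eq_diagonal, Matrix.smul_mulVec,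
    Matrix.one_mulVec]

variable {θ} in
-- The rows of `θ(1 ⊗ x)` are linear relations over `F_∞` between the coordinates of `z`.
theorem eq_zero_of_stdRep_mulVec_eq_zero {z : Fin d → C}
    (hz : ∀ c : Fin d → p.Completion, c ≠ 0 → ∑ i, algebraMap p.Completion C (c i) * z i ≠ 0)
    {x : D} (hx : (stdRep C θ x).mulVec z = 0) : x = 0 := by
  have h1 : ∀ s, (θ (1 ⊗ₜ x)) s = 0 := fun s => by
    by_contra h
    exact hz _ h (congrFun hx s)
  refine tmul_right_injective θ ?_
  change θ (1 ⊗ₜ x) = θ (1 ⊗ₜ 0)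
  rw [TensorProduct.tmul_zero, map_zero]
  exact funext h1

end StdRep

section Topology

/-- A subset of a finite-dimensional vector space is discrete for the canonical topology if and
only if its image in coordinates is. -/
theorem discreteTopology_image_iff {C V : Type*} [NontriviallyNormedField C] [AddCommGroup V]
    [Module C V] {d : ℕ} (ψ : V ≃ₗ[C] (Fin d → C)) (S : Set V) :
    DiscreteTopology (ψ '' S) ↔ (letI := moduleTopology C V; DiscreteTopology S) := by
  let := moduleTopology C V
  have : IsModuleTopology C V := ⟨rfl⟩
  have : ContinuousAdd V := IsModuleTopology.toContinuousAdd C V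
  let e : V ≃ₜ (Fin d → C) :=
    { ψ with
      continuous_toFun := IsModuleTopology.continuous_of_linearMap ψ.toLinearMap
      continuous_invFun := IsModuleTopology.continuous_of_linearMap ψ.symm.toLinearMap }
  constructor <;> intro h
  · have h' : DiscreteTopology (e '' S) := h
    exact (e.image S).isEmbedding.discreteTopology
  · have h' : DiscreteTopology S := h
    exact (e.image S).symm.isEmbedding.discreteTopology

end Topology

end DLattice

/-! ### From lattices in `V` to lattices in `D` -/

namespace DLattice

section Abstract

variable {A D : Type*} [CommRing A] [IsDomain A] [Ring D] [Algebra A D] {O : Subalgebra A D}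

/-- A projective lattice in the algebra of an order is finitely generated. -/
theorem IsMaximalFullOrder.finite_of_projective [Module.IsTorsionFree A D]
    (hO : IsMaximalFullOrder O) (L : Submodule O D) [Module.Projective O L] {s : A} (hs : s ≠ 0)
    (hsL : algebraMap A D s ∈ L) : Module.Finite O L := by
  obtain ⟨S, hS⟩ := Module.projective_def'.1 (inferInstance : Module.Projective O L)
  let σ : L := ⟨algebraMap A D s, hsL⟩
  -- Every `l` has a non-zero scalar multiple that is an `O`-multiple of `σ`. Hence the support of
  -- `S l` lies in that of `S σ`, a finite set, which therefore generates `L`.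
  have hsupp : ∀ l : L, ∀ t, S σ t = 0 → S l t = 0 := by
    intro l t ht
    obtain ⟨a, ha, hal⟩ := hO.exists_smul_mem l
    have h1 : algebraMap A O (s * a) • l = (⟨a • (l : D), hal⟩ : O) • σ := by
      refine Subtype.ext ?_
      change algebraMap A D (s * a) * (l : D) = (a • (l : D)) * algebraMap A D s
      rw [← Algebra.commutes, map_mul, mul_assoc, ← Algebra.smul_def a]
    have h2 := congrArg (fun f : L →₀ O => ((f t : O) : D)) (congrArg S h1)
    simp only [map_smul, Finsupp.smul_apply, ht, smul_zero, ZeroMemClass.coe_zero] at h2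
    have h3 : (s * a) • ((S l t : O) : D) = 0 := by
      rw [Algebra.smul_def]
      exact h2
    exact Subtype.ext ((smul_eq_zero.1 h3).resolve_left (mul_ne_zero hs ha))
  refine ⟨⟨(S σ).support, ?_⟩⟩
  refine eq_top_iff.2 fun l _ => ?_
  have h1 : Finsupp.linearCombination O id (S l) = l := LinearMap.congr_fun hS l
  rw [← h1, Finsupp.linearCombination_apply]
  refine Submodule.sum_mem _ fun t ht => Submodule.smul_mem _ _ (Submodule.subset_span ?_)
  refine Finset.mem_coe.2 (Finsupp.mem_support_iff.2 fun h => ?_)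
  exact Finsupp.mem_support_iff.1 ht (hsupp l t h)

theorem IsMaximalFullOrder.exists_smul_mem_of_finite (hO : IsMaximalFullOrder O)
    (L : Submodule O D) [Module.Finite O L] : ∃ r : A, r ≠ 0 ∧ ∀ l ∈ L, r • l ∈ O := by
  classical
  obtain ⟨G, hG⟩ := (Module.finite_def.1 (inferInstance : Module.Finite O L))
  obtain ⟨r, hr, hrG⟩ : ∃ r : A, r ≠ 0 ∧ ∀ g ∈ G, r • (g : D) ∈ O := by
    clear hG
    induction G using Finset.induction_on with
    | empty => exact ⟨1, one_ne_zero, by simp⟩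
    | insert g G _ ih =>
      obtain ⟨r, hr, h⟩ := ih
      obtain ⟨a, ha, hag⟩ := hO.exists_smul_mem (g : D)
      refine ⟨r * a, mul_ne_zero hr ha, fun x hx => ?_⟩
      rcases Finset.mem_insert.1 hx with rfl | hx
      · rw [mul_smul]
        exact O.smul_mem hag r
      · rw [mul_comm, mul_smul]
        exact O.smul_mem (h x hx) a
  refine ⟨r, hr, fun l hl => ?_⟩
  have key : ∀ x : L, r • (x : D) ∈ O := by
    intro x
    have hx : x ∈ Submodule.span O (G : Set L) := hG ▸ Submodule.mem_top
    induction hx using Submodule.span_induction with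
    | mem x hx => exact hrG x hx
    | zero => simp
    | add x y _ _ hx hy =>
      rw [Submodule.coe_add, smul_add]
      exact O.add_mem hx hy
    | smul o x _ hx =>
      have h1 : r • ((o • x : L) : D) = o * (r • (x : D)) := (mul_smul_comm r (o : D) (x : D)).symm
      rw [h1]
      exact O.mul_mem o.2 hx
  exact key ⟨l, hl⟩

end Abstract

section Units

/-- For a ring embedded in `E`, multiplication by two units carries the ring to the same set if
and only if the units differ by a unit of the ring. -/
theorem inv_mul_mem_range_units_map_iff {S E : Type*} [Semiring S] [Semiring E] (f : S →+* E)
    (hf : Function.Injective f) (T : E → Prop) (hT : ∀ y, T y ↔ ∃ u, y = f u) (g g' : Eˣ) :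
    g⁻¹ * g' ∈ (Units.map f.toMonoidHom).range ↔ ∀ y : E, T (y * g) ↔ T (y * g') := by
  simp only [hT]
  constructor
  · rintro ⟨u, hu⟩ y
    have hu1 : f (u : S) = (g⁻¹ : Eˣ) * (g' : E) := congrArg Units.val hu
    have hu2 : f ((u⁻¹ : Sˣ) : S) = (g'⁻¹ : Eˣ) * (g : E) := by
      have := congrArg (fun x : Eˣ => ((x⁻¹ : Eˣ) : E)) hu
      simpa [mul_inv_rev, ← map_inv] using this
    constructor
    · rintro ⟨x, hx⟩
      exact ⟨x * u, by rw [map_mul, ← hx, hu1, mul_assoc, Units.mul_inv_cancel_left]⟩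
    · rintro ⟨x, hx⟩
      exact ⟨x * (u⁻¹ : Sˣ), by rw [map_mul, ← hx, hu2, mul_assoc, Units.mul_inv_cancel_left]⟩
  · intro h
    obtain ⟨a, ha⟩ := (h (g⁻¹ : Eˣ)).1 ⟨1, by rw [map_one, Units.inv_mul]⟩
    obtain ⟨b, hb⟩ := (h (g'⁻¹ : Eˣ)).2 ⟨1, by rw [map_one, Units.inv_mul]⟩
    refine ⟨⟨a, b, hf ?_, hf ?_⟩, Units.ext ?_⟩
    · rw [map_mul, ← ha, ← hb, map_one, mul_assoc, Units.mul_inv_cancel_left, Units.inv_mul]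
    · rw [map_mul, ← ha, ← hb, map_one, mul_assoc, Units.mul_inv_cancel_left, Units.inv_mul]
    · exact ha.symm

end Units

section Lattice

variable {Fq F : Type*} [Field Fq] [Field F] [Algebra Fq F] {p : Place Fq F}
variable {D : Type*} [Ring D] [Algebra F D] {O : Subalgebra p.regularRing D}
variable {V : Type*} [AddCommGroup V] [Module D V]

/-- The elements of `D` that carry a vector `w` into a lattice. -/
def latticeOf (Λ : Submodule O V) (w : V) : Submodule O D where
  carrier := {x | x • w ∈ Λ}
  add_mem' {x y} hx hy := by
    have h : (x + y) • w = x • w + y • w := add_smul x y w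
    exact (congrArg (· ∈ Λ) h).mpr (Λ.add_mem hx hy)
  zero_mem' := by
    have h : (0 : D) • w = 0 := zero_smul D w
    exact (congrArg (· ∈ Λ) h).mpr Λ.zero_mem
  smul_mem' o x hx := by
    have h : (o • x) • w = o • (x • w) := mul_smul (o : D) x w
    exact (congrArg (· ∈ Λ) h).mpr (Λ.smul_mem o hx)

theorem mem_latticeOf {Λ : Submodule O V} {w : V} {x : D} : x ∈ latticeOf Λ w ↔ x • w ∈ Λ := Iff.rfl

/-- A lattice of rank one, seen from the corresponding lattice in `D`. -/
def latticeOfMap (Λ : Submodule O V) (w : V) : latticeOf Λ w →ₗ[O] Λ where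
  toFun x := ⟨(x : D) • w, x.2⟩
  map_add' x y := Subtype.ext (add_smul (x : D) (y : D) w)
  map_smul' o x := Subtype.ext (mul_smul (o : D) (x : D) w)

theorem latticeOfMap_bijective {Λ : Submodule O V} {w : V}
    (hw : (Λ : Set V) ⊆ Set.range fun x : D => x • w)
    (hinj : Function.Injective fun x : D => x • w) : Function.Bijective (latticeOfMap Λ w) := by
  refine ⟨fun x y h => Subtype.ext (hinj (congrArg Subtype.val h)), fun v => ?_⟩
  obtain ⟨x, hx⟩ := hw v.2
  have hx' : x • w = v := hx
  exact ⟨⟨x, by rw [mem_latticeOf, hx']; exact v.2⟩, Subtype.ext hx⟩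

variable [Module F V] [IsScalarTower F D V]

theorem regularRing_smul_mem (Λ : Submodule O V) (a : p.regularRing) {v : V} (hv : v ∈ Λ) :
    (a : F) • v ∈ Λ := by
  have h : (a : F) • v = algebraMap p.regularRing O a • v :=
    (algebraMap_smul D (a : F) v).symm
  rw [h]
  exact Λ.smul_mem _ hv

theorem exists_smul_mem_of_mem_span [IsFractionRing p.regularRing F] (Λ : Submodule O V) {v : V}
    (hv : v ∈ Submodule.span F (Λ : Set V)) : ∃ a : p.regularRing, a ≠ 0 ∧ (a : F) • v ∈ Λ := by
  induction hv using Submodule.span_induction with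
  | mem v hv => exact ⟨1, one_ne_zero, by simpa using hv⟩
  | zero => exact ⟨1, one_ne_zero, by simp⟩
  | add v w _ _ hv hw =>
    obtain ⟨a, ha, hav⟩ := hv
    obtain ⟨b, hb, hbw⟩ := hw
    refine ⟨a * b, mul_ne_zero ha hb, ?_⟩
    rw [smul_add]
    refine Λ.add_mem ?_ ?_
    · have h : ((a * b : p.regularRing) : F) • v = (b : F) • (a : F) • v := by
        rw [smul_smul, mul_comm]; rfl
      rw [h]
      exact regularRing_smul_mem Λ b hav
    · have h : ((a * b : p.regularRing) : F) • w = (a : F) • (b : F) • w := by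
        rw [smul_smul]; rfl
      rw [h]
      exact regularRing_smul_mem Λ a hbw
  | smul f v _ hv =>
    obtain ⟨a, ha, hav⟩ := hv
    obtain ⟨n, s, hs, rfl⟩ := IsFractionRing.div_surjective (A := p.regularRing) f
    have hs0 : s ≠ 0 := nonZeroDivisors.ne_zero hs
    have hsF : (s : F) ≠ 0 := fun h => hs0 (Subtype.ext h)
    refine ⟨s * a, mul_ne_zero hs0 ha, ?_⟩
    have h : ((s * a : p.regularRing) : F) • (algebraMap p.regularRing F n /
        algebraMap p.regularRing F s) • v = (n : F) • (a : F) • v := by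
      rw [smul_smul, smul_smul]
      congr 1
      change ((s : F) * a) * ((n : F) / s) = n * a
      field_simp
    rw [h]
    exact regularRing_smul_mem Λ n hav

theorem smul_mem_span_lattice (hspan : Submodule.span F (O : Set D) = ⊤) (Λ : Submodule O V) (x : D)
    {v : V} (hv : v ∈ Submodule.span F (Λ : Set V)) : x • v ∈ Submodule.span F (Λ : Set V) := by
  have : SMulCommClass F D V := IsScalarTower.to_smulCommClass
  have hx : x ∈ Submodule.span F (O : Set D) := hspan ▸ Submodule.mem_top
  induction hx using Submodule.span_induction with
  | mem o ho =>
    induction hv using Submodule.span_induction with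
    | mem v hv => exact Submodule.subset_span (Λ.smul_mem (⟨o, ho⟩ : O) hv)
    | zero => simp
    | add v w _ _ hv hw => rw [smul_add]; exact Submodule.add_mem _ hv hw
    | smul f v _ hv => rw [← smul_comm f o v]; exact Submodule.smul_mem _ f hv
  | zero => simp
  | add x y _ _ hx hy => rw [add_smul]; exact Submodule.add_mem _ hx hy
  | smul f x _ hx => rw [smul_assoc]; exact Submodule.smul_mem _ f hx

/-- The `F`-span of a lattice of rank one is generated by one element over `D`. -/
theorem exists_span_lattice_eq_range [IsSimpleRing D] [FiniteDimensional F D]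
    (hspan : Submodule.span F (O : Set D) = ⊤) (Λ : Submodule O V)
    (hrank : Module.finrank F (Submodule.span F (Λ : Set V)) = Module.finrank F D) :
    ∃ w : V, (Submodule.span F (Λ : Set V) : Set V) = Set.range fun x : D => x • w := by
  let W : Submodule D V :=
    { Submodule.span F (Λ : Set V) with
      smul_mem' := fun x _ hv => smul_mem_span_lattice hspan Λ x hv }
  obtain ⟨e⟩ := nonempty_linearEquiv_of_finrank_eq (F := F) (D := D) (W := W) hrank
  refine ⟨e 1, ?_⟩
  ext v
  constructor
  · intro hv
    obtain ⟨x, hx⟩ := e.surjective ⟨v, hv⟩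
    refine ⟨x, ?_⟩
    change x • ((e 1 : W) : V) = v
    rw [← Submodule.coe_smul, ← map_smul, smul_eq_mul, mul_one, hx]
  · rintro ⟨x, rfl⟩
    exact W.smul_mem x (e 1).2

theorem smul_injective_of_span_eq_range [FiniteDimensional F D] {Λ : Submodule O V}
    (hrank : Module.finrank F (Submodule.span F (Λ : Set V)) = Module.finrank F D) {w : V}
    (hw : (Submodule.span F (Λ : Set V) : Set V) = Set.range fun x : D => x • w) :
    Function.Injective fun x : D => x • w := by
  let f : D →ₗ[F] Submodule.span F (Λ : Set V) :=
    { toFun := fun x => ⟨x • w, by rw [← SetLike.mem_coe, hw]; exact ⟨x, rfl⟩⟩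
      map_add' := fun x y => Subtype.ext (add_smul x y w)
      map_smul' := fun a x => Subtype.ext (smul_assoc a x w) }
  have hsurj : Function.Surjective f := by
    rintro ⟨v, hv⟩
    rw [← SetLike.mem_coe, hw] at hv
    obtain ⟨x, hx⟩ := hv
    exact ⟨x, Subtype.ext hx⟩
  have : FiniteDimensional F (Submodule.span F (Λ : Set V)) := Module.Finite.of_surjective f hsurj
  have hinj := (LinearMap.injective_iff_surjective_of_finrank_eq_finrank hrank.symm).2 hsurj
  exact fun x y h => hinj (Subtype.ext h)

theorem exists_smul_mem_latticeOf [IsFractionRing p.regularRing F] {Λ : Submodule O V} {w : V}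
    (hw : (Submodule.span F (Λ : Set V) : Set V) = Set.range fun x : D => x • w) (x : D) :
    ∃ a : p.regularRing, a ≠ 0 ∧ (a : F) • x ∈ latticeOf Λ w := by
  have hx : x • w ∈ Submodule.span F (Λ : Set V) := by
    rw [← SetLike.mem_coe, hw]
    exact ⟨x, rfl⟩
  obtain ⟨a, ha, h⟩ := exists_smul_mem_of_mem_span Λ hx
  exact ⟨a, ha, by rwa [mem_latticeOf, smul_assoc]⟩

end Lattice

end DLattice

/-! ### The adelic period of a lattice -/

namespace DLattice

section Abstract

variable {A D H E : Type*} [CommRing A] [Ring D] [Algebra A D] [CommRing H] [Ring E]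
variable {ι : D →+* E} {η : H →+* E} {O : Subalgebra A D}

/-- The adelic span of `L` is generated over that of the order `O` by the inverse of `g`. -/
def IsAdelicPeriod (ι : D →+* E) (η : H →+* E) (O : Subalgebra A D) (L : Set D) (g : Eˣ) : Prop :=
  ∀ y, y ∈ hatSpan ι η L ↔ y * g ∈ hatSpan ι η (O : Set D)

theorem mul_map_mem_hatSpan (hcomm : ∀ α y, η α * y = y * η α) {L L' : Set D} {δ : D}
    (h : ∀ x ∈ L', x * δ ∈ L) {y : E} (hy : y ∈ hatSpan ι η L') : y * ι δ ∈ hatSpan ι η L := by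
  refine mem_mul_of_mem_hatSpan (G := hatSpan ι η L) hy (ι δ) fun x hx α => ?_
  rw [mul_assoc, hcomm, ← mul_assoc, ← map_mul]
  exact map_mul_map_mem_hatSpan (h x hx) α

theorem mem_hatSpan_iff_mul_map_mem (hcomm : ∀ α y, η α * y = y * η α) {L L' : Set D} (δ : Dˣ)
    (h : ∀ x, x ∈ L' ↔ x * δ ∈ L) (y : E) :
    y ∈ hatSpan ι η L' ↔ y * ι δ ∈ hatSpan ι η L := by
  refine ⟨mul_map_mem_hatSpan hcomm fun x hx => (h x).1 hx, fun hy => ?_⟩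
  have h1 := mul_map_mem_hatSpan (L := L') (δ := (δ⁻¹ : Dˣ)) hcomm
    (fun x hx => (h _).2 (by rwa [Units.inv_mul_cancel_right])) hy
  rwa [mul_assoc, ← map_mul, Units.mul_inv, map_one, mul_one] at h1

/-- Here `L' = Lδ⁻¹`, so its adelic span is generated by `g⁻¹δ⁻¹ = (δg)⁻¹`. Two elements define the
same span exactly when they differ by a unit of the integral ring. -/
theorem IsAdelicPeriod.iff_inv_mul_mem [Algebra A H] (h : IsAdelicExtension O ι η)
    {S : Type*} [Semiring S]
    {f : S →+* E} (hf : Function.Injective f)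
    (hfO : ∀ y, y ∈ hatSpan ι η (O : Set D) ↔ ∃ u, y = f u) {L L' : Set D} {g g' : Eˣ}
    (hg : IsAdelicPeriod ι η O L g) (δ : Dˣ) (hL : ∀ x, x ∈ L' ↔ x * δ ∈ L) :
    IsAdelicPeriod ι η O L' g' ↔
      (Units.map ι.toMonoidHom δ * g)⁻¹ * g' ∈ (Units.map f.toMonoidHom).range := by
  rw [inv_mul_mem_range_units_map_iff f hf (fun y => y ∈ hatSpan ι η (O : Set D)) hfO]
  refine forall_congr' fun y => ?_
  rw [mem_hatSpan_iff_mul_map_mem h.comm δ hL, hg, mul_assoc]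
  rfl

theorem coe_eq_setOf_mul_inv_iff {X : Type*} {f : X → E} (hfO : ∀ y, y ∈ hatSpan ι η (O : Set D) ↔
    ∃ u, y = f u) {L : Set D} {T : AddSubgroup E} (hT : T = hatSpan ι η L) (g : Eˣ) :
    ((T : Set E) = {y | ∃ u, y = f u * ((g⁻¹ : Eˣ) : E)}) ↔ IsAdelicPeriod ι η O L g := by
  rw [Set.ext_iff]
  refine forall_congr' fun y => iff_congr (by rw [hT]; rfl) ?_
  rw [Set.mem_ofPred, hfO]
  exact exists_congr fun u => Units.eq_mul_inv_iff_mul_eq g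

variable [Algebra A H]

/-- A lattice is determined by its adelic span. -/
theorem IsAdelicPeriod.le (h : IsAdelicExtension O ι η) (hO : IsMaximalFullOrder O)
    [NoZeroDivisors A] {L L' : Submodule O D} {g : Eˣ} (hL : IsAdelicPeriod ι η O (L : Set D) g)
    (hL' : IsAdelicPeriod ι η O (L' : Set D) g) {s r : A} (hs : s ≠ 0)
    (hsL : algebraMap A D s ∈ L') (hr : r ≠ 0) (hrL : ∀ l ∈ L', r • l ∈ O) : L ≤ L' := by
  intro x hx
  refine h.mem_of_map_mem hO L' hs (fun o ho => ?_) hr hrL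
    ((hL' _).2 ((hL _).1 (map_mem_hatSpan hx)))
  rw [Algebra.smul_def, Algebra.commutes]
  exact L'.smul_mem (⟨o, ho⟩ : O) hsL

theorem exists_isAdelicPeriod_of_unit (h : IsAdelicExtension O ι η) (hO : IsMaximalFullOrder O)
    [IsDomain A] [IsNoetherianRing A] [Module.IsTorsionFree A D] [IsDedekindFiniteMonoid D]
    [Nontrivial D] (hA : ¬ IsField A) (g : Eˣ) :
    ∃ L : Submodule O D, IsAdelicPeriod ι η O (L : Set D) g ∧ Module.Projective O L ∧
      (∃ a : A, a ≠ 0 ∧ ∀ o ∈ O, a • o ∈ L) ∧ ∃ b : A, b ≠ 0 ∧ ∀ l ∈ L, b • l ∈ O := by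
  obtain ⟨L, hL⟩ := h.exists_lattice g
  exact ⟨L, h.mem_hatSpan_lattice_iff g L hL hO, h.projective_lattice g L hL hO hA,
    h.exists_smul_mem_lattice g L hL, h.exists_smul_lattice_mem g L hL⟩

end Abstract

section Period

variable {Fq F : Type*} [Field Fq] [Field F] [Algebra Fq F] {p : Place Fq F}
variable {D : Type*} [Ring D] [Algebra F D] {O : Subalgebra p.regularRing D}

variable (O) in
/-- The adelic span of `L` is `(O ⊗ Â) g⁻¹`. -/
def IsLatticePeriod (L : Set D) (g : (AdelicAlgebra p D)ˣ) : Prop :=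
  IsAdelicPeriod (H := p.HatRing) (E := AdelicAlgebra p D) (adelicLeft p D) (adelicRight p D) O L g

set_option maxHeartbeats 2000000 in
theorem iff_inv_mul_mem_levelSubgroup [Finite Fq] [FiniteDimensional F D]
    (hF : IsCurveFunctionField Fq F) (hO : IsMaximalOrder p O) {L L' : Set D}
    {g g' : (AdelicAlgebra p D)ˣ}
    (hg : IsLatticePeriod O L g) (δ : Dˣ)
    (hL : ∀ x, x ∈ L' ↔ x * δ ∈ L) :
    IsLatticePeriod O L' g' ↔
      (unitsToAdelic p D δ * g)⁻¹ * g' ∈ levelSubgroup p O :=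
  IsAdelicPeriod.iff_inv_mul_mem (isAdelicExtension_adelic hF hO) (f := (hatOrderMap p O).toRingHom)
    (hatOrderMap_injective hF O) (mem_hatSpan_iff_exists_hatOrderMap O) hg δ hL

set_option maxHeartbeats 2000000 in
theorem adelicSpan_eq_iff (L : Set D) (g : (AdelicAlgebra p D)ˣ) :
    (adelicSpan p L : Set (AdelicAlgebra p D)) =
      {y | ∃ u, y = hatOrderMap p O u * ((g⁻¹ : (AdelicAlgebra p D)ˣ) : AdelicAlgebra p D)} ↔
        IsLatticePeriod O L g :=
  coe_eq_setOf_mul_inv_iff (mem_hatSpan_iff_exists_hatOrderMap O) (adelicSpan_eq_hatSpan L) g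

/-- A transcendental element of `A` has a pole at `p`; its inverse would vanish at `p`, but 0 is the
only such element of `A`. -/
theorem not_isField_regularRing [Finite Fq] (hF : IsCurveFunctionField Fq F) (p : Place Fq F) :
    ¬ IsField p.regularRing := by
  intro hfield
  obtain ⟨t, ht, htr⟩ := p.exists_transcendental_mem_regularRing hF
  have htv : 1 < p.val t := Place.one_lt_val_of_mem_regularRing ht htr
  have ht0 : t ≠ 0 := by rintro rfl; simp at htv
  obtain ⟨s, hs⟩ := hfield.mul_inv_cancel (a := ⟨t, ht⟩) (fun h => ht0 (congrArg Subtype.val h))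
  have hs' : t * (s : F) = 1 := congrArg Subtype.val hs
  have hv : p.val t * p.val (s : F) = 1 := by rw [← map_mul, hs', map_one]
  have hs1 : p.val (s : F) < 1 := by
    by_contra h
    exact absurd hv (one_lt_mul_of_lt_of_le htv (not_lt.1 h)).ne'
  rw [Place.eq_zero_of_mem_regularRing hF s.2 hs1, mul_zero] at hs'
  exact zero_ne_one hs'

theorem isDedekindFiniteMonoid_of_finiteDimensional (F D : Type*) [Field F] [Ring D] [Algebra F D]
    [FiniteDimensional F D] : IsDedekindFiniteMonoid D := by
  have : IsNoetherianRing D := isNoetherian_of_tower F inferInstance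
  infer_instance

variable [Finite Fq] [FiniteDimensional F D]

theorem eq_of_isLatticePeriod (hF : IsCurveFunctionField Fq F) (hO : IsMaximalOrder p O)
    {L L' : Submodule O D} {g : (AdelicAlgebra p D)ˣ} (hL : IsLatticePeriod O (L : Set D) g)
    (hL' : IsLatticePeriod O (L' : Set D) g)
    (h : ∃ s : p.regularRing, s ≠ 0 ∧ algebraMap p.regularRing D s ∈ L)
    (h' : ∃ s : p.regularRing, s ≠ 0 ∧ algebraMap p.regularRing D s ∈ L')
    [Module.Finite O L] [Module.Finite O L'] : L = L' := by
  have hO' := isMaximalFullOrder hF hO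
  obtain ⟨s, hs, hsL⟩ := h
  obtain ⟨s', hs', hsL'⟩ := h'
  obtain ⟨r, hr, hrL⟩ := hO'.exists_smul_mem_of_finite L
  obtain ⟨r', hr', hrL'⟩ := hO'.exists_smul_mem_of_finite L'
  have hext := isAdelicExtension_adelic hF hO
  exact le_antisymm (IsAdelicPeriod.le hext hO' hL hL' hs' hsL' hr' hrL')
    (IsAdelicPeriod.le hext hO' hL' hL hs hsL hr hrL)

/-- A projective lattice of rank one is locally principal. -/
theorem exists_isLatticePeriod [Algebra.IsCentral F D] [Nontrivial D]
    (hF : IsCurveFunctionField Fq F) (hO : IsMaximalOrder p O)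
    (L : Submodule O D) [Module.Projective O L] [Module.Finite O L]
    (h : ∃ s : p.regularRing, s ≠ 0 ∧ algebraMap p.regularRing D s ∈ L) :
    ∃ g : (AdelicAlgebra p D)ˣ, IsLatticePeriod O (L : Set D) g := by
  have hO' := isMaximalFullOrder hF hO
  obtain ⟨s, hs, hsL⟩ := h
  obtain ⟨r, hr, hrL⟩ := hO'.exists_smul_mem_of_finite L
  have hext := isAdelicExtension_adelic hF hO
  have := Place.isDedekindDomain hF p
  have := Place.hasFiniteQuotients hF p
  have := isDedekindFiniteMonoid_of_finiteDimensional F D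
  exact hext.exists_unit_of_projective L hO' (exists_algebraMap_of_commute hF hO)
    (not_isField_regularRing hF p) hs hsL hr hrL

theorem exists_lattice_isLatticePeriod [Nontrivial D] (hF : IsCurveFunctionField Fq F)
    (hO : IsMaximalOrder p O) (g : (AdelicAlgebra p D)ˣ) :
    ∃ L : Submodule O D, IsLatticePeriod O (L : Set D) g ∧ Module.Projective O L ∧
      (∃ a : p.regularRing, a ≠ 0 ∧ ∀ o ∈ O, a • o ∈ L) ∧
      ∃ b : p.regularRing, b ≠ 0 ∧ ∀ l ∈ L, b • l ∈ O := by
  have := Place.isDedekindDomain hF p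
  have := isDedekindFiniteMonoid_of_finiteDimensional F D
  exact exists_isAdelicPeriod_of_unit (isAdelicExtension_adelic hF hO) (isMaximalFullOrder hF hO)
    (not_isField_regularRing hF p) g

/-- The lattice in `D` that corresponds to a projective lattice of rank one. -/
theorem latticeOf_properties {V : Type*} [AddCommGroup V] [Module D V] [Module F V]
    [IsScalarTower F D V] (hF : IsCurveFunctionField Fq F) (hO : IsMaximalOrder p O)
    {Λ : Submodule O V} [Module.Projective O Λ]
    (hrank : Module.finrank F (Submodule.span F (Λ : Set V)) = Module.finrank F D) {w : V}
    (hw : (Submodule.span F (Λ : Set V) : Set V) = Set.range fun x : D => x • w) :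
    Module.Projective O (latticeOf Λ w) ∧ Module.Finite O (latticeOf Λ w) ∧
      ∃ s : p.regularRing, s ≠ 0 ∧ algebraMap p.regularRing D s ∈ latticeOf Λ w := by
  have := Place.isFractionRing hF p
  have hproj : Module.Projective O (latticeOf Λ w) :=
    Module.Projective.of_equiv (LinearEquiv.ofBijective (latticeOfMap Λ w)
      (latticeOfMap_bijective (Submodule.subset_span.trans hw.subset)
        (smul_injective_of_span_eq_range hrank hw))).symm
  obtain ⟨s, hs, hsL⟩ := exists_smul_mem_latticeOf hw 1
  have hsL' : algebraMap p.regularRing D s ∈ latticeOf Λ w := by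
    have h : algebraMap p.regularRing D s = (s : F) • (1 : D) := Algebra.algebraMap_eq_smul_one _
    rwa [h]
  exact ⟨hproj, (isMaximalFullOrder hF hO).finite_of_projective _ hs hsL', s, hs, hsL'⟩

end Period

end DLattice

/-! ### Periods of pairs: dependence on the choices -/

namespace DLattice

section Pairs

variable {Fq F : Type*} [Field Fq] [Field F] [Algebra Fq F] {p : Place Fq F}
variable {D : Type*} [Ring D] [Algebra F D] {O : Subalgebra p.regularRing D}
variable {C : Type u} [NontriviallyNormedField C] [Algebra p.Completion C] {d : ℕ}
variable (θ : p.Completion ⊗[F] D ≃ₐ[p.Completion] Matrix (Fin d) (Fin d) p.Completion)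

theorem mk_eq_mk_iff {z z' : drinfeldSpace p C d} {g g' : (AdelicAlgebra p D)ˣ} :
    DoubleCosets.mk C θ O z g = DoubleCosets.mk C θ O z' g' ↔
      ∃ δ : Dˣ, (z' : ℙ C (Fin d → C)) = unitsToGL C θ δ • (z : ℙ C (Fin d → C)) ∧
        (unitsToAdelic p D δ * g)⁻¹ * g' ∈ levelSubgroup p O := by
  refine eq_comm.trans ((Quotient.eq (r := MulAction.orbitRel Dˣ (PeriodSpace C θ O))).trans ?_)
  refine exists_congr fun δ => ?_
  rw [← QuotientGroup.eq]
  constructor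
  · intro h
    exact ⟨(congrArg (fun x : PeriodSpace C θ O => (x.1 : ℙ C (Fin d → C))) h).symm,
      congrArg (fun x : PeriodSpace C θ O => x.2) h⟩
  · rintro ⟨h1, h2⟩
    exact Prod.ext (Subtype.ext h1.symm) h2

theorem unitsToGL_smul_mk (δ : Dˣ) {v v' : Fin d → C} (hv : v ≠ 0) (hv' : v' ≠ 0)
    (h : v' = (stdRep C θ δ).mulVec v) :
    unitsToGL C θ δ • Projectivization.mk C v hv = Projectivization.mk C v' hv' := by
  subst h
  rw [Projectivization.smul_mk]
  rfl

variable {θ} [Algebra F C]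

theorem LatticePair.hasPeriod_iff {P : LatticePair C d O} {z : drinfeldSpace p C d}
    {g : (AdelicAlgebra p D)ˣ} :
    P.HasPeriod θ z g ↔ ∃ (ψ : P.V ≃ₗ[C] (Fin d → C)) (w : P.V) (hw : ψ w ≠ 0),
      (∀ (x : D) (v : P.V), ψ (x • v) = Matrix.mulVec (stdRep C θ x) (ψ v)) ∧
      (Submodule.span F (P.lattice : Set P.V) : Set P.V) = Set.range (fun x : D => x • w) ∧
      (z : ℙ C (Fin d → C)) = Projectivization.mk C (ψ w) hw ∧
      IsLatticePeriod O (latticeOf P.lattice w : Set D) g :=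
  exists_congr fun _ => exists_congr fun _ => exists_congr fun _ =>
    and_congr_right fun _ => and_congr_right fun _ => and_congr_right fun _ =>
      adelicSpan_eq_iff _ g

variable [Finite Fq] [FiniteDimensional F D]

/-- The generator `w` is replaced by `δw`, with the same `ψ`. -/
theorem LatticePair.HasPeriod.smul (hF : IsCurveFunctionField Fq F) (hO : IsMaximalOrder p O)
    {P : LatticePair C d O} {z z' : drinfeldSpace p C d} {g g' : (AdelicAlgebra p D)ˣ}
    (h : P.HasPeriod θ z g) (δ : Dˣ)
    (hz : (z' : ℙ C (Fin d → C)) = unitsToGL C θ δ • (z : ℙ C (Fin d → C)))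
    (hg : (unitsToAdelic p D δ * g)⁻¹ * g' ∈ levelSubgroup p O) : P.HasPeriod θ z' g' := by
  rw [hasPeriod_iff] at h ⊢
  obtain ⟨ψ, w, hw, hψ, hspan, hzw, hgw⟩ := h
  have hw' : ψ ((δ : D) • w) ≠ 0 := by
    rw [ne_eq, LinearEquiv.map_eq_zero_iff]
    intro h
    refine hw ?_
    rw [← one_smul D w, ← Units.inv_mul δ, mul_smul, h, smul_zero, map_zero]
  refine ⟨ψ, (δ : D) • w, hw', hψ, ?_, ?_, ?_⟩
  · rw [hspan]
    ext v
    constructor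
    · rintro ⟨x, rfl⟩
      refine ⟨x * (δ⁻¹ : Dˣ), ?_⟩
      change (x * ((δ⁻¹ : Dˣ) : D)) • (δ : D) • w = x • w
      rw [smul_smul, Units.inv_mul_cancel_right]
    · rintro ⟨x, rfl⟩
      exact ⟨x * δ, mul_smul x (δ : D) w⟩
  · rw [hz, hzw]
    exact unitsToGL_smul_mk θ δ hw hw' (hψ δ w)
  · refine (iff_inv_mul_mem_levelSubgroup hF hO hgw δ fun x => ?_).2 hg
    rw [SetLike.mem_coe, SetLike.mem_coe, mem_latticeOf, mem_latticeOf, smul_smul]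

/-- Two generators differ by a unit `δ` of `D`, and two isomorphisms `ψ` by a scalar, which does not
move the projective point. -/
theorem LatticePair.HasPeriod.mk_eq_mk (hF : IsCurveFunctionField Fq F) (hO : IsMaximalOrder p O)
    {P : LatticePair C d O} {z z' : drinfeldSpace p C d} {g g' : (AdelicAlgebra p D)ˣ}
    (h : P.HasPeriod θ z g) (h' : P.HasPeriod θ z' g') :
    DoubleCosets.mk C θ O z g = DoubleCosets.mk C θ O z' g' := by
  rw [hasPeriod_iff] at h h'
  obtain ⟨ψ, w, hw, hψ, hspan, hzw, hgw⟩ := h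
  obtain ⟨ψ', w', hw', hψ', hspan', hzw', hgw'⟩ := h'
  rw [mk_eq_mk_iff]
  obtain ⟨x, hx⟩ : ∃ x : D, x • w = w' := by
    have h1 : w' ∈ Set.range fun x : D => x • w := by
      rw [← hspan, hspan']
      exact ⟨1, one_smul D w'⟩
    exact h1
  obtain ⟨y, hy⟩ : ∃ y : D, y • w' = w := by
    have h1 : w ∈ Set.range fun x : D => x • w' := by
      rw [← hspan', hspan]
      exact ⟨1, one_smul D w⟩
    exact h1
  have hinj := smul_injective_of_span_eq_range P.rank_one hspan
  have hinj' := smul_injective_of_span_eq_range P.rank_one hspan'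
  let δ : Dˣ := ⟨x, y,
    hinj' (by change (x * y) • w' = (1 : D) • w'; rw [mul_smul, hy, hx, one_smul]),
    hinj (by change (y * x) • w = (1 : D) • w; rw [mul_smul, hx, hy, one_smul])⟩
  refine ⟨δ, ?_, ?_⟩
  · obtain ⟨a, ha⟩ := exists_smul_of_commute_stdRep (θ := θ)
      (ψ'.toLinearMap ∘ₗ ψ.symm.toLinearMap) (fun x v => by
        change ψ' (ψ.symm _) = (stdRep C θ x).mulVec (ψ' (ψ.symm v))
        rw [← hψ']
        congr 1
        rw [LinearEquiv.symm_apply_eq, hψ, LinearEquiv.apply_symm_apply])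
    have ha' : ∀ v, ψ' v = a • ψ v := fun v => by
      have := ha (ψ v)
      rwa [LinearMap.comp_apply, LinearEquiv.coe_coe, LinearEquiv.coe_coe,
        LinearEquiv.symm_apply_apply] at this
    have h1 : ψ w' = (stdRep C θ δ).mulVec (ψ w) := by rw [← hψ, ← hx]
    have h2 : ψ w' ≠ 0 := fun h => hw' (by rw [ha', h, smul_zero])
    rw [hzw, hzw', unitsToGL_smul_mk θ δ hw h2 h1, Projectivization.mk_eq_mk_iff']
    exact ⟨a, (ha' w').symm⟩
  · refine (iff_inv_mul_mem_levelSubgroup hF hO hgw δ fun t => ?_).1 hgw'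
    change t • w' ∈ P.lattice ↔ (t * x) • w ∈ P.lattice
    rw [mul_smul, hx]

/-- Equal `g` gives the same lattice in `D`, and equal `z` makes `ψ w` and `ψ' w'` proportional.
After rescaling, `ψ'⁻¹ψ` carries `w` to `w'`, hence one lattice to the other. -/
theorem LatticePair.HasPeriod.iso (hF : IsCurveFunctionField Fq F) (hO : IsMaximalOrder p O)
    {P Q : LatticePair C d O} {z : drinfeldSpace p C d} {g : (AdelicAlgebra p D)ˣ}
    (hP : P.HasPeriod θ z g) (hQ : Q.HasPeriod θ z g) : LatticePair.Iso P Q := by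
  rw [hasPeriod_iff] at hP hQ
  obtain ⟨ψ, w, hw, hψ, hspan, hzw, hgw⟩ := hP
  obtain ⟨ψ', w', hw', hψ', hspan', hzw', hgw'⟩ := hQ
  have := P.projective
  have := Q.projective
  obtain ⟨_, _, hs⟩ := latticeOf_properties hF hO P.rank_one hspan
  obtain ⟨_, _, hs'⟩ := latticeOf_properties hF hO Q.rank_one hspan'
  have hL := eq_of_isLatticePeriod hF hO hgw hgw' hs hs'
  obtain ⟨a, ha⟩ := (Projectivization.mk_eq_mk_iff C _ _ hw' hw).1 (hzw'.symm.trans hzw)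
  let e : P.V ≃ₗ[C] Q.V := (ψ.trans (LinearEquiv.smulOfUnit a)).trans ψ'.symm
  have he : ∀ v, ψ' (e v) = (a : C) • ψ v := fun v => LinearEquiv.apply_symm_apply ψ' _
  have heD : ∀ (x : D) (v : P.V), e (x • v) = x • e v := fun x v => by
    apply ψ'.injective
    rw [he, hψ, hψ', he, Matrix.mulVec_smul]
  have hew : e w = w' := by
    apply ψ'.injective
    rw [he, ← ha]
    rfl
  refine ⟨e, heD, ?_⟩
  ext v
  constructor
  · rintro ⟨u, hu, rfl⟩
    obtain ⟨x, rfl⟩ : u ∈ Set.range fun x : D => x • w := hspan ▸ Submodule.subset_span hu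
    have hx : x ∈ latticeOf P.lattice w := hu
    rw [hL] at hx
    change e (x • w) ∈ Q.lattice
    rw [heD, hew]
    exact hx
  · intro hv
    obtain ⟨x, rfl⟩ : v ∈ Set.range fun x : D => x • w' := hspan' ▸ Submodule.subset_span hv
    have hx : x ∈ latticeOf Q.lattice w' := hv
    rw [← hL] at hx
    refine ⟨x • w, hx, ?_⟩
    rw [heD, hew]

omit [Finite Fq] [FiniteDimensional F D] in
theorem LatticePair.HasPeriod.of_iso {P Q : LatticePair C d O} (hPQ : LatticePair.Iso P Q)
    {z : drinfeldSpace p C d} {g : (AdelicAlgebra p D)ˣ} (hP : P.HasPeriod θ z g) :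
    Q.HasPeriod θ z g := by
  rw [hasPeriod_iff] at hP ⊢
  obtain ⟨ψ, w, hw, hψ, hspan, hzw, hgw⟩ := hP
  obtain ⟨e, heD, heL⟩ := hPQ
  have hcoe : ∀ v, (e.symm.trans ψ) (e v) = ψ v := fun v => by simp
  have heF : ∀ (f : F) v, e (f • v) = f • e v := fun f v => by
    rw [← algebraMap_smul C f v, map_smul, algebraMap_smul]
  have hmem : ∀ v, e v ∈ Q.lattice ↔ v ∈ P.lattice := fun v => by
    rw [← SetLike.mem_coe, ← heL, e.injective.mem_set_image]
    rfl
  refine ⟨e.symm.trans ψ, e w, by rwa [hcoe], fun x v => ?_, ?_, ?_, ?_⟩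
  · obtain ⟨v, rfl⟩ := e.surjective v
    rw [← heD, hcoe, hcoe, hψ]
  · let eF : P.V →ₗ[F] Q.V :=
      { toFun := e, map_add' := map_add e, map_smul' := heF }
    have h1 : Submodule.span F (Q.lattice : Set Q.V) =
        (Submodule.span F (P.lattice : Set P.V)).map eF := by
      rw [Submodule.map_span, ← heL]
      rfl
    rw [h1, Submodule.map_coe, hspan, ← Set.range_comp]
    congr 1
    funext x
    exact heD x w
  · rw [hzw]
    simp only [hcoe]
  · have h1 : latticeOf Q.lattice (e w) = latticeOf P.lattice w := by
      ext x
      rw [mem_latticeOf, mem_latticeOf, ← heD, hmem]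
    rwa [h1]

end Pairs

end DLattice

/-! ### Existence of periods and of pairs -/

namespace DLattice

section Pairs

variable {Fq F : Type*} [Field Fq] [Field F] [Algebra Fq F] {p : Place Fq F}
variable {D : Type*} [Ring D] [Algebra F D] {O : Subalgebra p.regularRing D}
variable {C : Type u} [NontriviallyNormedField C] [Algebra p.Completion C] {d : ℕ}
variable (θ : p.Completion ⊗[F] D ≃ₐ[p.Completion] Matrix (Fin d) (Fin d) p.Completion)
variable [Algebra F C] [IsScalarTower F p.Completion C]
variable [Finite Fq] [FiniteDimensional F D]

theorem LatticePair.exists_hasPeriod [IsSimpleRing D] [Algebra.IsCentral F D]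
    (hF : IsCurveFunctionField Fq F) (hC : Continuous (algebraMap p.Completion C))
    (hO : IsMaximalOrder p O) (P : LatticePair C d O) :
    ∃ (z : drinfeldSpace p C d) (g : (AdelicAlgebra p D)ˣ), P.HasPeriod θ z g := by
  obtain ⟨w, hw⟩ := exists_span_lattice_eq_range hO.1.span_eq_top P.lattice P.rank_one
  obtain ⟨ψ, hψ⟩ := exists_linearEquiv_stdRep θ P.finrank_eq (D := D)
  have hinj := smul_injective_of_span_eq_range P.rank_one hw
  have hψw : ∀ x : D, (stdRep C θ x).mulVec (ψ w) = 0 → x = 0 := fun x hx => by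
    rw [← hψ, LinearEquiv.map_eq_zero_iff] at hx
    exact hinj (hx.trans (zero_smul D w).symm)
  have hψ0 : ψ w ≠ 0 := fun h => one_ne_zero (hψw 1 (by rw [h, Matrix.mulVec_zero]))
  have := P.projective
  obtain ⟨_, _, hs⟩ := latticeOf_properties hF hO P.rank_one hw
  obtain ⟨g, hg⟩ := exists_isLatticePeriod hF hO (latticeOf P.lattice w) hs
  have hz : Projectivization.mk C (ψ w) hψ0 ∈ drinfeldSpace p C d := by
    rw [mk_mem_drinfeldSpace]
    have := Place.isFractionRing hF p
    -- A basis of `D` is scaled into `L`, as the discreteness argument needs a basis inside the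
    -- lattice.
    choose a ha haL using fun i => exists_smul_mem_latticeOf hw (Module.finBasis F D i)
    have haF : ∀ i, IsUnit (a i : F) := fun i =>
      isUnit_iff_ne_zero.2 fun h => ha i (Subtype.ext h)
    let L : Submodule p.regularRing D := (latticeOf P.lattice w).restrictScalars p.regularRing
    let G : AddSubgroup (Fin d → C) := P.lattice.toAddSubgroup.map ψ.toAddEquiv.toAddMonoidHom
    have : DiscreteTopology G := (discreteTopology_image_iff ψ (P.lattice : Set P.V)).2 P.discrete
    refine sum_ne_zero_of_discreteTopology θ hF hC ((Module.finBasis F D).isUnitSMul haF) L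
      (fun i => ?_) hψw G (fun l hl => ⟨l • w, hl, hψ l w⟩)
    rw [Module.Basis.isUnitSMul_apply]
    exact haL i
  exact ⟨⟨_, hz⟩, g, LatticePair.hasPeriod_iff.2 ⟨ψ, w, hψ0, hψ, hw, rfl, hg⟩⟩

/-- The `D`-module `C^d`. -/
abbrev stdModule : Module D (Fin d → C) :=
  Module.compHom (Fin d → C)
    ((Matrix.toLinAlgEquiv' (R := C) (n := Fin d)).toRingEquiv.toRingHom.comp (stdRep C θ))

/-- The pair is `C^d` with `Λ = Lv`, where `v` represents `z` and `L` is the lattice in `D` with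
period `g`. The point being in the Drinfeld space makes `x ↦ xv` injective on `D` and `Lv` discrete.
-/
theorem exists_latticePair_hasPeriod [IsSimpleRing D] (hF : IsCurveFunctionField Fq F)
    (hC : Continuous (algebraMap p.Completion C)) (hO : IsMaximalOrder p O)
    (z : drinfeldSpace p C d) (g : (AdelicAlgebra p D)ˣ) :
    ∃ P : LatticePair C d O, P.HasPeriod θ z g := by
  obtain ⟨L, hLg, hproj, ⟨a, ha, haL⟩, b, hb, hbL⟩ := exists_lattice_isLatticePeriod hF hO g
  have hO' := isMaximalFullOrder hF hO
  have := hO'.finite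
  let := stdModule (C := C) θ
  set v := (z : ℙ C (Fin d → C)).rep with hv
  have hsmul : ∀ (x : D) (u : Fin d → C), x • u = (stdRep C θ x).mulVec u := fun _ _ => rfl
  have hcomm : SMulCommClass D C (Fin d → C) := ⟨fun x c u => by
    rw [hsmul, hsmul, Matrix.mulVec_smul]⟩
  have htower : IsScalarTower F D (Fin d → C) := ⟨fun f x u => by
    rw [hsmul, hsmul, stdRep_smul, Matrix.smul_mulVec, ← algebraMap_smul C f,
      IsScalarTower.algebraMap_apply F p.Completion C]
    rfl⟩
  have hinj : Function.Injective fun x : D => x • v := fun x y h => by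
    have h1 : (x - y) • v = 0 := by rw [sub_smul, sub_eq_zero]; exact h
    exact sub_eq_zero.1 (eq_zero_of_stdRep_mulVec_eq_zero z.2 h1)
  let Λ : Submodule O (Fin d → C) :=
    { carrier := (fun x : D => x • v) '' L
      add_mem' := by
        rintro _ _ ⟨x, hx, rfl⟩ ⟨y, hy, rfl⟩
        exact ⟨x + y, L.add_mem hx hy, add_smul x y v⟩
      zero_mem' := ⟨0, L.zero_mem, zero_smul D v⟩
      smul_mem' := by
        rintro o _ ⟨x, hx, rfl⟩
        exact ⟨o • x, L.smul_mem o hx, mul_smul (o : D) x v⟩ }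
  have hΛ : ∀ x : D, x • v ∈ Λ ↔ x ∈ L := fun x => hinj.mem_set_image
  have hΛL : latticeOf Λ v = L := Submodule.ext hΛ
  let f : D →ₗ[F] (Fin d → C) :=
    { toFun := fun x => x • v
      map_add' := fun x y => add_smul x y v
      map_smul' := fun c x => smul_assoc c x v }
  have hspan : (Submodule.span F (Λ : Set (Fin d → C)) : Set (Fin d → C)) =
      Set.range fun x : D => x • v := by
    have hL : Submodule.span F (L : Set D) = ⊤ := by
      refine eq_top_iff.2 fun x _ => ?_
      obtain ⟨s, hs, hsx⟩ := hO'.exists_smul_mem x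
      have h1 : ((a * s : p.regularRing) : F) • x ∈ Submodule.span F (L : Set D) := by
        have h2 : ((a * s : p.regularRing) : F) • x = a • s • x := mul_smul a s x
        rw [h2]
        exact Submodule.subset_span (haL _ hsx)
      refine (Submodule.smul_mem_iff _ fun h => ?_).1 h1
      exact mul_ne_zero ha hs (Subtype.ext h)
    have h1 : Submodule.span F (Λ : Set (Fin d → C)) = LinearMap.range f := by
      rw [LinearMap.range_eq_map, ← hL, Submodule.map_span]
      rfl
    rw [h1]
    rfl
  have hrank : Module.finrank F (Submodule.span F (Λ : Set (Fin d → C))) = Module.finrank F D := by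
    have h1 : Submodule.span F (Λ : Set (Fin d → C)) = LinearMap.range f :=
      SetLike.coe_injective hspan
    rw [h1]
    exact LinearMap.finrank_range_of_inj hinj
  have hΛproj : Module.Projective O Λ := by
    have h1 : Module.Projective O (latticeOf Λ v) := by rw [hΛL]; exact hproj
    exact Module.Projective.of_equiv (LinearEquiv.ofBijective (latticeOfMap Λ v)
      (latticeOfMap_bijective (Submodule.subset_span.trans hspan.subset) hinj))
  have hdisc : DiscreteTopology Λ.toAddSubgroup := by
    obtain ⟨δ, hδ, h⟩ := exists_pos_forall_norm_lt θ hF hC z.2 (L := (L : Set D)) hb hbL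
    refine discreteTopology_of_isOpen_singleton_zero ?_
    have h1 : ({0} : Set Λ.toAddSubgroup) = Subtype.val ⁻¹' Metric.ball (0 : Fin d → C) δ := by
      ext ⟨u, hu⟩
      rw [Set.mem_singleton_iff, Set.mem_preimage, mem_ball_zero_iff]
      constructor
      · intro h0
        have h2 : u = 0 := congrArg Subtype.val h0
        change ‖u‖ < δ
        rwa [h2, norm_zero]
      · intro hlt
        obtain ⟨x, hx, rfl⟩ := hu
        have h0 := h x hx fun i => (norm_le_pi_norm (x • v) i).trans_lt hlt
        exact Subtype.ext (by change x • v = 0; rw [h0, zero_smul])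
    rw [h1]
    exact Metric.isOpen_ball.preimage continuous_subtype_val
  have hdisc' : let _ := moduleTopology C (Fin d → C); DiscreteTopology Λ := by
    refine (discreteTopology_image_iff (LinearEquiv.refl C (Fin d → C)) _).1 ?_
    have h1 : (LinearEquiv.refl C (Fin d → C)) '' (Λ : Set (Fin d → C)) = Λ := Set.image_id _
    rw [h1]
    exact hdisc
  let P : LatticePair C d O :=
    { V := Fin d → C
      finrank_eq := Module.finrank_fin_fun C
      lattice := Λ
      discrete := hdisc'
      projective := hΛproj
      rank_one := hrank }
  refine ⟨P, LatticePair.hasPeriod_iff.2 ⟨LinearEquiv.refl C (Fin d → C), v,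
    Projectivization.rep_nonzero _, fun _ _ => rfl, hspan,
    (Projectivization.mk_rep _).symm, ?_⟩⟩
  change IsLatticePeriod O (latticeOf Λ v : Set D) g
  rwa [hΛL]

end Pairs

end DLattice

end

theorem mainTheorem7
    {Fq F D C : Type*}
    [Field Fq] [Finite Fq] [Field F] [Algebra Fq F]
    (hF : DLattice.IsCurveFunctionField Fq F)
    (infty : DLattice.Place Fq F)
    [NontriviallyNormedField C] [CompleteSpace C] [IsAlgClosed C]
    [Algebra infty.Completion C] [Algebra F C] [IsScalarTower F infty.Completion C]
    (hC : Continuous (algebraMap infty.Completion C))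
    [Ring D] [Algebra F D] [Algebra.IsCentral F D] [IsSimpleRing D] [FiniteDimensional F D]
    (d : ℕ)
    (θ : infty.Completion ⊗[F] D ≃ₐ[infty.Completion]
      Matrix (Fin d) (Fin d) infty.Completion)
    (O : Subalgebra infty.regularRing D) (hO : DLattice.IsMaximalOrder infty O) :
    ∃ Φ : DLattice.PairClasses C d O ≃ DLattice.DoubleCosets C θ O,
      ∀ (P : DLattice.LatticePair C d O) (z : DLattice.drinfeldSpace infty C d)
        (g : (DLattice.AdelicAlgebra infty D)ˣ),
        Φ (DLattice.PairClasses.mk C d O P) = DLattice.DoubleCosets.mk C θ O z g ↔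
          P.HasPeriod θ z g := by
  classical
  choose z g hzg using DLattice.LatticePair.exists_hasPeriod (O := O) θ hF hC hO
  -- The periods of a pair form exactly one double coset. The choice of `z P` and `g P` is therefore
  -- immaterial, and naturality holds by construction.
  have hclass : ∀ P z' g', DLattice.DoubleCosets.mk C θ O (z P) (g P) =
      DLattice.DoubleCosets.mk C θ O z' g' ↔ P.HasPeriod θ z' g' := by
    intro P z' g'
    refine ⟨fun h => ?_, fun h => (hzg P).mk_eq_mk hF hO h⟩
    obtain ⟨δ, h1, h2⟩ := (DLattice.mk_eq_mk_iff θ).1 h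
    exact (hzg P).smul hF hO δ h1 h2
  let φ : DLattice.PairClasses C d O → DLattice.DoubleCosets C θ O :=
    Quotient.lift (fun P => DLattice.DoubleCosets.mk C θ O (z P) (g P)) fun P Q hPQ =>
      ((hzg P).of_iso hPQ).mk_eq_mk hF hO (hzg Q)
  have hφ : Function.Bijective φ := by
    constructor
    · intro x y hxy
      induction x using Quotient.inductionOn with
      | h P =>
        induction y using Quotient.inductionOn with
        | h Q => exact Quotient.sound (((hclass P _ _).1 hxy).iso hF hO (hzg Q))
    · intro x
      induction x using Quotient.inductionOn with
      | h x =>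
        obtain ⟨z', g'⟩ := x
        induction g' using QuotientGroup.induction_on with
        | H g' =>
          obtain ⟨P, hP⟩ := DLattice.exists_latticePair_hasPeriod θ hF hC hO z' g'
          exact ⟨DLattice.PairClasses.mk C d O P, (hclass P z' g').2 hP⟩
  exact ⟨Equiv.ofBijective φ hφ, hclass⟩
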